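/- Fix $\alpha\in(0,\infty]$ and scalars $\mathbb K=\mathbb R$ or $\mathbb C$; equip $(0,\alpha)$ with Lebesgue measure $\nu$, write $L_r=L_r(0,\alpha)$ for $0<r\le\infty$, and let $L_0$ be the space of (classes of) measurable $f:(0,\alpha)\to\mathbb K$ with $\nu(\{|f|>t\})<\infty$ for some $t$. Put $f^*(t)=\inf\{s\ge 0:\nu(\{|f|>s\})\le t\}$ (so $f^*(t)=0$ for $t\ge\alpha$). A *symmetric space* $E$ is a nonzero linear subspace of $L_0$ with a complete quasi-norm $\|\cdot\|_E$ such that: if $f\in E$ and $|g|\le|f|$ a.e., then $g\in E$ and $\|g\|_E\le\|f\|_E$; and if $f\in E$ and $|g|,|f|$ have the same distribution function, then $g\in E$ and $\|g\|_E=\|f\|_E$. For $0<r\le\infty$ and $0<p<r$, $E$ is an *interpolation space for $(L_p,L_r)$* if $L_p\cap L_r\subset E\subset L_p+L_r$ and there is $C>0$ such that every bounded linear operator $T$ on $L_p+L_r$ which restricts to contractions $L_p\to L_p$ and $L_r\to L_r$ maps $E$ into $E$ with $\|Tf\|_E\le C\|f\|_E$ for all $f\in E$. For $p,q\in(0,\infty)$,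 $E$ is - *left-$p$-monotone* if there is $C>0$ such that for all $f\in E$, $g\in L_0$ with $\int_0^t(|f|^p)^*\ge\int_0^t(|g|^p)^*$ for all $t>0$ one has $g\in E$ and $\|g\|_E\le C\|f\|_E$; - *right-$q$-monotone* if there is $C>0$ such that for all $f\in E$, $g\in L_0$ with $\int_t^\infty(|f|^q)^*\ge\int_t^\infty(|g|^q)^*$ for all $t>0$ one has $g\in E$ and $\|g\|_E\le C\|f\|_E$; - *$p$-convex* if there is $C$ with $\big\|(\sum_{i=1}^n|x_i|^p)^{1/p}\big\|_E\le C\big(\sum_{i=1}^n\|x_i\|_E^p\big)^{1/p}$ for all $n$ and $x_1,\dots,x_n\in E$; - *$q$-concave* if there is $C$ with $\big(\sum_{i=1}^n\|x_i\|_E^q\big)^{1/q}\le C\big\|(\sum_{i=1}^n|x_i|^q)^{1/q}\big\|_E$ for all $n$ and $x_1,\dots,x_n\in E$. $E$ has the *Fatou property* if, whenever $0\le f_n\uparrow f$ a.e. with $f_n\in E$ ($n\in\mathbb N$), $\sup_n\|f_n\|_E<\infty$ and $f\in L_0$, one has $f\in E$ and $\|f_n\|_E\uparrow\|f\|_E$.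 For $t>0$ let $D_tf(s)=f(s/t)$, with $f$ extended by $0$ outside $(0,\alpha)$. The Boyd indices of $E$ are $$\alpha_E=\sup_{0<t<1}\frac{\log\|D_t\|_{E\to E}}{\log t},\qquad \beta_E=\inf_{t>1}\frac{\log\|D_t\|_{E\to E}}{\log t},$$ and $1/0=\infty$. **Theorem.** Let $E$ be a symmetric space and let $p,q\in(0,\infty)$ with $p<q$. Suppose that $E$ satisfies at least one of - (P1) $E$ is left-$p$-monotone, - (P2) $p<1/\beta_E$, - (P3) $E$ has the Fatou property and is $p$-convex, - (P4) $E$ is an interpolation space for $(L_p,L_\infty)$, and at least one of - (Q1) $E$ is right-$q$-monotone, - (Q2) $q>1/\alpha_E$, - (Q3) $E$ has the Fatou property and is $q$-concave. Then $E$ is an interpolation space for the couple $(L_p,L_q)$. -/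

import Mathlib

open MeasureTheory Set Filter Topology
open scoped ENNReal

/-- Lebesgue measure on the interval `(0, α)`, for `α ∈ [0, ∞]`. -/
noncomputable abbrev ivolume (α : ℝ≥0∞) : Measure ℝ :=
  (volume : Measure ℝ).restrict {x : ℝ | 0 < x ∧ ENNReal.ofReal x < α}

/-- Classes, modulo equality almost everywhere, of measurable scalar functions on `(0, α)`. -/
abbrev Fn (𝕜 : Type*) [RCLike 𝕜] (α : ℝ≥0∞) : Type _ := ℝ →ₘ[ivolume α] 𝕜

/-- Membership in `L_0(0, α)`: the set `{|f| > t}` has finite measure for some real `t`. -/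
def MemLZero {𝕜 : Type*} [RCLike 𝕜] {α : ℝ≥0∞} (f : Fn 𝕜 α) : Prop :=
  ∃ t : ℝ, ivolume α {x | t < ‖f x‖} < ∞

/-- The nonincreasing rearrangement on `(0, ∞)` of a nonnegative function on `(0, α)`:
`F^*(t) = inf {s : |{F > s}| ≤ t}`. It vanishes on `[α, ∞)`. -/
noncomputable def rearr (α : ℝ≥0∞) (F : ℝ → ℝ≥0∞) (t : ℝ) : ℝ≥0∞ :=
  sInf {s : ℝ≥0∞ | ivolume α {x | s < F x} ≤ ENNReal.ofReal t}

/-- `F ≻ G`: `∫_0^t F^* ≥ ∫_0^t G^*` for all `t > 0`. -/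
def LeftMajorizes (α : ℝ≥0∞) (F G : ℝ → ℝ≥0∞) : Prop :=
  ∀ t : ℝ, 0 < t → ∫⁻ s in Ioc 0 t, rearr α G s ≤ ∫⁻ s in Ioc 0 t, rearr α F s

/-- `F ▷ G`: `∫_t^∞ F^* ≥ ∫_t^∞ G^*` for all `t > 0`. -/
def RightMajorizes (α : ℝ≥0∞) (F G : ℝ → ℝ≥0∞) : Prop :=
  ∀ t : ℝ, 0 < t → ∫⁻ s in Ioi t, rearr α G s ≤ ∫⁻ s in Ioi t, rearr α F s

/-- The dilation `D_t f (s) = f (s / t)`, where `f` is extended by `0` outside `(0, α)`. -/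
noncomputable def dilation {𝕜 : Type*} [RCLike 𝕜] {α : ℝ≥0∞} (t : ℝ) (f : Fn 𝕜 α) : Fn 𝕜 α :=
  AEEqFun.mk (fun s => ({x : ℝ | 0 < x ∧ ENNReal.ofReal x < α}.indicator f) (s / t))
    ((f.stronglyMeasurable.indicator (measurableSet_Ioi.inter
      (measurableSet_lt ENNReal.measurable_ofReal measurable_const))).comp_measurable
        (measurable_id.div_const t)).aestronglyMeasurable

/-- The function `(∑ i, |x i| ^ p) ^ (1 / p)`. -/
noncomputable def powSum {𝕜 : Type*} [RCLike 𝕜] {α : ℝ≥0∞} (p : ℝ) {n : ℕ}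
    (x : Fin n → Fn 𝕜 α) : Fn 𝕜 α :=
  AEEqFun.mk (fun s => (((∑ i, ‖x i s‖ ^ p) ^ (1 / p) : ℝ) : 𝕜))
    (RCLike.measurable_ofReal.comp
      ((Finset.measurable_sum _ fun i _ => (x i).measurable.norm.pow_const p).pow_const
        (1 / p))).aestronglyMeasurable

/-- The space `L_p + L_q` on `(0, α)`. -/
noncomputable abbrev LpSum (𝕜 : Type*) [RCLike 𝕜] (α p q : ℝ≥0∞) : Submodule 𝕜 (Fn 𝕜 α) :=
  Lp.LpSubmodule 𝕜 𝕜 p (ivolume α) ⊔ Lp.LpSubmodule 𝕜 𝕜 q (ivolume α)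

/-- A (quasi-Banach) symmetric space on `(0, α)`: a nonzero linear subspace of `L_0(0, α)` with a
complete quasi-norm that is increasing (monotone on a solid subspace) and rearrangement
invariant. Only the values of `qnorm` on the subspace are meaningful. -/
structure SymmetricSpace (𝕜 : Type*) [RCLike 𝕜] (α : ℝ≥0∞) where
  /-- the underlying subspace -/
  carrier : Submodule 𝕜 (Fn 𝕜 α)
  /-- the quasi-norm -/
  qnorm : Fn 𝕜 α → ℝ
  memLZero : ∀ f ∈ carrier, MemLZero f
  exists_ne_zero : ∃ f ∈ carrier, f ≠ 0
  qnorm_nonneg : ∀ f ∈ carrier, 0 ≤ qnorm f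
  qnorm_eq_zero_iff : ∀ f ∈ carrier, qnorm f = 0 ↔ f = 0
  qnorm_smul : ∀ (c : 𝕜), ∀ f ∈ carrier, qnorm (c • f) = ‖c‖ * qnorm f
  exists_qnorm_add_le :
    ∃ K : ℝ, ∀ f ∈ carrier, ∀ g ∈ carrier, qnorm (f + g) ≤ K * (qnorm f + qnorm g)
  complete : ∀ u : ℕ → Fn 𝕜 α, (∀ n, u n ∈ carrier) →
    (∀ ε : ℝ, 0 < ε → ∃ N : ℕ, ∀ m ≥ N, ∀ n ≥ N, qnorm (u m - u n) < ε) →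
    ∃ f ∈ carrier, Tendsto (fun n => qnorm (u n - f)) atTop (𝓝 0)
  solid : ∀ f ∈ carrier, ∀ g : Fn 𝕜 α, (∀ᵐ x ∂(ivolume α), ‖g x‖ ≤ ‖f x‖) →
    g ∈ carrier ∧ qnorm g ≤ qnorm f
  rearrangement_invariant : ∀ f ∈ carrier, ∀ g : Fn 𝕜 α,
    (∀ t : ℝ, 0 < t → ivolume α {x | t < ‖g x‖} = ivolume α {x | t < ‖f x‖}) →
    g ∈ carrier ∧ qnorm g = qnorm f

namespace SymmetricSpace

variable {𝕜 : Type*} [RCLike 𝕜] {α : ℝ≥0∞}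

/-- `E` is left-`p`-monotone. -/
def LeftMonotone (E : SymmetricSpace 𝕜 α) (p : ℝ) : Prop :=
  ∃ C : ℝ, 0 < C ∧ ∀ f ∈ E.carrier, ∀ g : Fn 𝕜 α, MemLZero g →
    LeftMajorizes α (fun x => ‖f x‖ₑ ^ p) (fun x => ‖g x‖ₑ ^ p) →
    g ∈ E.carrier ∧ E.qnorm g ≤ C * E.qnorm f

/-- `E` is right-`q`-monotone. -/
def RightMonotone (E : SymmetricSpace 𝕜 α) (q : ℝ) : Prop :=
  ∃ C : ℝ, 0 < C ∧ ∀ f ∈ E.carrier, ∀ g : Fn 𝕜 α, MemLZero g →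
    RightMajorizes α (fun x => ‖f x‖ₑ ^ q) (fun x => ‖g x‖ₑ ^ q) →
    g ∈ E.carrier ∧ E.qnorm g ≤ C * E.qnorm f

/-- The operator norm of the dilation `D_t` on `E`. -/
noncomputable def dilationNorm (E : SymmetricSpace 𝕜 α) (t : ℝ) : ℝ :=
  sInf {C : ℝ | 0 ≤ C ∧ ∀ f ∈ E.carrier, E.qnorm (dilation t f) ≤ C * E.qnorm f}

/-- The Boyd index `α_E`, the supremum over `0 < t < 1` of `log ‖D_t‖ / log t`. These quotients are
nonnegative because `‖D_t‖ ≤ 1` for `t < 1`. -/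
noncomputable def lowerBoyd (E : SymmetricSpace 𝕜 α) : ℝ≥0∞ :=
  ⨆ t ∈ Ioo (0 : ℝ) 1, ENNReal.ofReal (Real.log (E.dilationNorm t) / Real.log t)

/-- The Boyd index `β_E`, the infimum over `t > 1` of `log ‖D_t‖ / log t`. These quotients are
nonnegative because `‖D_t‖ ≥ 1` for `t > 1`. -/
noncomputable def upperBoyd (E : SymmetricSpace 𝕜 α) : ℝ≥0∞ :=
  ⨅ t ∈ Ioi (1 : ℝ), ENNReal.ofReal (Real.log (E.dilationNorm t) / Real.log t)

/-- The Fatou property: if `0 ≤ u n` increases almost everywhere to `f ∈ L_0`, with `u n ∈ E` and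
`‖u n‖_E` bounded, then `f ∈ E` and `‖u n‖_E → ‖f‖_E`. (That `u n ≥ 0` is written `u n = |u n|`.) -/
def Fatou (E : SymmetricSpace 𝕜 α) : Prop :=
  ∀ (u : ℕ → Fn 𝕜 α) (f : Fn 𝕜 α),
    (∀ n, u n ∈ E.carrier) → (∃ B : ℝ, ∀ n, E.qnorm (u n) ≤ B) → MemLZero f →
    (∀ᵐ x ∂(ivolume α), (∀ n, u n x = ((‖u n x‖ : ℝ) : 𝕜)) ∧ Monotone (fun n => ‖u n x‖) ∧
      Tendsto (fun n => u n x) atTop (𝓝 (f x))) →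
    f ∈ E.carrier ∧ Tendsto (fun n => E.qnorm (u n)) atTop (𝓝 (E.qnorm f))

/-- `E` is `p`-convex. -/
def PConvex (E : SymmetricSpace 𝕜 α) (p : ℝ) : Prop :=
  ∃ C : ℝ, ∀ (n : ℕ) (x : Fin n → Fn 𝕜 α), (∀ i, x i ∈ E.carrier) →
    E.qnorm (powSum p x) ≤ C * (∑ i, E.qnorm (x i) ^ p) ^ (1 / p)

/-- `E` is `q`-concave. -/
def QConcave (E : SymmetricSpace 𝕜 α) (q : ℝ) : Prop :=
  ∃ C : ℝ, ∀ (n : ℕ) (x : Fin n → Fn 𝕜 α), (∀ i, x i ∈ E.carrier) →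
    (∑ i, E.qnorm (x i) ^ q) ^ (1 / q) ≤ C * E.qnorm (powSum q x)

/-- `E` is an interpolation space for the couple `(L_p, L_q)` on `(0, α)`: one has
`L_p ∩ L_q ⊆ E ⊆ L_p + L_q`, and there is a constant `C` such that every linear operator on
`L_p + L_q` whose restrictions to `L_p` and to `L_q` are contractions (such an operator is
automatically a contraction on `L_p + L_q`) maps `E` to `E` with norm at most `C`. -/
def IsInterpolation (E : SymmetricSpace 𝕜 α) (p q : ℝ≥0∞) : Prop :=
  Lp.LpSubmodule 𝕜 𝕜 p (ivolume α) ⊓ Lp.LpSubmodule 𝕜 𝕜 q (ivolume α) ≤ E.carrier ∧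
  E.carrier ≤ LpSum 𝕜 α p q ∧
  ∃ C : ℝ, 0 < C ∧
    ∀ T : ↥(LpSum 𝕜 α p q) →ₗ[𝕜] ↥(LpSum 𝕜 α p q),
      (∀ f : ↥(LpSum 𝕜 α p q), (f : Fn 𝕜 α) ∈ Lp.LpSubmodule 𝕜 𝕜 p (ivolume α) →
        eLpNorm (T f : Fn 𝕜 α) p (ivolume α) ≤ eLpNorm (f : Fn 𝕜 α) p (ivolume α)) →
      (∀ f : ↥(LpSum 𝕜 α p q), (f : Fn 𝕜 α) ∈ Lp.LpSubmodule 𝕜 𝕜 q (ivolume α) →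
        eLpNorm (T f : Fn 𝕜 α) q (ivolume α) ≤ eLpNorm (f : Fn 𝕜 α) q (ivolume α)) →
      ∀ f : ↥(LpSum 𝕜 α p q), (f : Fn 𝕜 α) ∈ E.carrier →
        (T f : Fn 𝕜 α) ∈ E.carrier ∧ E.qnorm (T f : Fn 𝕜 α) ≤ C * E.qnorm (f : Fn 𝕜 α)

end SymmetricSpace

/-!
Each of the conditions at `p` implies that `E` is left-`p`-monotone, each of the conditions at `q`
implies that `E` is right-`q`-monotone, and these two monotonicity properties together give the
interpolation property.

The last step is `SymmetricSpace.isInterpolation_of_monotone`. Fix `f` in `E`, an operator `T`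
contracting `L_p` and `L_q`, and a scale `t`. The function `f` splits into a part in `L_p` carrying
the values of `f^*` on `(0, t]` and a part in `L_q` carrying the values beyond `t` (`exists_split`).
The images of the parts under `T` control both the integral of `((T f)^*)^p` over the head `(0, t]`
and the integral of `((T f)^*)^q` over the tail `(t, ∞)` by the larger of the two means of `f^*`
(`exists_head_tail_bound`). Hence, for each `t`, the head or the tail of `(T f)^*` is dominated by
that of a multiple of `f^*`. Cutting `(T f)^*` into its part over the `t` of the first kind and its
part over the `t` of the second kind leaves the heads of the former and the tails of the latter
dominated (`head_rearr_indicator_le`, `tail_rearr_indicator_le`), so that one part is bounded by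
left monotonicity and the other one by right monotonicity.

For the conditions on the Boyd indices (`SymmetricSpace.leftMonotone_of_lt_upperBoyd`,
`SymmetricSpace.rightMonotone_of_lowerBoyd_lt`), some dilation has norm so small that the heads, or
the tails, of `f^*` are bounded by a series of iterated dilations of `f^*` which converges in `E`
(`SymmetricSpace.exists_domBy_dilation_series`); by monotonicity of `g^*`, its values are bounded by
its heads or tails.

The other conditions use monotone transport of mass on the line (`exists_transport`). If the heads
of `(g^*)^p` are dominated by those of `(f^*)^p`, then `(g^*)^p = 2 w ((f^*)^p ∘ φ)`, where `w ≤ 1`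
and `φ` maps the measure `w ds` into Lebesgue measure (`exists_left_transport`). Then
`h ↦ w ^ (1 / p) (h ∘ φ)` contracts `L_p` and `L_∞` and takes `f^*` to a multiple of `g^*`, which
settles interpolation spaces for `(L_p, L_∞)`
(`SymmetricSpace.leftMonotone_of_isInterpolation_top`). In a
`p`-convex space the weight is replaced by an average of indicator functions of sets that have, on
the level sets of a dyadic rounding of `f^* ∘ φ`, the measure prescribed by `w` (`exists_average`);
the `p`-th power of `g^*` is then up to constants an average of `p`-th powers of functions
distributed no more widely than `f` (`SymmetricSpace.PConvex.exists_domBy_rearrFn`). A `q`-concave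
space is treated dually, with a transport that matches tails (`exists_right_transport`):
equidistributed copies of `g^*` have a power mean close to `f^*`
(`SymmetricSpace.QConcave.exists_domBy_indicator`). The cut-offs made on the way are removed by the
Fatou property. -/

/-! ### Distribution functions and rearrangements -/

theorem volume_restrict_Ioi_ofReal_lt (D : ℝ≥0∞) :
    (volume.restrict (Ioi (0 : ℝ))) {t : ℝ | ENNReal.ofReal t < D} = D := by
  rw [Measure.restrict_apply (measurableSet_lt ENNReal.measurable_ofReal measurable_const)]
  rcases eq_or_ne D ⊤ with rfl | hD
  · have : {t : ℝ | ENNReal.ofReal t < ⊤} ∩ Ioi 0 = Ioi 0 := by ext; simp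
    rw [this, Real.volume_Ioi]
  · have : {t : ℝ | ENNReal.ofReal t < D} ∩ Ioi 0 = Ioo 0 D.toReal := by
      ext t
      simp only [mem_inter_iff, mem_ofPred_eq, mem_Ioi, mem_Ioo]
      constructor
      · rintro ⟨h1, h2⟩
        exact ⟨h2, (ENNReal.ofReal_lt_iff_lt_toReal h2.le hD).1 h1⟩
      · rintro ⟨h1, h2⟩
        exact ⟨(ENNReal.ofReal_lt_iff_lt_toReal h1.le hD).2 h2, h1⟩
    rw [this, Real.volume_Ioo, sub_zero, ENNReal.ofReal_toReal hD]

theorem ivolume_ofReal_lt (α D : ℝ≥0∞) :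
    ivolume α {t : ℝ | ENNReal.ofReal t < D} = min D α := by
  rw [← volume_restrict_Ioi_ofReal_lt (min D α),
    Measure.restrict_apply (measurableSet_lt ENNReal.measurable_ofReal measurable_const),
    Measure.restrict_apply (measurableSet_lt ENNReal.measurable_ofReal measurable_const)]
  congr 1
  ext t
  simp only [mem_inter_iff, mem_ofPred_eq, mem_Ioi, lt_min_iff]
  tauto

theorem measurableSet_interval (α : ℝ≥0∞) :
    MeasurableSet {x : ℝ | 0 < x ∧ ENNReal.ofReal x < α} :=
  measurableSet_Ioi.inter (measurableSet_lt ENNReal.measurable_ofReal measurable_const)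

theorem ivolume_univ (α : ℝ≥0∞) : ivolume α univ = α := by
  have := ivolume_ofReal_lt α ⊤
  simpa using this

theorem ivolume_le_restrict_Ioi (α : ℝ≥0∞) : ivolume α ≤ volume.restrict (Ioi (0 : ℝ)) :=
  Measure.restrict_mono (fun _ hx => hx.1) le_rfl

theorem ivolume_le_volume (α : ℝ≥0∞) : ivolume α ≤ volume := Measure.restrict_le_self

theorem ae_ivolume_mem (α : ℝ≥0∞) : ∀ᵐ x ∂(ivolume α), 0 < x ∧ ENNReal.ofReal x < α :=
  ae_restrict_mem (measurableSet_interval α)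

/-- The rearrangement is the generalized inverse of the distribution function. -/
theorem lt_rearr_iff {α : ℝ≥0∞} {F : ℝ → ℝ≥0∞} {t : ℝ} {s : ℝ≥0∞} :
    s < rearr α F t ↔ ENNReal.ofReal t < ivolume α {x | s < F x} := by
  constructor
  · intro h
    by_contra hle
    have h' : rearr α F t ≤ s := sInf_le (not_lt.1 hle)
    exact absurd h (not_lt.2 h')
  · intro h
    by_contra hle
    have hle : rearr α F t ≤ s := not_lt.1 hle
    have hs : s < ⊤ := by
      rcases eq_or_ne s ⊤ with rfl | h'
      · simp at h
      · exact h'.lt_top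
    obtain ⟨u, hu, hu', hlim⟩ := exists_seq_strictAnti_tendsto' hs
    have hU : {x | s < F x} = ⋃ n, {x | u n < F x} := by
      ext x
      simp only [mem_ofPred_eq, mem_iUnion]
      constructor
      · intro hx
        exact (hlim.eventually (gt_mem_nhds hx)).exists
      · rintro ⟨n, hn⟩
        exact (hu' n).1.trans hn
    have hmono : Monotone fun n => {x | u n < F x} := by
      intro m n hmn x hx
      exact (hu.antitone hmn).trans_lt hx
    rw [hU, hmono.measure_iUnion] at h
    refine absurd h (not_lt.2 (iSup_le fun n => ?_))
    have hlt : rearr α F t < u n := hle.trans_lt (hu' n).1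
    obtain ⟨r, hr, hru⟩ := sInf_lt_iff.1 hlt
    exact (measure_mono fun x hx => hru.trans hx).trans hr

theorem rearr_antitone (α : ℝ≥0∞) (F : ℝ → ℝ≥0∞) : Antitone (rearr α F) := fun _ _ hab =>
  le_of_forall_lt fun _ hc => lt_rearr_iff.2
    ((ENNReal.ofReal_le_ofReal hab).trans_lt (lt_rearr_iff.1 hc))

theorem measurable_rearr (α : ℝ≥0∞) (F : ℝ → ℝ≥0∞) : Measurable (rearr α F) :=
  (rearr_antitone α F).measurable

theorem measure_lt_rearr (α : ℝ≥0∞) (F : ℝ → ℝ≥0∞) (s : ℝ≥0∞) :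
    (volume.restrict (Ioi (0 : ℝ))) {t | s < rearr α F t} = ivolume α {x | s < F x} := by
  simp_rw [lt_rearr_iff, volume_restrict_Ioi_ofReal_lt]

theorem ivolume_lt_rearr (α : ℝ≥0∞) (F : ℝ → ℝ≥0∞) (s : ℝ≥0∞) :
    ivolume α {t | s < rearr α F t} = ivolume α {x | s < F x} := by
  simp_rw [lt_rearr_iff, ivolume_ofReal_lt]
  exact min_eq_left ((measure_mono (subset_univ _)).trans_eq (ivolume_univ α))

theorem rearr_mono_distr {α : ℝ≥0∞} {F G : ℝ → ℝ≥0∞}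
    (h : ∀ s, ivolume α {x | s < F x} ≤ ivolume α {x | s < G x}) : rearr α F ≤ rearr α G :=
  fun _ => le_of_forall_lt fun _ hc => lt_rearr_iff.2 ((lt_rearr_iff.1 hc).trans_le (h _))

theorem rearr_congr_distr {α : ℝ≥0∞} {F G : ℝ → ℝ≥0∞}
    (h : ∀ s, ivolume α {x | s < F x} = ivolume α {x | s < G x}) : rearr α F = rearr α G :=
  le_antisymm (rearr_mono_distr fun s => (h s).le) (rearr_mono_distr fun s => (h s).ge)

theorem rearr_rearr (α : ℝ≥0∞) (F : ℝ → ℝ≥0∞) : rearr α (rearr α F) = rearr α F :=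
  rearr_congr_distr (ivolume_lt_rearr α F)

theorem measure_lt_mono_ae {α : ℝ≥0∞} {F G : ℝ → ℝ≥0∞} (h : F ≤ᵐ[ivolume α] G) (s : ℝ≥0∞) :
    ivolume α {x | s < F x} ≤ ivolume α {x | s < G x} :=
  measure_mono_ae (h.mono fun _ hx hs => lt_of_lt_of_le hs hx)

theorem setOf_lt_rpow {X : Type*} (F : X → ℝ≥0∞) {p : ℝ} (hp : 0 < p) (s : ℝ≥0∞) :
    {x | s < F x ^ p} = {x | s ^ (1 / p) < F x} := by
  ext x
  simp only [mem_ofPred_eq]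
  rw [← ENNReal.rpow_lt_rpow_iff (z := p) (x := s ^ (1 / p)) hp, ← ENNReal.rpow_mul,
    one_div_mul_cancel hp.ne', ENNReal.rpow_one]

theorem rearr_rpow (α : ℝ≥0∞) (F : ℝ → ℝ≥0∞) {p : ℝ} (hp : 0 < p) (t : ℝ) :
    rearr α (fun x => F x ^ p) t = rearr α F t ^ p := by
  refine eq_of_forall_lt_iff fun s => ?_
  rw [lt_rearr_iff, setOf_lt_rpow F hp, ← lt_rearr_iff]
  have := setOf_lt_rpow (rearr α F) hp s
  exact (Set.ext_iff.1 this t).symm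

theorem rearr_eq_zero {α : ℝ≥0∞} (F : ℝ → ℝ≥0∞) {t : ℝ} (ht : α ≤ ENNReal.ofReal t) :
    rearr α F t = 0 := by
  by_contra h
  have := lt_rearr_iff.1 (pos_iff_ne_zero.2 h)
  exact absurd this (not_lt.2 (((measure_mono (subset_univ _)).trans_eq (ivolume_univ α)).trans ht))

theorem rearr_lt_top {α : ℝ≥0∞} {F : ℝ → ℝ≥0∞} (hF : Measurable F)
    (hfin : ∀ᵐ x ∂(ivolume α), F x < ⊤) (h0 : ∃ s : ℝ≥0∞, s ≠ ⊤ ∧ ivolume α {x | s < F x} < ⊤)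
    {t : ℝ} (ht : 0 < t) : rearr α F t < ⊤ := by
  by_contra hcon
  have htop : rearr α F t = ⊤ := not_lt_top_iff.1 hcon
  obtain ⟨s, hs, hsm⟩ := h0
  have hanti : Antitone fun n : ℕ => {x | s + n < F x} := by
    intro m n hmn x hx
    have : (m : ℝ≥0∞) ≤ n := by exact_mod_cast hmn
    exact (add_le_add_right this s).trans_lt hx
  have hI := hanti.measure_iInter (μ := ivolume α)
    (fun n => (measurableSet_lt measurable_const hF).nullMeasurableSet)
    ⟨0, by simpa using hsm.ne⟩
  have h1 : ivolume α (⋂ n : ℕ, {x | s + n < F x}) = 0 := by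
    refine measure_mono_null ?_ hfin
    intro x hx hlt
    simp only [mem_iInter, mem_ofPred_eq] at hx
    obtain ⟨n, hn⟩ := ENNReal.exists_nat_gt hlt.ne
    exact absurd ((hx n).trans hn) (not_lt.2 le_add_self)
  have h2 : ENNReal.ofReal t ≤ ⨅ n : ℕ, ivolume α {x | s + n < F x} := by
    refine le_iInf fun n => (lt_rearr_iff.1 ?_).le
    rw [htop]
    exact (ENNReal.add_ne_top.2 ⟨hs, ENNReal.natCast_ne_top n⟩).lt_top
  rw [← hI, h1] at h2
  exact absurd (ENNReal.ofReal_pos.2 ht) (not_lt.2 h2)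

/-- The layer cake formula for `[0, ∞]`-valued functions. -/
theorem lintegral_eq_lintegral_measure_lt {X : Type*} [MeasurableSpace X] (μ : Measure X)
    [SFinite μ] {F : X → ℝ≥0∞} (hF : Measurable F) :
    ∫⁻ x, F x ∂μ = ∫⁻ s in Ioi (0 : ℝ), μ {x | ENNReal.ofReal s < F x} := by
  have hm : MeasurableSet {z : X × ℝ | ENNReal.ofReal z.2 < F z.1} :=
    measurableSet_lt (ENNReal.measurable_ofReal.comp measurable_snd) (hF.comp measurable_fst)
  calc ∫⁻ x, F x ∂μ
      = ∫⁻ x, (volume.restrict (Ioi (0 : ℝ))) (Prod.mk x ⁻¹'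
          {z : X × ℝ | ENNReal.ofReal z.2 < F z.1}) ∂μ := by
        refine lintegral_congr fun x => ?_
        exact (volume_restrict_Ioi_ofReal_lt (F x)).symm
    _ = (μ.prod (volume.restrict (Ioi (0 : ℝ)))) {z : X × ℝ | ENNReal.ofReal z.2 < F z.1} :=
        (Measure.prod_apply hm).symm
    _ = _ := Measure.prod_apply_symm hm

theorem lintegral_le_of_measure_lt_le {X Y : Type*} [MeasurableSpace X] [MeasurableSpace Y]
    {μ : Measure X} {ν : Measure Y} [SFinite μ] [SFinite ν] {F : X → ℝ≥0∞} {G : Y → ℝ≥0∞}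
    (hF : Measurable F) (hG : Measurable G) (h : ∀ s, μ {x | s < F x} ≤ ν {y | s < G y}) :
    ∫⁻ x, F x ∂μ ≤ ∫⁻ y, G y ∂ν := by
  rw [lintegral_eq_lintegral_measure_lt μ hF, lintegral_eq_lintegral_measure_lt ν hG]
  exact lintegral_mono fun s => h _

theorem lintegral_rpow_le_of_measure_lt_le {X Y : Type*} [MeasurableSpace X] [MeasurableSpace Y]
    {μ : Measure X} {ν : Measure Y} [SFinite μ] [SFinite ν] {F : X → ℝ≥0∞} {G : Y → ℝ≥0∞}
    (hF : Measurable F) (hG : Measurable G) {p : ℝ} (hp : 0 < p)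
    (h : ∀ s, μ {x | s < F x} ≤ ν {y | s < G y}) :
    ∫⁻ x, F x ^ p ∂μ ≤ ∫⁻ y, G y ^ p ∂ν := by
  refine lintegral_le_of_measure_lt_le (hF.pow_const p) (hG.pow_const p) fun s => ?_
  rw [setOf_lt_rpow F hp, setOf_lt_rpow G hp]
  exact h _

theorem lintegral_rearr_rpow (α : ℝ≥0∞) {F : ℝ → ℝ≥0∞} (hF : Measurable F) {p : ℝ} (hp : 0 < p) :
    ∫⁻ t in Ioi (0 : ℝ), rearr α F t ^ p = ∫⁻ x, F x ^ p ∂(ivolume α) :=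
  le_antisymm
    (lintegral_rpow_le_of_measure_lt_le (measurable_rearr α F) hF hp
      fun s => (measure_lt_rearr α F s).le)
    (lintegral_rpow_le_of_measure_lt_le hF (measurable_rearr α F) hp
      fun s => (measure_lt_rearr α F s).ge)

theorem lintegral_rearr (α : ℝ≥0∞) {F : ℝ → ℝ≥0∞} (hF : Measurable F) :
    ∫⁻ t in Ioi (0 : ℝ), rearr α F t = ∫⁻ x, F x ∂(ivolume α) := by
  simpa using lintegral_rearr_rpow α hF one_pos

/-- Subadditivity of the rearrangement, with a splitting of the argument. -/
theorem rearr_add_le {α : ℝ≥0∞} {F G H : ℝ → ℝ≥0∞}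
    (h : ∀ᵐ x ∂(ivolume α), F x ≤ G x + H x) {s t : ℝ} (hs : 0 ≤ s) (ht : 0 ≤ t) :
    rearr α F (s + t) ≤ rearr α G s + rearr α H t := by
  refine le_of_forall_lt fun c hc => ?_
  by_contra hle
  have hle := not_lt.1 hle
  have h1 := lt_rearr_iff.1 hc
  have h2 : ivolume α {x | rearr α G s < G x} ≤ ENNReal.ofReal s :=
    not_lt.1 fun h' => lt_irrefl _ (lt_rearr_iff.2 h')
  have h3 : ivolume α {x | rearr α H t < H x} ≤ ENNReal.ofReal t :=
    not_lt.1 fun h' => lt_irrefl _ (lt_rearr_iff.2 h')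
  rw [ENNReal.ofReal_add hs ht] at h1
  refine absurd h1 (not_lt.2 (le_trans ?_ (add_le_add h2 h3)))
  refine (measure_mono_ae ?_).trans (measure_union_le _ _)
  filter_upwards [h] with x hx hcx
  by_contra hn
  have hn' : ¬ (rearr α G s < G x) ∧ ¬ (rearr α H t < H x) := not_or.1 hn
  exact absurd ((lt_of_lt_of_le hcx hx).trans_le
    (add_le_add (not_lt.1 hn'.1) (not_lt.1 hn'.2))) (not_lt.2 hle)

theorem rearr_zero_le_of_ae_le {α : ℝ≥0∞} {H : ℝ → ℝ≥0∞} {c : ℝ≥0∞}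
    (h : ∀ᵐ x ∂(ivolume α), H x ≤ c) : rearr α H 0 ≤ c := by
  refine sInf_le ?_
  have : ivolume α {x | c < H x} = 0 := by
    refine measure_mono_null (fun x hx => ?_) h
    have hx : c < H x := hx
    exact not_le.2 hx
  simp [this]

/-! ### Distribution functions of atomless measures on the line, and monotone transport -/

section CDF

variable {μ : Measure ℝ}

theorem exists_measure_Iic_lt (hfin : ∀ x, μ (Iic x) ≠ ⊤) {v : ℝ≥0∞} (hv : 0 < v) :
    ∃ x, μ (Iic x) < v := by
  have hanti : Antitone fun n : ℕ => Iic (-(n : ℝ)) := by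
    intro m n hmn
    exact Iic_subset_Iic.2 (neg_le_neg (by exact_mod_cast hmn))
  have hI := tendsto_measure_iInter_atTop (μ := μ)
    (fun n : ℕ => (measurableSet_Iic : MeasurableSet (Iic (-(n : ℝ)))).nullMeasurableSet)
    hanti ⟨0, hfin _⟩
  have h0 : (⋂ n : ℕ, Iic (-(n : ℝ))) = ∅ := by
    refine eq_empty_iff_forall_notMem.2 fun x hx => ?_
    obtain ⟨n, hn⟩ := exists_nat_gt (-x)
    have : x ≤ -(n : ℝ) := mem_iInter.1 hx n
    linarith
  rw [h0, measure_empty] at hI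
  obtain ⟨n, hn⟩ := (hI.eventually (gt_mem_nhds hv)).exists
  exact ⟨_, hn⟩

theorem measure_Iic_mono : Monotone fun x => μ (Iic x) :=
  fun _ _ h => measure_mono (Iic_subset_Iic.2 h)

theorem le_measure_Iic_of_forall_gt (hfin : ∀ x, μ (Iic x) ≠ ⊤) {v : ℝ≥0∞} {a : ℝ}
    (h : ∀ x, a < x → v ≤ μ (Iic x)) : v ≤ μ (Iic a) := by
  obtain ⟨u, hu, hu', hlim⟩ := exists_seq_strictAnti_tendsto a
  have hI := tendsto_measure_iInter_atTop (μ := μ)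
    (fun n => (measurableSet_Iic : MeasurableSet (Iic (u n))).nullMeasurableSet)
    (fun _ _ h => Iic_subset_Iic.2 (hu.antitone h)) ⟨0, hfin _⟩
  have h0 : (⋂ n : ℕ, Iic (u n)) = Iic a := by
    ext x
    simp only [mem_iInter, mem_Iic]
    exact ⟨fun hx => ge_of_tendsto' hlim hx, fun hx n => hx.trans (hu' n).le⟩
  rw [h0] at hI
  exact ge_of_tendsto' hI fun n => h _ (hu' n)

theorem measure_Iic_le_of_forall_lt [NullSingletonClass μ] {v : ℝ≥0∞} {a : ℝ}
    (h : ∀ x, x < a → μ (Iic x) ≤ v) : μ (Iic a) ≤ v := by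
  rw [← measure_congr (Iio_ae_eq_Iic (μ := μ) (a := a))]
  obtain ⟨u, hu, hu', hlim⟩ := exists_seq_strictMono_tendsto a
  have h0 : Iio a = ⋃ n : ℕ, Iic (u n) := by
    ext x
    simp only [mem_iUnion, mem_Iic, mem_Iio]
    constructor
    · intro hx
      obtain ⟨n, hn⟩ := (hlim.eventually (lt_mem_nhds hx)).exists
      exact ⟨n, hn.le⟩
    · rintro ⟨n, hn⟩
      exact hn.trans_lt (hu' n)
  have hmono : Monotone fun n => Iic (u n) := fun _ _ h => Iic_subset_Iic.2 (hu.monotone h)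
  rw [h0, hmono.measure_iUnion]
  exact iSup_le fun n => h _ (hu' n)

/-- The intermediate value property of the distribution function of an atomless measure, in the
form that sublevel sets are half-lines of the expected measure. -/
theorem exists_setOf_measure_Iic_le_eq [NullSingletonClass μ] (hfin : ∀ x, μ (Iic x) ≠ ⊤) {v : ℝ≥0∞}
    (hv0 : 0 < v) (hv : v < μ univ) :
    ∃ a, μ (Iic a) = v ∧ {x | μ (Iic x) ≤ v} = Iic a := by
  have hne : {x | μ (Iic x) ≤ v}.Nonempty := by
    obtain ⟨x, hx⟩ := exists_measure_Iic_lt hfin hv0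
    exact ⟨x, hx.le⟩
  obtain ⟨b, hb⟩ := ((tendsto_measure_Iic_atTop μ).eventually (lt_mem_nhds hv)).exists
  have hbdd : BddAbove {x | μ (Iic x) ≤ v} := by
    refine ⟨b, fun x hx => ?_⟩
    by_contra hlt
    have hx : μ (Iic x) ≤ v := hx
    exact absurd (hb.trans_le (measure_Iic_mono (not_le.1 hlt).le)) (not_lt.2 hx)
  have hle : μ (Iic (sSup {x | μ (Iic x) ≤ v})) ≤ v := by
    refine measure_Iic_le_of_forall_lt fun x hx => ?_
    obtain ⟨y, hy, hxy⟩ := exists_lt_of_lt_csSup hne hx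
    exact (measure_Iic_mono hxy.le).trans hy
  have hge : v ≤ μ (Iic (sSup {x | μ (Iic x) ≤ v})) := by
    refine le_measure_Iic_of_forall_gt hfin fun x hx => ?_
    by_contra hlt
    have : x ∈ {x | μ (Iic x) ≤ v} := (not_le.1 hlt).le
    exact absurd (le_csSup hbdd this) (not_le.2 hx)
  refine ⟨_, le_antisymm hle hge, ?_⟩
  ext x
  exact ⟨fun hx => le_csSup hbdd hx, fun hx => (measure_Iic_mono hx).trans hle⟩

theorem measure_setOf_measure_Iic_le [NullSingletonClass μ] (hfin : ∀ x, μ (Iic x) ≠ ⊤) {v : ℝ≥0∞}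
    (hv : v ≤ μ univ) : μ {x | μ (Iic x) ≤ v} = v := by
  rcases hv.eq_or_lt with rfl | hlt
  · congr 1
    exact eq_univ_of_forall fun x => measure_mono (subset_univ _)
  rcases eq_or_ne v 0 with rfl | h0
  · refine le_antisymm (le_of_forall_gt fun c hc => ?_) zero_le
    obtain ⟨d, hd, hd'⟩ := exists_between (lt_min hc hlt)
    obtain ⟨a, ha, ha'⟩ := exists_setOf_measure_Iic_le_eq hfin hd (lt_min_iff.1 hd').2
    refine lt_of_le_of_lt ?_ (lt_min_iff.1 hd').1
    rw [← ha, ← ha']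
    exact measure_mono fun x hx => le_trans hx hd.le
  · obtain ⟨a, ha, ha'⟩ := exists_setOf_measure_Iic_le_eq hfin (pos_iff_ne_zero.2 h0) hlt
    rw [ha', ha]

theorem measure_setOf_measure_Iic_lt [NullSingletonClass μ] (hfin : ∀ x, μ (Iic x) ≠ ⊤) {v : ℝ≥0∞}
    (hv : v ≤ μ univ) : μ {x | μ (Iic x) < v} = v := by
  have hsub : {x | μ (Iic x) < v} ⊆ {x | μ (Iic x) ≤ v} := fun x (hx : μ (Iic x) < v) => hx.le
  refine le_antisymm ((measure_mono hsub).trans_eq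
    (measure_setOf_measure_Iic_le hfin hv)) (le_of_forall_lt fun c hc => ?_)
  obtain ⟨d, hd, hd'⟩ := exists_between hc
  refine hd.trans_le ?_
  rw [← measure_setOf_measure_Iic_le hfin (hd'.le.trans hv)]
  exact measure_mono fun x hx => lt_of_le_of_lt hx hd'

theorem ae_measure_Iic_pos [NullSingletonClass μ] (hfin : ∀ x, μ (Iic x) ≠ ⊤) :
    ∀ᵐ x ∂μ, 0 < μ (Iic x) := by
  have := measure_setOf_measure_Iic_le hfin (zero_le (a := μ univ))
  rw [ae_iff]
  simpa using this

theorem ae_measure_Iic_lt_univ [NullSingletonClass μ] (hfin : ∀ x, μ (Iic x) ≠ ⊤) :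
    ∀ᵐ x ∂μ, μ (Iic x) < μ univ := by
  rcases eq_or_ne (μ univ) ⊤ with h | h
  · exact Eventually.of_forall fun x => h ▸ (hfin x).lt_top
  · have hm : MeasurableSet {x | μ (Iic x) < μ univ} :=
      measurableSet_lt measure_Iic_mono.measurable measurable_const
    have : IsFiniteMeasure μ := ⟨h.lt_top⟩
    have h2 := measure_compl hm (measure_ne_top μ _)
    rw [measure_setOf_measure_Iic_lt hfin le_rfl, tsub_self] at h2
    rw [ae_iff]
    exact h2

/-- Monotone transport between atomless measures on the line: the mass of `μ` can be moved into
`ν` so that almost every point and its image have the same cumulative mass. -/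
theorem exists_transport {ν : Measure ℝ} [NullSingletonClass μ] [NullSingletonClass ν]
    (hμ : ∀ x, μ (Iic x) ≠ ⊤) (hν : ∀ x, ν (Iic x) ≠ ⊤) (hle : μ univ ≤ ν univ) :
    ∃ φ : ℝ → ℝ, Measurable φ ∧ μ.map φ ≤ ν ∧
      ∀ᵐ s ∂μ, 0 < μ (Iic s) ∧ ν (Iic (φ s)) = μ (Iic s) := by
  classical
  set G : Set ℝ := {s | 0 < μ (Iic s) ∧ μ (Iic s) < ν univ} with hG
  have hGm : MeasurableSet G :=
    (measurableSet_lt measurable_const measure_Iic_mono.measurable).inter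
      (measurableSet_lt measure_Iic_mono.measurable measurable_const)
  have hGae : ∀ᵐ s ∂μ, s ∈ G := by
    filter_upwards [ae_measure_Iic_pos hμ, ae_measure_Iic_lt_univ hμ] with s h1 h2
    exact ⟨h1, h2.trans_le hle⟩
  -- on `G` the set below is nonempty and bounded below, so that its infimum is meaningful
  set φ : ℝ → ℝ := fun s => if s ∈ G then sInf {u | μ (Iic s) ≤ ν (Iic u)} else 0 with hφ
  have key : ∀ s ∈ G, ν (Iic (φ s)) = μ (Iic s) ∧ ∀ u, φ s ≤ u ↔ μ (Iic s) ≤ ν (Iic u) := by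
    intro s hs
    obtain ⟨a, ha, -⟩ := exists_setOf_measure_Iic_le_eq hν hs.1 hs.2
    have hne : {u | μ (Iic s) ≤ ν (Iic u)}.Nonempty := ⟨a, ha.ge⟩
    obtain ⟨b, hb⟩ := exists_measure_Iic_lt hν hs.1
    have hbdd : BddBelow {u | μ (Iic s) ≤ ν (Iic u)} := by
      refine ⟨b, fun u hu => ?_⟩
      by_contra hlt
      have hu : μ (Iic s) ≤ ν (Iic u) := hu
      exact absurd (hb.trans_le hu) (not_lt.2 (measure_Iic_mono (not_le.1 hlt).le))
    have hφs : φ s = sInf {u | μ (Iic s) ≤ ν (Iic u)} := if_pos hs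
    have hge : μ (Iic s) ≤ ν (Iic (φ s)) := by
      refine le_measure_Iic_of_forall_gt hν fun x hx => ?_
      rw [hφs] at hx
      obtain ⟨y, hy, hxy⟩ := exists_lt_of_csInf_lt hne hx
      exact le_trans hy (measure_Iic_mono hxy.le)
    have hmin : ∀ u, μ (Iic s) ≤ ν (Iic u) → φ s ≤ u := fun u hu => by
      rw [hφs]
      exact csInf_le hbdd hu
    exact ⟨le_antisymm ((measure_Iic_mono (hmin a ha.ge)).trans_eq ha) hge,
      fun u => ⟨fun hu => hge.trans (measure_Iic_mono hu), hmin u⟩⟩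
  have hφm : Measurable φ := by
    refine measurable_of_Iic fun u => ?_
    have : φ ⁻¹' Iic u = (G ∩ {s | μ (Iic s) ≤ ν (Iic u)}) ∪ (Gᶜ ∩ {_s | (0 : ℝ) ≤ u}) := by
      ext s
      by_cases hs : s ∈ G
      · simp [hs, (key s hs).2 u]
      · have : φ s = 0 := if_neg hs
        simp [hs, this]
    rw [this]
    exact (hGm.inter (measurableSet_le measure_Iic_mono.measurable measurable_const)).union
      (hGm.compl.inter (MeasurableSet.const _))
  refine ⟨φ, hφm, ?_, hGae.mono fun s hs => ⟨hs.1, (key s hs).1⟩⟩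
  have hmapIic : ∀ u, μ.map φ (Iic u) = μ {s | μ (Iic s) ≤ ν (Iic u)} := by
    intro u
    rw [Measure.map_apply hφm measurableSet_Iic]
    refine measure_congr ?_
    filter_upwards [hGae] with s hs
    exact propext ((key s hs).2 u)
  have hVm : MeasurableSet {x | ν (Iic x) < μ univ} :=
    measurableSet_lt measure_Iic_mono.measurable measurable_const
  have hIic : ∀ u, μ.map φ (Iic u) = ν.restrict {x | ν (Iic x) < μ univ} (Iic u) := by
    intro u
    rw [hmapIic, Measure.restrict_apply measurableSet_Iic]
    rcases lt_or_ge (ν (Iic u)) (μ univ) with h | h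
    · rw [measure_setOf_measure_Iic_le hμ h.le, inter_eq_left.2]
      exact fun x hx => (measure_Iic_mono hx).trans_lt h
    · have h1 : {s | μ (Iic s) ≤ ν (Iic u)} = univ :=
        eq_univ_of_forall fun s => (measure_mono (subset_univ _)).trans h
      rw [h1, inter_eq_right.2, measure_setOf_measure_Iic_lt hν hle]
      intro x hx
      have hx : ν (Iic x) < μ univ := hx
      by_contra hlt
      exact absurd (hx.trans_le h) (not_lt.2 (measure_Iic_mono (not_le.1 hlt).le))
  have hfin : ∀ u, ν.restrict {x | ν (Iic x) < μ univ} (Iic u) ≠ ⊤ := fun u =>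
    ne_top_of_le_ne_top (hν u) (Measure.restrict_apply_le _ _)
  have : μ.map φ = ν.restrict {x | ν (Iic x) < μ univ} := by
    refine Measure.ext_of_Ioc' _ _ (fun a b _ => ?_) fun a b hab => ?_
    · refine ne_top_of_le_ne_top (hfin b) ?_
      rw [← hIic]
      exact measure_mono Ioc_subset_Iic_self
    · rw [← Iic_sdiff_Iic, measure_sdiff (Iic_subset_Iic.2 hab.le)
        measurableSet_Iic.nullMeasurableSet (by rw [hIic]; exact hfin a),
        measure_sdiff (Iic_subset_Iic.2 hab.le) measurableSet_Iic.nullMeasurableSet (hfin a),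
        hIic, hIic]
  rw [this]
  exact Measure.restrict_le_self

end CDF

/-! ### Equidistributed colourings and averages of indicator functions -/

/-- A finite atomless measure splits into `M` sets of equal measure: a point is coloured according
to its cumulative mass. -/
theorem exists_coloring (ρ : Measure ℝ) [IsFiniteMeasure ρ] [NullSingletonClass ρ] (M : ℕ)
    [NeZero M] : ∃ c : ℝ → Fin M, Measurable c ∧ ∀ i, ρ (c ⁻¹' {i}) = ρ univ / M := by
  have hfin : ∀ x, ρ (Iic x) ≠ ⊤ := fun x => measure_ne_top _ _
  rcases eq_or_ne (ρ univ) 0 with h0 | h0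
  · refine ⟨fun _ => 0, measurable_const, fun i => ?_⟩
    rw [h0, ENNReal.zero_div]
    exact measure_mono_null (subset_univ _) h0
  have hM : (0 : ℝ) < M := by exact_mod_cast Nat.pos_of_ne_zero (NeZero.ne M)
  set m : ℝ := (ρ univ).toReal with hm
  have hm0 : 0 < m := ENNReal.toReal_pos h0 (measure_ne_top _ _)
  have hmρ : ENNReal.ofReal m = ρ univ := ENNReal.ofReal_toReal (measure_ne_top _ _)
  have hVm : Measurable fun x => (ρ (Iic x)).toReal :=
    (measure_Iic_mono (μ := ρ)).measurable.ennreal_toReal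
  set C : ℝ → ℕ := fun x => ⌊M * (ρ (Iic x)).toReal / m⌋₊ with hC
  have hCm : Measurable C := Nat.measurable_floor.comp ((hVm.const_mul _).div_const _)
  refine ⟨fun x => Fin.ofNat M (C x), (measurable_from_nat (f := Fin.ofNat M)).comp hCm,
    fun i => ?_⟩
  have hset : ∀ j : ℕ, MeasurableSet {x | ρ (Iic x) < ENNReal.ofReal (j * m / M)} := fun j =>
    measurableSet_lt measure_Iic_mono.measurable measurable_const
  have hmeas : ∀ j : ℕ, j ≤ M → ρ {x | ρ (Iic x) < ENNReal.ofReal (j * m / M)} =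
      ENNReal.ofReal (j * m / M) := by
    intro j hj
    refine measure_setOf_measure_Iic_lt hfin ?_
    rw [← hmρ]
    refine ENNReal.ofReal_le_ofReal ?_
    have : (j : ℝ) ≤ M := by exact_mod_cast hj
    rw [div_le_iff₀ hM, mul_comm]
    gcongr
  have hcongr : ρ ((fun x => Fin.ofNat M (C x)) ⁻¹' {i}) =
      ρ ({x | ρ (Iic x) < ENNReal.ofReal ((i.1 + 1 : ℕ) * m / M)} \
        {x | ρ (Iic x) < ENNReal.ofReal ((i.1 : ℕ) * m / M)}) := by
    refine measure_congr ?_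
    filter_upwards [ae_measure_Iic_lt_univ hfin] with x hx
    have hv : (ρ (Iic x)).toReal < m :=
      (ENNReal.toReal_lt_toReal (hfin x) (measure_ne_top _ _)).2 hx
    have hv0 : 0 ≤ (ρ (Iic x)).toReal := ENNReal.toReal_nonneg
    have hCx : C x < M := by
      refine (Nat.floor_lt (by positivity)).2 ?_
      rw [div_lt_iff₀ hm0]
      gcongr
    have hlt : ∀ j : ℕ, ρ (Iic x) < ENNReal.ofReal (j * m / M) ↔ C x < j := by
      intro j
      rw [ENNReal.lt_ofReal_iff_toReal_lt (hfin x), hC, Nat.floor_lt (by positivity),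
        lt_div_iff₀ hM, div_lt_iff₀ hm0, mul_comm (M : ℝ)]
    have h1 : (Fin.ofNat M (C x) = i) ↔ C x = i.1 := by
      rw [Fin.ext_iff, Fin.val_ofNat, Nat.mod_eq_of_lt hCx]
    refine propext (h1.trans ?_)
    change _ ↔ (ρ (Iic x) < _ ∧ ¬ (ρ (Iic x) < _))
    rw [hlt, hlt]
    omega
  rw [hcongr, measure_sdiff _ (hset _).nullMeasurableSet (measure_ne_top _ _), hmeas _ i.2,
    hmeas _ i.2.le, ← ENNReal.ofReal_sub _ (by positivity), ← hmρ, ← ENNReal.ofReal_natCast,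
    ← ENNReal.ofReal_div_of_pos hM]
  · congr 1
    push_cast
    ring
  · intro x hx
    refine lt_of_lt_of_le hx (ENNReal.ofReal_le_ofReal ?_)
    push_cast
    gcongr
    linarith

/-- A multiple `A (k x) / M` of the measure is the average of `M` restrictions of it to measurable
sets, as far as sets described by the key `k` are concerned. -/
theorem exists_average_of_key {ι : Type*} [Countable ι] [MeasurableSpace ι]
    [DiscreteMeasurableSpace ι] (μ : Measure ℝ) [NullSingletonClass μ] (k : ℝ → ι)
    (hk : Measurable k) (hfin : ∀ κ, μ (k ⁻¹' {κ}) ≠ ⊤) (M : ℕ) [NeZero M] (A : ι → ℕ)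
    (hA : ∀ κ, A κ ≤ M) :
    ∃ P : Fin M → Set ℝ, (∀ i, MeasurableSet (P i)) ∧
      (∀ x (y : ℝ), ∑ i, (P i).indicator (fun _ => y) x = A (k x) * y) ∧
      ∀ i (S : Set ι), μ (k ⁻¹' S ∩ P i) = ∫⁻ x in k ⁻¹' S, (A (k x) : ℝ≥0∞) / M ∂μ := by
  classical
  have hcol : ∀ κ, ∃ c : ℝ → Fin M, Measurable c ∧
      ∀ i, μ (k ⁻¹' {κ} ∩ c ⁻¹' {i}) = μ (k ⁻¹' {κ}) / M := by
    intro κ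
    have : IsFiniteMeasure (μ.restrict (k ⁻¹' {κ})) :=
      ⟨by rw [Measure.restrict_apply_univ]; exact (hfin κ).lt_top⟩
    obtain ⟨c, hc, hci⟩ := exists_coloring (μ.restrict (k ⁻¹' {κ})) M
    refine ⟨c, hc, fun i => ?_⟩
    have := hci i
    rwa [Measure.restrict_apply (hc (measurableSet_singleton i)), Measure.restrict_apply_univ,
      inter_comm] at this
  choose c hcm hc using hcol
  -- The colour of `x`, shifted by `i` modulo `M`, is below `A (k x)` for exactly `A (k x)` of the
  -- indices `i`; and for each `i` this happens on `A κ` of the `M` colour classes of `k ⁻¹' {κ}`.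
  set P : Fin M → Set ℝ := fun i => {x | (c (k x) x + i).1 < A (k x)} with hP
  have hPk : ∀ i κ, k ⁻¹' {κ} ∩ P i = k ⁻¹' {κ} ∩ c κ ⁻¹' {j | (j + i).1 < A κ} := by
    intro i κ
    ext x
    simp only [hP, mem_inter_iff, mem_preimage, mem_singleton_iff, mem_ofPred_eq]
    constructor
    · rintro ⟨rfl, h⟩; exact ⟨rfl, h⟩
    · rintro ⟨rfl, h⟩; exact ⟨rfl, h⟩
  have hPm : ∀ i, MeasurableSet (P i) := by
    intro i
    have : P i = ⋃ κ, k ⁻¹' {κ} ∩ c κ ⁻¹' {j | (j + i).1 < A κ} := by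
      simp_rw [← hPk, ← iUnion_inter]
      rw [iUnion_eq_univ_iff.2 fun x => ⟨k x, rfl⟩, univ_inter]
    rw [this]
    exact MeasurableSet.iUnion fun κ => (hk (measurableSet_singleton κ)).inter
      (hcm κ (Set.toFinite _).measurableSet)
  have hcard : ∀ (a : ℕ), a ≤ M → Finset.card {j : Fin M | j.1 < a} = a := by
    intro a ha
    rw [Fin.card_filter_val_lt, min_eq_right ha]
  refine ⟨P, hPm, fun x y => ?_, fun i S => ?_⟩
  · simp_rw [indicator_apply]
    rw [← Finset.sum_filter, Finset.sum_const, nsmul_eq_mul]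
    congr 2
    refine Eq.trans ?_ (hcard (A (k x)) (hA _))
    refine Finset.card_bij (fun j _ => c (k x) x + j) ?_ ?_ ?_
    · intro j hj
      simpa [hP] using hj
    · intro a _ b _ h
      exact add_left_cancel h
    · intro b hb
      refine ⟨b - c (k x) x, ?_, by simp⟩
      simpa [hP] using hb
  · have hS : MeasurableSet (k ⁻¹' S) := hk S.to_countable.measurableSet
    have key : (μ.restrict (P i)).map k =
        (μ.withDensity fun x => (A (k x) : ℝ≥0∞) / M).map k := by
      refine Measure.ext_of_singleton fun κ => ?_
      have hκ : MeasurableSet (k ⁻¹' {κ}) := hk (measurableSet_singleton κ)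
      rw [Measure.map_apply hk (measurableSet_singleton κ),
        Measure.map_apply hk (measurableSet_singleton κ), Measure.restrict_apply hκ, hPk,
        withDensity_apply _ hκ]
      have h1 : ∫⁻ x in k ⁻¹' {κ}, (A (k x) : ℝ≥0∞) / M ∂μ = A κ / M * μ (k ⁻¹' {κ}) := by
        rw [← setLIntegral_const]
        refine setLIntegral_congr_fun hκ fun x hx => ?_
        have : k x = κ := hx
        simp only [this]
      have h2 : k ⁻¹' {κ} ∩ c κ ⁻¹' {j | (j + i).1 < A κ} =
          ⋃ j ∈ (Finset.univ.filter fun j : Fin M => (j + i).1 < A κ),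
            k ⁻¹' {κ} ∩ c κ ⁻¹' {j} := by
        ext x
        simp
      rw [h1, h2, measure_biUnion_finset]
      · simp_rw [hc]
        rw [Finset.sum_const, nsmul_eq_mul]
        have : Finset.card (Finset.univ.filter fun j : Fin M => (j + i).1 < A κ) = A κ := by
          conv_rhs => rw [← hcard (A κ) (hA _)]
          refine Finset.card_bij (fun j _ => j + i) ?_ ?_ ?_
          · intro j hj
            simpa using hj
          · intro a _ b _ h
            exact add_right_cancel h
          · intro b hb
            exact ⟨b - i, by simpa using hb, by simp⟩
        rw [this, ENNReal.div_eq_inv_mul, ENNReal.div_eq_inv_mul]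
        ring
      · intro j _ j' _ hjj'
        refine Set.disjoint_left.2 fun x hx hx' => hjj' ?_
        exact hx.2.symm.trans hx'.2
      · exact fun j _ => hκ.inter (hcm κ (measurableSet_singleton j))
    have := congrArg (fun ν => ν S) key
    rwa [Measure.map_apply hk S.to_countable.measurableSet,
      Measure.map_apply hk S.to_countable.measurableSet, Measure.restrict_apply hS,
      withDensity_apply _ hS] at this

/-- The weight `a / M` is the average of `M` indicator functions of sets which, on each union of
level sets of `j`, have the same measure as the weight. The key consists of `j`, of `a`, and of the
integer part of the variable, which makes its level sets have finite measure. -/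
theorem exists_average (α : ℝ≥0∞) (j : ℝ → ℤ) (hj : Measurable j) (M : ℕ) [NeZero M] (a : ℝ → ℕ)
    (ha : Measurable a) (haM : ∀ x, a x ≤ M) :
    ∃ P : Fin M → Set ℝ, (∀ i, MeasurableSet (P i)) ∧
      (∀ x (y : ℝ), ∑ i, (P i).indicator (fun _ => y) x = a x * y) ∧
      ∀ i (S : Set ℤ), ivolume α (j ⁻¹' S ∩ P i) =
        ∫⁻ x in j ⁻¹' S, (a x : ℝ≥0∞) / M ∂(ivolume α) := by
  obtain ⟨P, hP, hcard, hmeas⟩ := exists_average_of_key (ι := ℤ × ℕ × ℤ) (ivolume α)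
    (fun x => (j x, a x, ⌊x⌋)) (hj.prodMk (ha.prodMk Int.measurable_floor))
    (fun κ => by
      refine ne_top_of_le_ne_top (b := volume (Ico (κ.2.2 : ℝ) (κ.2.2 + 1))) (by simp) ?_
      refine (ivolume_le_volume α _).trans (measure_mono fun x hx => ?_)
      have hx : (j x, a x, ⌊x⌋) = κ := hx
      have : ⌊x⌋ = κ.2.2 := by rw [← hx]
      exact Int.floor_eq_iff.1 this) M (fun κ => min κ.2.1 M) (fun κ => min_le_right _ _)
  refine ⟨P, hP, fun x y => ?_, fun i S => ?_⟩
  · rw [hcard x y]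
    simp only [min_eq_left (haM x)]
  have := hmeas i (Prod.fst ⁻¹' S)
  simp only [min_eq_left (haM _)] at this
  exact this

/-! ### Domination by elements of a symmetric space -/

/-- The class of the real-valued function underlying a `[0, ∞]`-valued function (the value `∞`
becomes `0`). -/
noncomputable def toFn (𝕜 : Type*) [RCLike 𝕜] (α : ℝ≥0∞) (h : ℝ → ℝ≥0∞) (hm : Measurable h) :
    Fn 𝕜 α :=
  AEEqFun.mk (fun x => (((h x).toReal : ℝ) : 𝕜))
    (RCLike.measurable_ofReal.comp hm.ennreal_toReal).aestronglyMeasurable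

/-- The distribution function of `h` is finite somewhere. -/
def FiniteDistr (α : ℝ≥0∞) (h : ℝ → ℝ≥0∞) : Prop :=
  ∃ s : ℝ≥0∞, s ≠ ⊤ ∧ ivolume α {x | s < h x} < ⊤

section

variable {𝕜 : Type*} [RCLike 𝕜] {α : ℝ≥0∞}

theorem measurable_enorm_fn (f : Fn 𝕜 α) : Measurable fun x => ‖f x‖ₑ :=
  f.measurable.enorm

theorem coeFn_toFn (h : ℝ → ℝ≥0∞) (hm : Measurable h) :
    ∀ᵐ x ∂(ivolume α), toFn 𝕜 α h hm x = (((h x).toReal : ℝ) : 𝕜) :=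
  AEEqFun.coeFn_mk _ _

theorem enorm_toFn_le (h : ℝ → ℝ≥0∞) (hm : Measurable h) :
    ∀ᵐ x ∂(ivolume α), ‖toFn 𝕜 α h hm x‖ₑ ≤ h x := by
  filter_upwards [coeFn_toFn (𝕜 := 𝕜) h hm] with x hx
  rw [hx, ← ofReal_norm, RCLike.norm_ofReal, abs_of_nonneg ENNReal.toReal_nonneg]
  exact ENNReal.ofReal_toReal_le

theorem enorm_toFn (h : ℝ → ℝ≥0∞) (hm : Measurable h) (hfin : ∀ᵐ x ∂(ivolume α), h x < ⊤) :
    ∀ᵐ x ∂(ivolume α), ‖toFn 𝕜 α h hm x‖ₑ = h x := by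
  filter_upwards [coeFn_toFn (𝕜 := 𝕜) h hm, hfin] with x hx hfx
  rw [hx, ← ofReal_norm, RCLike.norm_ofReal, abs_of_nonneg ENNReal.toReal_nonneg,
    ENNReal.ofReal_toReal hfx.ne]

theorem measure_lt_congr_ae {F G : ℝ → ℝ≥0∞} (h : ∀ᵐ x ∂(ivolume α), F x = G x) (s : ℝ≥0∞) :
    ivolume α {x | s < F x} = ivolume α {x | s < G x} :=
  le_antisymm (measure_lt_mono_ae (h.mono fun _ hx => hx.le) s)
    (measure_lt_mono_ae (h.mono fun _ hx => hx.ge) s)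

theorem setOf_lt_norm (f : Fn 𝕜 α) {t : ℝ} (ht : 0 ≤ t) :
    {x | t < ‖f x‖} = {x | ENNReal.ofReal t < ‖f x‖ₑ} := by
  ext x
  change t < ‖f x‖ ↔ ENNReal.ofReal t < ‖f x‖ₑ
  rw [← ofReal_norm, ENNReal.ofReal_lt_ofReal_iff_of_nonneg ht]

theorem memLZero_iff_finiteDistr (f : Fn 𝕜 α) : MemLZero f ↔ FiniteDistr α fun x => ‖f x‖ₑ := by
  constructor
  · rintro ⟨t, ht⟩
    refine ⟨ENNReal.ofReal t, ENNReal.ofReal_ne_top, (measure_mono fun x hx => ?_).trans_lt ht⟩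
    have hx : ENNReal.ofReal t < ‖f x‖ₑ := hx
    rw [← ofReal_norm] at hx
    exact (ENNReal.ofReal_lt_ofReal_iff'.1 hx).1
  · rintro ⟨s, hs, h⟩
    refine ⟨s.toReal, ?_⟩
    rwa [setOf_lt_norm f ENNReal.toReal_nonneg, ENNReal.ofReal_toReal hs]

theorem FiniteDistr.mono_ae {F G : ℝ → ℝ≥0∞} (hG : FiniteDistr α G)
    (h : ∀ᵐ x ∂(ivolume α), F x ≤ G x) : FiniteDistr α F := by
  obtain ⟨s, hs, hlt⟩ := hG
  exact ⟨s, hs, (measure_lt_mono_ae h s).trans_lt hlt⟩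

theorem ae_lt_top_of_rearr {h : ℝ → ℝ≥0∞} (hr : ∀ t, 0 < t → rearr α h t < ⊤) :
    ∀ᵐ x ∂(ivolume α), h x < ⊤ := by
  rw [ae_iff]
  by_contra h0
  obtain ⟨d, hd0, hd⟩ := exists_between (pos_iff_ne_zero.2 h0)
  have hdt : d ≠ ⊤ := hd.ne_top
  have hlt := hr d.toReal (ENNReal.toReal_pos hd0.ne' hdt)
  refine lt_irrefl _ (lt_rearr_iff.2 (?_ : _ < ivolume α {x | rearr α h d.toReal < h x}))
  rw [ENNReal.ofReal_toReal hdt]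
  refine hd.trans_le (measure_mono fun x hx => ?_)
  have hx : ¬ h x < ⊤ := hx
  exact hlt.trans_le (not_lt.1 hx)

theorem rearr_enorm_lt_top {f : Fn 𝕜 α} (hf : MemLZero f) {t : ℝ} (ht : 0 < t) :
    rearr α (fun x => ‖f x‖ₑ) t < ⊤ :=
  rearr_lt_top (measurable_enorm_fn f) (Eventually.of_forall fun _ => enorm_lt_top)
    ((memLZero_iff_finiteDistr f).1 hf) ht

theorem ae_ivolume_of_forall_pos {P : ℝ → Prop} (h : ∀ t, 0 < t → P t) :
    ∀ᵐ x ∂(ivolume α), P x := (ae_ivolume_mem α).mono fun x hx => h x hx.1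

end

namespace SymmetricSpace

variable {𝕜 : Type*} [RCLike 𝕜] {α : ℝ≥0∞} (E : SymmetricSpace 𝕜 α)

/-- The function `h` is dominated by an element of `E` of quasi-norm at most `c`. For `h = |f|` this
says that `f` belongs to `E` and has quasi-norm at most `c`. -/
def DomBy (h : ℝ → ℝ≥0∞) (c : ℝ) : Prop :=
  ∃ f ∈ E.carrier, E.qnorm f ≤ c ∧ ∀ᵐ x ∂(ivolume α), h x ≤ ‖f x‖ₑ

variable {E}

theorem DomBy.mono {h k : ℝ → ℝ≥0∞} {c d : ℝ} (H : E.DomBy h c)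
    (hk : ∀ᵐ x ∂(ivolume α), k x ≤ h x) (hcd : c ≤ d) : E.DomBy k d := by
  obtain ⟨f, hf, hfc, hle⟩ := H
  refine ⟨f, hf, hfc.trans hcd, ?_⟩
  filter_upwards [hk, hle] with x h1 h2 using h1.trans h2

theorem DomBy.nonneg {h : ℝ → ℝ≥0∞} {c : ℝ} (H : E.DomBy h c) : 0 ≤ c := by
  obtain ⟨f, hf, hfc, -⟩ := H
  exact (E.qnorm_nonneg f hf).trans hfc

theorem mem_of_enorm_le {f g : Fn 𝕜 α} (hf : f ∈ E.carrier)
    (h : ∀ᵐ x ∂(ivolume α), ‖g x‖ₑ ≤ ‖f x‖ₑ) : g ∈ E.carrier ∧ E.qnorm g ≤ E.qnorm f :=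
  E.solid f hf g (h.mono fun _ hx => enorm_le_iff_norm_le.1 hx)

theorem domBy_enorm_iff {f : Fn 𝕜 α} {c : ℝ} :
    E.DomBy (fun x => ‖f x‖ₑ) c ↔ f ∈ E.carrier ∧ E.qnorm f ≤ c := by
  constructor
  · rintro ⟨g, hg, hgc, hle⟩
    obtain ⟨h1, h2⟩ := mem_of_enorm_le hg hle
    exact ⟨h1, h2.trans hgc⟩
  · rintro ⟨h1, h2⟩
    exact ⟨f, h1, h2, Eventually.of_forall fun x => le_rfl⟩

theorem domBy_of_mem {f : Fn 𝕜 α} (hf : f ∈ E.carrier) :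
    E.DomBy (fun x => ‖f x‖ₑ) (E.qnorm f) := domBy_enorm_iff.2 ⟨hf, le_rfl⟩

theorem DomBy.ae_lt_top {h : ℝ → ℝ≥0∞} {c : ℝ} (H : E.DomBy h c) :
    ∀ᵐ x ∂(ivolume α), h x < ⊤ := by
  obtain ⟨f, -, -, hle⟩ := H
  exact hle.mono fun x hx => hx.trans_lt enorm_lt_top

theorem DomBy.toFn_mem {h : ℝ → ℝ≥0∞} {c : ℝ} (H : E.DomBy h c) (hm : Measurable h) :
    toFn 𝕜 α h hm ∈ E.carrier ∧ E.qnorm (toFn 𝕜 α h hm) ≤ c :=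
  domBy_enorm_iff.1 (H.mono (enorm_toFn_le h hm) le_rfl)

theorem domBy_of_toFn_mem {h : ℝ → ℝ≥0∞} (hm : Measurable h)
    (hfin : ∀ᵐ x ∂(ivolume α), h x < ⊤) (H : toFn 𝕜 α h hm ∈ E.carrier) :
    E.DomBy h (E.qnorm (toFn 𝕜 α h hm)) :=
  (domBy_of_mem H).mono ((enorm_toFn (𝕜 := 𝕜) h hm hfin).mono fun _ hx => hx.ge) le_rfl

theorem DomBy.const_mul {h : ℝ → ℝ≥0∞} {c : ℝ} (H : E.DomBy h c) {r : ℝ} (hr : 0 ≤ r) :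
    E.DomBy (fun x => ENNReal.ofReal r * h x) (r * c) := by
  obtain ⟨f, hf, hfc, hle⟩ := H
  refine ⟨(r : 𝕜) • f, E.carrier.smul_mem _ hf, ?_, ?_⟩
  · rw [E.qnorm_smul _ f hf, RCLike.norm_ofReal, abs_of_nonneg hr]
    exact mul_le_mul_of_nonneg_left hfc hr
  · filter_upwards [hle, AEEqFun.coeFn_smul (r : 𝕜) f] with x hx hs
    rw [hs, Pi.smul_apply, enorm_smul, ← ofReal_norm (r : 𝕜), RCLike.norm_ofReal, abs_of_nonneg hr]
    gcongr

theorem exists_quasi_const (E : SymmetricSpace 𝕜 α) : ∃ K : ℝ, 1 ≤ K ∧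
    ∀ f ∈ E.carrier, ∀ g ∈ E.carrier, E.qnorm (f + g) ≤ K * (E.qnorm f + E.qnorm g) := by
  obtain ⟨K, hK⟩ := E.exists_qnorm_add_le
  refine ⟨max K 1, le_max_right _ _, fun f hf g hg => (hK f hf g hg).trans ?_⟩
  have := E.qnorm_nonneg f hf
  have := E.qnorm_nonneg g hg
  gcongr
  exact le_max_left _ _

/-- Every element of `E` may be replaced by its absolute value. -/
theorem DomBy.exists_nonneg {h : ℝ → ℝ≥0∞} {c : ℝ} (H : E.DomBy h c) :
    ∃ f ∈ E.carrier, E.qnorm f ≤ c ∧ (∀ᵐ x ∂(ivolume α), h x ≤ ‖f x‖ₑ) ∧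
      ∀ᵐ x ∂(ivolume α), f x = ((‖f x‖ : ℝ) : 𝕜) := by
  obtain ⟨f, hf, hfc, hle⟩ := H
  have hm := measurable_enorm_fn f
  obtain ⟨h1, h2⟩ := (domBy_enorm_iff.2 ⟨hf, hfc⟩ : E.DomBy (fun x => ‖f x‖ₑ) c).toFn_mem hm
  refine ⟨_, h1, h2, ?_, ?_⟩
  · filter_upwards [hle, enorm_toFn (𝕜 := 𝕜) _ hm (Eventually.of_forall fun x => enorm_lt_top)]
      with x h1 h2
    rwa [h2]
  · filter_upwards [coeFn_toFn (𝕜 := 𝕜) (α := α) _ hm] with x hx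
    rw [hx, RCLike.norm_ofReal, abs_of_nonneg ENNReal.toReal_nonneg]

theorem DomBy.add {K : ℝ} (hK : ∀ f ∈ E.carrier, ∀ g ∈ E.carrier,
    E.qnorm (f + g) ≤ K * (E.qnorm f + E.qnorm g)) (hK1 : 1 ≤ K) {h k : ℝ → ℝ≥0∞} {c d : ℝ}
    (H : E.DomBy h c) (H' : E.DomBy k d) : E.DomBy (fun x => h x + k x) (K * (c + d)) := by
  obtain ⟨f, hf, hfc, hle, hfn⟩ := H.exists_nonneg
  obtain ⟨g, hg, hgd, hle', hgn⟩ := H'.exists_nonneg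
  refine ⟨f + g, E.carrier.add_mem hf hg, (hK f hf g hg).trans ?_, ?_⟩
  · gcongr
  · filter_upwards [hle, hle', hfn, hgn, AEEqFun.coeFn_add f g] with x h1 h2 h3 h4 h5
    have : ‖(f + g) x‖ₑ = ‖f x‖ₑ + ‖g x‖ₑ := by
      rw [h5, Pi.add_apply, h3, h4, ← RCLike.ofReal_add, ← ofReal_norm, ← ofReal_norm,
        ← ofReal_norm, ← ENNReal.ofReal_add (norm_nonneg _) (norm_nonneg _), RCLike.norm_ofReal,
        RCLike.norm_ofReal, RCLike.norm_ofReal, abs_of_nonneg (norm_nonneg _),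
        abs_of_nonneg (norm_nonneg _), abs_of_nonneg (by positivity)]
    rw [this]
    exact add_le_add h1 h2

/-- Iterating the quasi-triangle inequality costs a constant depending on the number of terms
only. -/
theorem exists_domBy_sum (E : SymmetricSpace 𝕜 α) (n : ℕ) : ∃ C : ℝ, 0 < C ∧
    ∀ (h : Fin n → ℝ → ℝ≥0∞) (c : ℝ), 0 ≤ c → (∀ i, E.DomBy (h i) c) →
      E.DomBy (fun x => ∑ i, h i x) (C * c) := by
  obtain ⟨K, hK1, hK⟩ := E.exists_quasi_const
  induction n with
  | zero =>
    refine ⟨1, one_pos, fun h c hc _ => ⟨0, E.carrier.zero_mem, ?_, ?_⟩⟩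
    · rw [(E.qnorm_eq_zero_iff 0 E.carrier.zero_mem).2 rfl]
      positivity
    · exact Eventually.of_forall fun x => by simp
  | succ n ih =>
    obtain ⟨C, hC, ih⟩ := ih
    refine ⟨K * (1 + C), by positivity, fun h c hc H => ?_⟩
    have := (H 0).add hK hK1 (ih (fun i => h i.succ) c hc fun i => H _)
    refine this.mono (Eventually.of_forall fun x => ?_) (by ring_nf; rfl)
    rw [Fin.sum_univ_succ]

theorem toFn_mem_of_distr_eq {f : Fn 𝕜 α} (hf : f ∈ E.carrier) {k : ℝ → ℝ≥0∞} (hk : Measurable k)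
    (hfin : ∀ᵐ x ∂(ivolume α), k x < ⊤)
    (h : ∀ s, ivolume α {x | s < k x} = ivolume α {x | s < ‖f x‖ₑ}) :
    toFn 𝕜 α k hk ∈ E.carrier ∧ E.qnorm (toFn 𝕜 α k hk) = E.qnorm f := by
  refine E.rearrangement_invariant f hf _ fun t ht => ?_
  rw [setOf_lt_norm _ ht.le, setOf_lt_norm _ ht.le, ← h]
  exact measure_lt_congr_ae (enorm_toFn k hk hfin) _

theorem toFn_rearr_mem {f : Fn 𝕜 α} (hf : f ∈ E.carrier) :
    toFn 𝕜 α (rearr α fun x => ‖f x‖ₑ) (measurable_rearr _ _) ∈ E.carrier ∧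
    E.qnorm (toFn 𝕜 α (rearr α fun x => ‖f x‖ₑ) (measurable_rearr _ _)) = E.qnorm f :=
  toFn_mem_of_distr_eq hf _
    (ae_ivolume_of_forall_pos fun _ ht => rearr_enorm_lt_top (E.memLZero f hf) ht)
    (ivolume_lt_rearr α _)

theorem domBy_rearr {f : Fn 𝕜 α} (hf : f ∈ E.carrier) :
    E.DomBy (rearr α fun x => ‖f x‖ₑ) (E.qnorm f) := by
  obtain ⟨h1, h2⟩ := toFn_rearr_mem hf
  rw [← h2]
  exact domBy_of_toFn_mem _
    (ae_ivolume_of_forall_pos fun _ ht => rearr_enorm_lt_top (E.memLZero f hf) ht) h1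

/-- Domination only depends on the distribution function. -/
theorem DomBy.of_distr {h k : ℝ → ℝ≥0∞} {c : ℝ} (H : E.DomBy h c) (hk : Measurable k)
    (hd : ∀ s, ivolume α {x | s < k x} ≤ ivolume α {x | s < h x}) : E.DomBy k c := by
  obtain ⟨f, hf, hfc, hle⟩ := H
  have hkf : rearr α k ≤ rearr α fun x => ‖f x‖ₑ :=
    rearr_mono_distr fun s => (hd s).trans (measure_lt_mono_ae hle s)
  have hkt : ∀ t, 0 < t → rearr α k t < ⊤ := fun t ht =>
    (hkf t).trans_lt (rearr_enorm_lt_top (E.memLZero f hf) ht)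
  have hkfin := ae_lt_top_of_rearr hkt
  have H1 : E.DomBy (rearr α k) c := (domBy_rearr hf).mono (Eventually.of_forall hkf) hfc
  obtain ⟨h1, h2⟩ := H1.toFn_mem (measurable_rearr _ _)
  have h3 := toFn_mem_of_distr_eq h1 hk hkfin fun s => by
    rw [measure_lt_congr_ae (enorm_toFn (𝕜 := 𝕜) (rearr α k) (measurable_rearr _ _)
      (ae_ivolume_of_forall_pos hkt)), ivolume_lt_rearr]
  exact (domBy_of_toFn_mem hk hkfin h3.1).mono (Eventually.of_forall fun _ => le_rfl)
    (h3.2.trans_le h2)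

theorem DomBy.of_rearr {h : ℝ → ℝ≥0∞} (hm : Measurable h) {c : ℝ}
    (H : E.DomBy (rearr α h) c) : E.DomBy h c :=
  H.of_distr hm fun s => (ivolume_lt_rearr α h s).ge

end SymmetricSpace

/-! ### Dyadic rounding -/

/-- The exponent `n` of the largest power `2 ^ n` not exceeding `y`, for `0 < y < ∞`. -/
noncomputable def dyadicExp (y : ℝ≥0∞) : ℤ := ⌊Real.logb 2 y.toReal⌋

/-- The power `2 ^ n`, as an extended nonnegative real number. -/
noncomputable def dyadic (n : ℤ) : ℝ≥0∞ := ENNReal.ofReal ((2 : ℝ) ^ n)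

theorem measurable_dyadicExp : Measurable dyadicExp :=
  Int.measurable_floor.comp ((Real.measurable_log.comp ENNReal.measurable_toReal).div_const _)

theorem measurable_dyadic : Measurable dyadic := measurable_of_countable _

theorem dyadicExp_eq (y : ℝ≥0∞) : dyadicExp y = Int.log 2 y.toReal := by
  have := Real.floor_logb_natCast (b := 2) (r := y.toReal) ENNReal.toReal_nonneg
  exact_mod_cast this

theorem dyadic_le {y : ℝ≥0∞} (h0 : y ≠ 0) (ht : y ≠ ⊤) : dyadic (dyadicExp y) ≤ y := by
  rw [dyadicExp_eq, dyadic]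
  refine ENNReal.ofReal_le_of_le_toReal ?_
  exact_mod_cast Int.zpow_log_le_self (b := 2) one_lt_two (ENNReal.toReal_pos h0 ht)

theorem le_two_mul_dyadic {y : ℝ≥0∞} (ht : y ≠ ⊤) : y ≤ 2 * dyadic (dyadicExp y) := by
  have h1 : y.toReal < (2 : ℝ) ^ (Int.log 2 y.toReal + 1) := by
    exact_mod_cast Int.lt_zpow_succ_log_self (b := 2) one_lt_two y.toReal
  rw [zpow_add_one₀ two_ne_zero] at h1
  rw [dyadicExp_eq, dyadic, ← ENNReal.ofReal_ofNat, ← ENNReal.ofReal_mul zero_le_two, mul_comm]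
  exact (ENNReal.le_ofReal_iff_toReal_le ht (by positivity)).2 h1.le

theorem setLIntegral_one_div {α : ℝ≥0∞} (B : Set ℝ) (N : ℕ) :
    ∫⁻ _ in B, (1 : ℝ≥0∞) / N ∂(ivolume α) = ivolume α B / N := by
  rw [setLIntegral_const, mul_comm, mul_one_div]

namespace SymmetricSpace

variable {𝕜 : Type*} [RCLike 𝕜] {α : ℝ≥0∞} {E : SymmetricSpace 𝕜 α}

/-- Enlarging the distribution function by a factor `N` is harmless: the level sets of a dyadic
rounding can be split into `N` equimeasurable parts. -/
theorem exists_domBy_of_distr_le_mul (E : SymmetricSpace 𝕜 α) (N : ℕ) [NeZero N] :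
    ∃ C : ℝ, 0 < C ∧
    ∀ (h k : ℝ → ℝ≥0∞) (c : ℝ), Measurable k →
      (∀ s, ivolume α {x | s < k x} ≤ N * ivolume α {x | s < h x}) → E.DomBy h c →
      E.DomBy k (C * c) := by
  obtain ⟨C, hC, hsum⟩ := E.exists_domBy_sum N
  refine ⟨C * 2, by positivity, fun h k c hk hd H => ?_⟩
  have hN0 : (N : ℝ≥0∞) ≠ 0 := by exact_mod_cast NeZero.ne N
  have hNt : (N : ℝ≥0∞) ≠ ⊤ := ENNReal.natCast_ne_top N
  have hkfin : ∀ᵐ x ∂(ivolume α), k x < ⊤ := by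
    obtain ⟨f, hf, -, hle⟩ := H
    refine ae_lt_top_of_rearr fun t ht => ?_
    have hNr : (0 : ℝ) < N := by exact_mod_cast Nat.pos_of_ne_zero (NeZero.ne N)
    refine lt_of_le_of_lt ?_ (rearr_enorm_lt_top (E.memLZero f hf) (div_pos ht hNr))
    refine le_of_forall_lt fun s hs => lt_rearr_iff.2 ?_
    have h1 := (lt_rearr_iff.1 hs).trans_le
      ((hd s).trans (mul_le_mul_right (measure_lt_mono_ae hle s) _))
    rw [ENNReal.ofReal_div_of_pos hNr, ENNReal.ofReal_natCast]
    exact ENNReal.div_lt_of_lt_mul' h1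
  have hm : Measurable fun x => dyadicExp (k x) := measurable_dyadicExp.comp hk
  -- The weight is `1 / N` where `k ≠ 0`. Where `k = 0` the dyadic exponent is a junk value, and the
  -- weight is `0` there.
  obtain ⟨P, hP, hcard, hmeas⟩ := exists_average α (fun x => dyadicExp (k x)) hm N
    (fun x => if k x = 0 then 0 else 1)
    (Measurable.ite (hk (measurableSet_singleton 0)) measurable_const measurable_const)
    (fun x => by
      have := Nat.pos_of_ne_zero (NeZero.ne N)
      split_ifs <;> omega)
  set g : Fin N → ℝ → ℝ≥0∞ := fun i => (P i).indicator fun x => 2 * dyadic (dyadicExp (k x))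
  have hgm : ∀ i, Measurable (g i) := fun i =>
    (Measurable.const_mul (measurable_dyadic.comp hm) _).indicator (hP i)
  have hg : ∀ i, E.DomBy (g i) (2 * c) := by
    intro i
    have H2 := H.const_mul (r := 2) zero_le_two
    refine H2.of_distr (hgm i) fun s => ?_
    have h1 : {x | s < g i x} = (fun x => dyadicExp (k x)) ⁻¹' {n | s < 2 * dyadic n} ∩ P i := by
      ext x
      by_cases hx : x ∈ P i <;> simp [g, hx]
    have hSm : MeasurableSet ((fun x => dyadicExp (k x)) ⁻¹' {n | s < 2 * dyadic n}) :=
      hm (Set.to_countable _).measurableSet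
    rw [h1, hmeas i]
    have h2 : ∫⁻ x in (fun x => dyadicExp (k x)) ⁻¹' {n | s < 2 * dyadic n},
        ((if k x = 0 then 0 else 1 : ℕ) : ℝ≥0∞) / N ∂(ivolume α) ≤
        ivolume α {x | s < 2 * k x} / N := by
      rw [← setLIntegral_one_div, ← lintegral_indicator hSm, ← lintegral_indicator
        (measurableSet_lt measurable_const (hk.const_mul 2))]
      refine lintegral_mono_ae ?_
      filter_upwards [hkfin] with x hx
      by_cases h0 : k x = 0
      · by_cases hxS : x ∈ (fun x => dyadicExp (k x)) ⁻¹' {n | s < 2 * dyadic n}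
        · rw [indicator_of_mem hxS]
          simp [h0]
        · rw [indicator_of_notMem hxS]
          exact zero_le
      · by_cases hxS : x ∈ (fun x => dyadicExp (k x)) ⁻¹' {n | s < 2 * dyadic n}
        · have hxS' : s < 2 * dyadic (dyadicExp (k x)) := hxS
          have hx2 : x ∈ {x | s < 2 * k x} :=
            hxS'.trans_le (mul_le_mul_right (dyadic_le h0 hx.ne) 2)
          rw [indicator_of_mem hxS, indicator_of_mem hx2]
          simp [h0]
        · rw [indicator_of_notMem hxS]
          exact zero_le
    refine h2.trans (ENNReal.div_le_of_le_mul' ?_)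
    have h3 : ∀ F : ℝ → ℝ≥0∞, {x | s < 2 * F x} = {x | s / 2 < F x} := by
      intro F
      ext x
      change s < 2 * F x ↔ s / 2 < F x
      rw [ENNReal.div_lt_iff (Or.inl two_ne_zero) (Or.inl ENNReal.ofNat_ne_top), mul_comm]
    rw [ENNReal.ofReal_ofNat, h3, h3]
    exact hd _
  have := hsum g (2 * c) (by have := H.nonneg; positivity) hg
  refine this.mono ?_ (by rw [mul_assoc])
  filter_upwards [hkfin] with x hx
  by_cases h0 : k x = 0
  · rw [h0]; exact zero_le
  · have hc := hcard x 1
    have : ∃ i, x ∈ P i := by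
      by_contra hn
      push Not at hn
      rw [Finset.sum_eq_zero fun i _ => indicator_of_notMem (hn i) _] at hc
      simp [h0] at hc
    obtain ⟨i, hi⟩ := this
    refine (le_two_mul_dyadic hx.ne).trans ?_
    have h4 : g i x = 2 * dyadic (dyadicExp (k x)) := indicator_of_mem hi _
    rw [← h4]
    exact Finset.single_le_sum (f := fun i => g i x) (fun _ _ => zero_le) (Finset.mem_univ i)

theorem exists_distr_pos {f : Fn 𝕜 α} (hf : f ≠ 0) :
    ∃ s : ℝ≥0∞, 0 < s ∧ s ≠ ⊤ ∧ 0 < ivolume α {x | s < ‖f x‖ₑ} := by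
  by_contra hcon
  push Not at hcon
  refine hf (AEEqFun.ext ?_)
  have h1 : ∀ n : ℕ, ∀ᵐ x ∂(ivolume α), ‖f x‖ₑ ≤ ((n : ℝ≥0∞) + 1)⁻¹ := by
    intro n
    have := hcon ((n : ℝ≥0∞) + 1)⁻¹ (ENNReal.inv_pos.2 (by finiteness)) (by simp)
    rw [ae_iff]
    simp only [not_le]
    exact le_antisymm this zero_le
  filter_upwards [ae_all_iff.2 h1, AEEqFun.coeFn_zero (α := ℝ) (β := 𝕜) (μ := ivolume α)]
    with x hx h0
  rw [h0, Pi.zero_apply, ← enorm_eq_zero]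
  by_contra hne
  obtain ⟨n, hn⟩ := ENNReal.exists_inv_nat_lt hne
  refine absurd (hx n) (not_le.2 (lt_of_le_of_lt ?_ hn))
  exact ENNReal.inv_le_inv.2 le_self_add

/-- Every symmetric space contains the bounded functions with bounded support. -/
theorem exists_domBy_indicator (E : SymmetricSpace 𝕜 α) (R : ℝ) :
    ∃ c, E.DomBy ((Ioc 0 R).indicator fun _ => 1) c := by
  obtain ⟨f, hf, hf0⟩ := E.exists_ne_zero
  obtain ⟨s, hs0, hst, hm⟩ := exists_distr_pos hf0
  obtain ⟨n, hn⟩ := ENNReal.exists_nat_mul_gt hm.ne' (ENNReal.ofReal_ne_top (r := R))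
  obtain ⟨C, hC, key⟩ := E.exists_domBy_of_distr_le_mul (n + 1)
  refine ⟨_, key _ _ _ (measurable_const.indicator measurableSet_Ioc) (fun u => ?_)
    ((domBy_of_mem hf).const_mul (r := (s⁻¹).toReal) ENNReal.toReal_nonneg)⟩
  rcases lt_or_ge u 1 with hu | hu
  · have h1 : ivolume α {x | u < (Ioc 0 R).indicator (fun _ => (1 : ℝ≥0∞)) x} ≤
        ENNReal.ofReal R := by
      calc _ ≤ volume (Ioc 0 R) := by
            refine (ivolume_le_volume α _).trans (measure_mono fun x hx => ?_)
            have hx : u < (Ioc 0 R).indicator (fun _ => (1 : ℝ≥0∞)) x := hx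
            by_contra hn
            rw [indicator_of_notMem hn] at hx
            exact not_lt_zero hx
        _ = ENNReal.ofReal R := by simp
    refine h1.trans (hn.le.trans ?_)
    push_cast
    refine mul_le_mul' le_self_add (measure_mono fun x hx => ?_)
    have hx : s < ‖f x‖ₑ := hx
    refine hu.trans_le ?_
    rw [ENNReal.ofReal_toReal (ENNReal.inv_ne_top.2 hs0.ne')]
    calc (1 : ℝ≥0∞) = s⁻¹ * s := (ENNReal.inv_mul_cancel hs0.ne' hst).symm
      _ ≤ _ := by gcongr
  · have : {x | u < (Ioc 0 R).indicator (fun _ => (1 : ℝ≥0∞)) x} = ∅ := by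
      refine eq_empty_iff_forall_notMem.2 fun x hx => ?_
      have hx : u < (Ioc 0 R).indicator (fun _ => (1 : ℝ≥0∞)) x := hx
      refine absurd (hu.trans_lt hx) (not_lt.2 ?_)
      exact indicator_le_self' (fun _ _ => zero_le) x
    rw [this]
    simp

/-- Geometrically decaying sequences in `E` have a common upper bound in `E`. -/
theorem domBy_iSup_of_geometric {K : ℝ} (hK1 : 1 ≤ K) (hK : ∀ f ∈ E.carrier, ∀ g ∈ E.carrier,
    E.qnorm (f + g) ≤ K * (E.qnorm f + E.qnorm g)) {x : ℕ → ℝ → ℝ≥0∞} {c r : ℝ} (hr : 0 ≤ r)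
    (hrK : 2 * K * r ≤ 1) (H : ∀ k, E.DomBy (x k) (c * r ^ k)) :
    E.DomBy (fun t => ⨆ k, x k t) (4 * K ^ 2 * c) := by
  choose f hf hfc hle hfn using fun k => (H k).exists_nonneg
  have hc : 0 ≤ c := by simpa using (H 0).nonneg
  have hr1 : r < 1 := by nlinarith
  -- the tail of the series of quasi-norms, summed with one factor `K` per term
  have htail : ∀ m n, E.qnorm (∑ k ∈ Finset.range m, f (n + k)) ≤ 2 * K * (c * r ^ n) := by
    intro m
    induction m with
    | zero =>
      intro n
      rw [Finset.sum_range_zero, (E.qnorm_eq_zero_iff 0 E.carrier.zero_mem).2 rfl]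
      positivity
    | succ m ih =>
      intro n
      rw [Finset.sum_range_succ']
      have hmem : ∑ k ∈ Finset.range m, f (n + (k + 1)) ∈ E.carrier :=
        E.carrier.sum_mem fun k _ => hf _
      have h1 : E.qnorm (∑ k ∈ Finset.range m, f (n + (k + 1))) ≤ 2 * K * (c * r ^ (n + 1)) := by
        have := ih (n + 1)
        simpa only [add_assoc, add_comm 1] using this
      refine (hK _ hmem _ (hf _)).trans ?_
      have h2 := hfc (n + 0)
      have h3 : 2 * K * (c * r ^ (n + 1)) = (2 * K * r) * (c * r ^ n) := by ring
      have h4 : (2 * K * r) * (c * r ^ n) ≤ 1 * (c * r ^ n) := by gcongr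
      rw [add_zero] at h2 ⊢
      nlinarith
  set S : ℕ → Fn 𝕜 α := fun n => ∑ k ∈ Finset.range n, f k with hS
  have hSmem : ∀ n, S n ∈ E.carrier := fun n => E.carrier.sum_mem fun k _ => hf k
  have hdiff : ∀ n m, n ≤ m → E.qnorm (S m - S n) ≤ 2 * K * (c * r ^ n) := by
    intro n m hnm
    obtain ⟨d, rfl⟩ := Nat.exists_eq_add_of_le hnm
    have : S (n + d) - S n = ∑ k ∈ Finset.range d, f (n + k) := by
      rw [hS]
      simp only
      rw [Finset.sum_range_add, add_sub_cancel_left]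
    rw [this]
    exact htail d n
  have hneg : ∀ u ∈ E.carrier, E.qnorm (-u) = E.qnorm u := by
    intro u hu
    have := E.qnorm_smul (-1) u hu
    have h1 : (-1 : 𝕜) • u = -u := neg_one_smul 𝕜 u
    rwa [h1, norm_neg, norm_one, one_mul] at this
  have hlim0 : Tendsto (fun n : ℕ => 2 * K * (c * r ^ n)) atTop (𝓝 0) := by
    have := ((tendsto_pow_atTop_nhds_zero_of_lt_one hr hr1).const_mul c).const_mul (2 * K)
    simpa using this
  -- the limit of the partial sums is the common upper bound
  obtain ⟨h, hh, hlim⟩ := E.complete S hSmem fun ε hε => by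
    obtain ⟨N, hN⟩ := (hlim0.eventually (gt_mem_nhds hε)).exists
    refine ⟨N, fun m hm n hn => ?_⟩
    have hanti : ∀ i, N ≤ i → 2 * K * (c * r ^ i) < ε := fun i hi => lt_of_le_of_lt (by
      have := pow_le_pow_of_le_one hr hr1.le hi
      gcongr) hN
    rcases le_total n m with hnm | hnm
    · exact (hdiff n m hnm).trans_lt (hanti n hn)
    · rw [← neg_sub, hneg _ (E.carrier.sub_mem (hSmem n) (hSmem m))]
      exact (hdiff m n hnm).trans_lt (hanti m hm)
  have hSx : ∀ᵐ t ∂(ivolume α), ∀ n, S n t = ((∑ k ∈ Finset.range n, ‖f k t‖ : ℝ) : 𝕜) := by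
    refine ae_all_iff.2 fun n => ?_
    have h1 : (S n : ℝ → 𝕜) =ᵐ[ivolume α] ∑ k ∈ Finset.range n, (f k : ℝ → 𝕜) := by
      rw [hS]
      simp only
      induction n with
      | zero => simpa using AEEqFun.coeFn_zero
      | succ n ih =>
        rw [Finset.sum_range_succ, Finset.sum_range_succ]
        exact (AEEqFun.coeFn_add _ _).trans (ih.add EventuallyEq.rfl)
    filter_upwards [h1, ae_all_iff.2 hfn] with t ht hft
    rw [ht, Finset.sum_apply, RCLike.ofReal_sum]
    exact Finset.sum_congr rfl fun k _ => hft k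
  have hSn : ∀ᵐ t ∂(ivolume α), ∀ n, ‖S n t‖ = ∑ k ∈ Finset.range n, ‖f k t‖ := by
    filter_upwards [hSx] with t ht n
    rw [ht n, RCLike.norm_ofReal, abs_of_nonneg (Finset.sum_nonneg fun _ _ => norm_nonneg _)]
  -- the positive part of `|S n| - |h|` is at most `|S m - h|` for every `m ≥ n`, hence zero
  have hbound : ∀ n, ∀ᵐ t ∂(ivolume α), ‖S n t‖ₑ ≤ ‖h t‖ₑ := by
    intro n
    have hdm : Measurable fun t => ENNReal.ofReal (‖S n t‖ - ‖h t‖) :=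
      ((S n).measurable.norm.sub h.measurable.norm).ennreal_ofReal
    have hd : ∀ m, n ≤ m → E.DomBy (fun t => ENNReal.ofReal (‖S n t‖ - ‖h t‖))
        (E.qnorm (S m - h)) := by
      intro m hnm
      refine (domBy_of_mem (E.carrier.sub_mem (hSmem m) hh)).mono ?_ le_rfl
      filter_upwards [hSn, AEEqFun.coeFn_sub (S m) h] with t ht hsub
      rw [hsub, Pi.sub_apply, ← ofReal_norm]
      refine ENNReal.ofReal_le_ofReal (le_trans ?_ (norm_sub_norm_le _ _))
      rw [ht n, ht m]
      gcongr
    obtain ⟨h1, -⟩ := (hd n le_rfl).toFn_mem hdm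
    have h2 : E.qnorm (toFn 𝕜 α _ hdm) ≤ 0 := by
      refine ge_of_tendsto hlim ?_
      filter_upwards [eventually_ge_atTop n] with m hm
      exact ((hd m hm).toFn_mem hdm).2
    have h3 := (E.qnorm_eq_zero_iff _ h1).1 (le_antisymm h2 (E.qnorm_nonneg _ h1))
    filter_upwards [enorm_toFn (𝕜 := 𝕜) _ hdm (Eventually.of_forall fun t => ENNReal.ofReal_lt_top),
      AEEqFun.coeFn_zero (α := ℝ) (β := 𝕜) (μ := ivolume α)] with t ht h0
    rw [h3, h0, Pi.zero_apply, enorm_zero] at ht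
    have := ENNReal.ofReal_eq_zero.1 ht.symm
    exact enorm_le_iff_norm_le.2 (by linarith)
  refine ⟨h, hh, ?_, ?_⟩
  · have h1 : ∀ n, E.qnorm h ≤ K * (2 * K * c + E.qnorm (S n - h)) := by
      intro n
      have h2 : h = S n + -(S n - h) := by abel
      have h3 := hK _ (hSmem n) _ (E.carrier.neg_mem (E.carrier.sub_mem (hSmem n) hh))
      rw [← h2, hneg _ (E.carrier.sub_mem (hSmem n) hh)] at h3
      refine h3.trans ?_
      have h4 : E.qnorm (S n) ≤ 2 * K * c := by
        have := htail n 0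
        simpa [hS] using this
      gcongr
    have h2 : E.qnorm h ≤ K * (2 * K * c + 0) :=
      ge_of_tendsto' ((hlim.const_add _).const_mul K) h1
    nlinarith [mul_nonneg (sq_nonneg K) hc]
  · filter_upwards [ae_all_iff.2 hle, ae_all_iff.2 hbound, hSn] with t h1 h2 h3
    refine iSup_le fun k => (h1 k).trans (le_trans ?_ (h2 (k + 1)))
    refine enorm_le_iff_norm_le.2 ?_
    rw [h3]
    exact Finset.single_le_sum (f := fun k => ‖f k t‖) (fun _ _ => norm_nonneg _)
      (Finset.self_mem_range_succ k)

/-- The Fatou property for dominated functions. -/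
theorem Fatou.domBy_of_tendsto (hE : E.Fatou) {h : ℕ → ℝ → ℝ≥0∞} (hm : ∀ n, Measurable (h n))
    (hmono : ∀ x, Monotone fun n => h n x) {c : ℝ} (H : ∀ n, E.DomBy (h n) c) {k : ℝ → ℝ≥0∞}
    (hk : Measurable k) (hkfin : ∀ᵐ x ∂(ivolume α), k x < ⊤) (hk0 : FiniteDistr α k)
    (hsup : ∀ᵐ x ∂(ivolume α), Tendsto (fun n => h n x) atTop (𝓝 (k x))) : E.DomBy k c := by
  have hmem := fun n => (H n).toFn_mem (hm n)
  have := hE (fun n => toFn 𝕜 α (h n) (hm n)) (toFn 𝕜 α k hk) (fun n => (hmem n).1)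
    ⟨c, fun n => (hmem n).2⟩ ((memLZero_iff_finiteDistr _).2
      (hk0.mono_ae (enorm_toFn_le k hk))) ?_
  · exact (domBy_of_toFn_mem hk hkfin this.1).mono (Eventually.of_forall fun _ => le_rfl)
      (le_of_tendsto' this.2 fun n => (hmem n).2)
  · filter_upwards [ae_all_iff.2 fun n => coeFn_toFn (𝕜 := 𝕜) (α := α) (h n) (hm n),
      coeFn_toFn (𝕜 := 𝕜) (α := α) k hk, hkfin, hsup, ae_all_iff.2 fun n => (H n).ae_lt_top]
      with x h1 h2 h3 h4 h5
    have hn : ∀ n, ‖toFn 𝕜 α (h n) (hm n) x‖ = (h n x).toReal := fun n => by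
      rw [h1, RCLike.norm_ofReal, abs_of_nonneg ENNReal.toReal_nonneg]
    refine ⟨fun n => by rw [hn, h1], fun m n hmn => ?_, ?_⟩
    · simp only [hn]
      exact ENNReal.toReal_mono (h5 n).ne (hmono x hmn)
    · simp only [h1, h2]
      exact (RCLike.continuous_ofReal.tendsto _).comp ((ENNReal.tendsto_toReal h3.ne).comp h4)

end SymmetricSpace

/-! ### Rearrangements of elements of a symmetric space -/

/-- The nonincreasing rearrangement `f^*` of `|f|`. -/
noncomputable def rearrFn {𝕜 : Type*} [RCLike 𝕜] {α : ℝ≥0∞} (f : Fn 𝕜 α) : ℝ → ℝ≥0∞ :=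
  rearr α fun x => ‖f x‖ₑ

theorem rearr_const_mul {α : ℝ≥0∞} (F : ℝ → ℝ≥0∞) {c : ℝ≥0∞} (hc0 : c ≠ 0) (hct : c ≠ ⊤) (t : ℝ) :
    rearr α (fun x => c * F x) t = c * rearr α F t := by
  refine eq_of_forall_lt_iff fun s => ?_
  have : ∀ y : ℝ≥0∞, s < c * y ↔ s / c < y := fun y => by
    rw [ENNReal.div_lt_iff (Or.inl hc0) (Or.inl hct), mul_comm]
  rw [lt_rearr_iff, this, lt_rearr_iff]
  simp_rw [this]

theorem Antitone.setLIntegral_Ioc_le {F : ℝ → ℝ≥0∞} (hF : Antitone F) (a b : ℝ) :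
    ∫⁻ s in Ioc a b, F s ≤ F a * ENNReal.ofReal (b - a) := by
  calc ∫⁻ s in Ioc a b, F s ≤ ∫⁻ _ in Ioc a b, F a :=
        setLIntegral_mono measurable_const fun x hx => hF hx.1.le
    _ = _ := by rw [setLIntegral_const, Real.volume_Ioc]

theorem Antitone.le_setLIntegral_Ioc {F : ℝ → ℝ≥0∞} (hF : Antitone F) (a b : ℝ) :
    F b * ENNReal.ofReal (b - a) ≤ ∫⁻ s in Ioc a b, F s := by
  calc _ = ∫⁻ _ in Ioc a b, F b := by rw [setLIntegral_const, Real.volume_Ioc]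
    _ ≤ ∫⁻ s in Ioc a b, F s := setLIntegral_mono hF.measurable fun x hx => hF hx.2

theorem setLIntegral_Ioc_add_Ioc (F : ℝ → ℝ≥0∞) {a b c : ℝ} (hab : a ≤ b) (hbc : b ≤ c) :
    ∫⁻ s in Ioc a c, F s = (∫⁻ s in Ioc a b, F s) + ∫⁻ s in Ioc b c, F s := by
  rw [← Ioc_union_Ioc_eq_Ioc hab hbc, lintegral_union measurableSet_Ioc
    (Ioc_disjoint_Ioc_of_le le_rfl)]

theorem setLIntegral_Ioc_add_Ioi (F : ℝ → ℝ≥0∞) {a b : ℝ} (hab : a ≤ b) :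
    ∫⁻ s in Ioi a, F s = (∫⁻ s in Ioc a b, F s) + ∫⁻ s in Ioi b, F s := by
  rw [← Ioc_union_Ioi_eq_Ioi hab, lintegral_union measurableSet_Ioi]
  exact Set.disjoint_left.2 fun x hx hx' => not_lt.2 hx.2 hx'

/-- The averages over `(0, t]` of a nonincreasing function are nonincreasing. -/
theorem Antitone.setLIntegral_average_le {F : ℝ → ℝ≥0∞} (hF : Antitone F) {t x : ℝ} (ht : 0 < t)
    (htx : t ≤ x) : (∫⁻ s in Ioc 0 x, F s) * ENNReal.ofReal t ≤
      (∫⁻ s in Ioc 0 t, F s) * ENNReal.ofReal x := by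
  have h1 := hF.le_setLIntegral_Ioc 0 t
  rw [sub_zero] at h1
  calc (∫⁻ s in Ioc 0 x, F s) * ENNReal.ofReal t
      = ((∫⁻ s in Ioc 0 t, F s) + ∫⁻ s in Ioc t x, F s) * ENNReal.ofReal t := by
        rw [setLIntegral_Ioc_add_Ioc F ht.le htx]
    _ ≤ ((∫⁻ s in Ioc 0 t, F s) + F t * ENNReal.ofReal (x - t)) * ENNReal.ofReal t := by
        gcongr
        exact hF.setLIntegral_Ioc_le t x
    _ = (∫⁻ s in Ioc 0 t, F s) * ENNReal.ofReal t +
          F t * ENNReal.ofReal t * ENNReal.ofReal (x - t) := by ring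
    _ ≤ (∫⁻ s in Ioc 0 t, F s) * ENNReal.ofReal t +
          (∫⁻ s in Ioc 0 t, F s) * ENNReal.ofReal (x - t) := by gcongr
    _ = (∫⁻ s in Ioc 0 t, F s) * ENNReal.ofReal x := by
        rw [← mul_add, ← ENNReal.ofReal_add ht.le (by linarith)]
        congr 2
        ring

theorem Antitone.rpow {F : ℝ → ℝ≥0∞} (hF : Antitone F) {p : ℝ} (hp : 0 ≤ p) :
    Antitone fun t => F t ^ p := fun _ _ h => ENNReal.rpow_le_rpow (hF h) hp

/-- If the integral over `(0, t]` of a nonincreasing function, finite on `(0, ∞)`, diverges for one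
`t > 0` then it diverges for all of them. -/
theorem Antitone.setLIntegral_Ioc_eq_top {F : ℝ → ℝ≥0∞} (hF : Antitone F)
    (hfin : ∀ t, 0 < t → F t < ⊤) {t₀ : ℝ} (h : ∫⁻ s in Ioc 0 t₀, F s = ⊤) {t : ℝ} (ht : 0 < t) :
    ∫⁻ s in Ioc 0 t, F s = ⊤ := by
  rcases le_total t₀ t with hle | hle
  · exact top_le_iff.1 (h ▸ lintegral_mono_set (Ioc_subset_Ioc_right hle))
  · rw [setLIntegral_Ioc_add_Ioc F ht.le hle, ENNReal.add_eq_top] at h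
    refine h.resolve_right (ne_top_of_le_ne_top ?_ (hF.setLIntegral_Ioc_le t t₀))
    exact ENNReal.mul_ne_top (hfin t ht).ne ENNReal.ofReal_ne_top

theorem Antitone.setLIntegral_Ioi_eq_top {F : ℝ → ℝ≥0∞} (hF : Antitone F)
    (hfin : ∀ t, 0 < t → F t < ⊤) {t₀ : ℝ} (ht₀ : 0 < t₀) (h : ∫⁻ s in Ioi t₀, F s = ⊤) {t : ℝ} :
    ∫⁻ s in Ioi t, F s = ⊤ := by
  rcases le_total t t₀ with hle | hle
  · exact top_le_iff.1 (h ▸ lintegral_mono_set (Ioi_subset_Ioi hle))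
  · rw [setLIntegral_Ioc_add_Ioi F hle, ENNReal.add_eq_top] at h
    refine h.resolve_left (ne_top_of_le_ne_top ?_ (hF.setLIntegral_Ioc_le t₀ t))
    exact ENNReal.mul_ne_top (hfin t₀ ht₀).ne ENNReal.ofReal_ne_top

section

variable {𝕜 : Type*} [RCLike 𝕜] {α : ℝ≥0∞}

theorem rearrFn_antitone (f : Fn 𝕜 α) : Antitone (rearrFn f) := rearr_antitone _ _

theorem measurable_rearrFn (f : Fn 𝕜 α) : Measurable (rearrFn f) := measurable_rearr _ _

theorem rearrFn_lt_top {f : Fn 𝕜 α} (hf : MemLZero f) {t : ℝ} (ht : 0 < t) : rearrFn f t < ⊤ :=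
  rearr_enorm_lt_top hf ht

theorem rearr_congr_ae {F G : ℝ → ℝ≥0∞} (h : ∀ᵐ x ∂(ivolume α), F x = G x) :
    rearr α F = rearr α G := rearr_congr_distr (measure_lt_congr_ae h)

theorem rearrFn_smul (f : Fn 𝕜 α) {r : ℝ} (hr : 0 < r) (t : ℝ) :
    rearrFn ((r : 𝕜) • f) t = ENNReal.ofReal r * rearrFn f t := by
  rw [rearrFn, rearrFn, ← rearr_const_mul _ (ENNReal.ofReal_pos.2 hr).ne' ENNReal.ofReal_ne_top]
  refine congrFun (rearr_congr_ae ?_) t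
  filter_upwards [AEEqFun.coeFn_smul (r : 𝕜) f] with x hs
  rw [hs, Pi.smul_apply, enorm_smul, ← ofReal_norm (r : 𝕜), RCLike.norm_ofReal, abs_of_pos hr]

theorem rearrFn_toFn {h : ℝ → ℝ≥0∞} (hm : Measurable h) (hfin : ∀ᵐ x ∂(ivolume α), h x < ⊤) :
    rearrFn (toFn 𝕜 α h hm) = rearr α h := rearr_congr_ae (enorm_toFn h hm hfin)

end

namespace SymmetricSpace

variable {𝕜 : Type*} [RCLike 𝕜] {α : ℝ≥0∞} {E : SymmetricSpace 𝕜 α}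

theorem not_forall_qnorm_le (E : SymmetricSpace 𝕜 α) (c : ℝ) :
    ¬ ∀ g ∈ E.carrier, E.qnorm g ≤ c := by
  intro h
  obtain ⟨g, hg, hg0⟩ := E.exists_ne_zero
  have hpos : 0 < E.qnorm g :=
    lt_of_le_of_ne (E.qnorm_nonneg g hg) fun h0 => hg0 ((E.qnorm_eq_zero_iff g hg).1 h0.symm)
  have hc : 0 ≤ c := (E.qnorm_nonneg g hg).trans (h g hg)
  have := h _ (E.carrier.smul_mem (((c + 1) / E.qnorm g : ℝ) : 𝕜) hg)
  rw [E.qnorm_smul _ g hg, RCLike.norm_ofReal, abs_of_nonneg (by positivity),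
    div_mul_cancel₀ _ hpos.ne'] at this
  linarith

/-- Left monotonicity for `[0, ∞]`-valued functions. -/
theorem LeftMonotone.exists_domBy {p : ℝ} (hp : 0 < p) (H : E.LeftMonotone p) :
    ∃ C : ℝ, 0 < C ∧ ∀ f ∈ E.carrier, ∀ k : ℝ → ℝ≥0∞, Measurable k →
      (∀ᵐ x ∂(ivolume α), k x < ⊤) → FiniteDistr α k →
      (∀ t, 0 < t → ∫⁻ s in Ioc 0 t, rearr α k s ^ p ≤ ∫⁻ s in Ioc 0 t, rearrFn f s ^ p) →
      E.DomBy k (C * E.qnorm f) := by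
  obtain ⟨C, hC, H⟩ := H
  refine ⟨C, hC, fun f hf k hk hkfin hk0 hmaj => ?_⟩
  have := H f hf (toFn 𝕜 α k hk) ((memLZero_iff_finiteDistr _).2
    (hk0.mono_ae (enorm_toFn_le k hk))) fun t ht => by
      simp_rw [rearr_rpow α _ hp]
      have h1 : rearr α (fun x => ‖toFn 𝕜 α k hk x‖ₑ) = rearr α k := rearrFn_toFn hk hkfin
      rw [h1]
      exact hmaj t ht
  exact (domBy_of_toFn_mem hk hkfin this.1).mono (Eventually.of_forall fun _ => le_rfl) this.2

/-- Right monotonicity for `[0, ∞]`-valued functions. -/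
theorem RightMonotone.exists_domBy {q : ℝ} (hq : 0 < q) (H : E.RightMonotone q) :
    ∃ C : ℝ, 0 < C ∧ ∀ f ∈ E.carrier, ∀ k : ℝ → ℝ≥0∞, Measurable k →
      (∀ᵐ x ∂(ivolume α), k x < ⊤) → FiniteDistr α k →
      (∀ t, 0 < t → ∫⁻ s in Ioi t, rearr α k s ^ q ≤ ∫⁻ s in Ioi t, rearrFn f s ^ q) →
      E.DomBy k (C * E.qnorm f) := by
  obtain ⟨C, hC, H⟩ := H
  refine ⟨C, hC, fun f hf k hk hkfin hk0 hmaj => ?_⟩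
  have := H f hf (toFn 𝕜 α k hk) ((memLZero_iff_finiteDistr _).2
    (hk0.mono_ae (enorm_toFn_le k hk))) fun t ht => by
      simp_rw [rearr_rpow α _ hq]
      have h1 : rearr α (fun x => ‖toFn 𝕜 α k hk x‖ₑ) = rearr α k := rearrFn_toFn hk hkfin
      rw [h1]
      exact hmaj t ht
  exact (domBy_of_toFn_mem hk hkfin this.1).mono (Eventually.of_forall fun _ => le_rfl) this.2

/-- Left monotonicity may be checked on rearrangements. -/
theorem leftMonotone_of_domBy {p : ℝ} (hp : 0 < p) {C : ℝ} (hC : 0 < C)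
    (H : ∀ f ∈ E.carrier, ∀ g : Fn 𝕜 α, MemLZero g →
      (∀ t, 0 < t → ∫⁻ s in Ioc 0 t, rearrFn g s ^ p ≤ ∫⁻ s in Ioc 0 t, rearrFn f s ^ p) →
      E.DomBy (rearrFn g) (C * E.qnorm f)) : E.LeftMonotone p := by
  refine ⟨C, hC, fun f hf g hg hmaj => ?_⟩
  refine domBy_enorm_iff.1 ((H f hf g hg fun t ht => ?_).of_rearr (measurable_enorm_fn g))
  have := hmaj t ht
  simp_rw [rearr_rpow α _ hp] at this
  exact this

/-- Right monotonicity may be checked on rearrangements. -/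
theorem rightMonotone_of_domBy {q : ℝ} (hq : 0 < q) {C : ℝ} (hC : 0 < C)
    (H : ∀ f ∈ E.carrier, ∀ g : Fn 𝕜 α, MemLZero g →
      (∀ t, 0 < t → ∫⁻ s in Ioi t, rearrFn g s ^ q ≤ ∫⁻ s in Ioi t, rearrFn f s ^ q) →
      E.DomBy (rearrFn g) (C * E.qnorm f)) : E.RightMonotone q := by
  refine ⟨C, hC, fun f hf g hg hmaj => ?_⟩
  refine domBy_enorm_iff.1 ((H f hf g hg fun t ht => ?_).of_rearr (measurable_enorm_fn g))
  have := hmaj t ht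
  simp_rw [rearr_rpow α _ hq] at this
  exact this

/-- If the integral diverged, then `f` would majorize every element of `E`, and the quasi-norm would
be bounded on `E`. -/
theorem LeftMonotone.setLIntegral_ne_top {p : ℝ} (hp : 0 < p) (H : E.LeftMonotone p) {f : Fn 𝕜 α}
    (hf : f ∈ E.carrier) (t : ℝ) : ∫⁻ s in Ioc 0 t, rearrFn f s ^ p ≠ ⊤ := by
  intro htop
  obtain ⟨C, hC, H⟩ := H
  refine E.not_forall_qnorm_le (C * E.qnorm f) fun g hg => (H f hf g (E.memLZero g hg) ?_).2
  intro u hu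
  simp_rw [rearr_rpow α _ hp]
  have := ((rearrFn_antitone f).rpow hp.le).setLIntegral_Ioc_eq_top
    (fun t ht => ENNReal.rpow_lt_top_of_nonneg hp.le (rearrFn_lt_top (E.memLZero f hf) ht).ne)
    htop hu
  exact le_top.trans_eq this.symm

/-- If the integral diverged, then `f` would majorize every element of `E`, and the quasi-norm would
be bounded on `E`. -/
theorem RightMonotone.setLIntegral_ne_top {q : ℝ} (hq : 0 < q) (H : E.RightMonotone q)
    {f : Fn 𝕜 α} (hf : f ∈ E.carrier) {t : ℝ} (ht : 0 < t) :
    ∫⁻ s in Ioi t, rearrFn f s ^ q ≠ ⊤ := by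
  intro htop
  obtain ⟨C, hC, H⟩ := H
  refine E.not_forall_qnorm_le (C * E.qnorm f) fun g hg => (H f hf g (E.memLZero g hg) ?_).2
  intro u hu
  simp_rw [rearr_rpow α _ hq]
  have := ((rearrFn_antitone f).rpow hq.le).setLIntegral_Ioi_eq_top
    (fun t ht => ENNReal.rpow_lt_top_of_nonneg hq.le (rearrFn_lt_top (E.memLZero f hf) ht).ne)
    ht htop (t := u)
  exact le_top.trans_eq this.symm

end SymmetricSpace

/-! ### Splitting a function at a prescribed measure -/

theorem exists_measurableSet_subset_measure_eq (μ : Measure ℝ) [NullSingletonClass μ] {B : Set ℝ}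
    (hB : MeasurableSet B) (hfin : μ B ≠ ⊤) {v : ℝ≥0∞} (hv : v ≤ μ B) :
    ∃ S ⊆ B, MeasurableSet S ∧ μ S = v := by
  have : IsFiniteMeasure (μ.restrict B) := ⟨by rwa [Measure.restrict_apply_univ, lt_top_iff_ne_top]⟩
  have hm : MeasurableSet {x | μ.restrict B (Iic x) ≤ v} :=
    measurableSet_le measure_Iic_mono.measurable measurable_const
  refine ⟨_ ∩ B, inter_subset_right, hm.inter hB, ?_⟩
  rw [← Measure.restrict_apply hm]
  exact measure_setOf_measure_Iic_le (fun x => measure_ne_top _ _) (by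
    rwa [Measure.restrict_apply_univ])

theorem volume_restrict_Ioc_ofReal_lt (D : ℝ≥0∞) (t : ℝ) :
    (volume.restrict (Ioc 0 t)) {u : ℝ | ENNReal.ofReal u < D} = min D (ENNReal.ofReal t) := by
  rw [← ivolume_ofReal_lt, ivolume, ← Measure.restrict_congr_set Ioo_ae_eq_Ioc]
  congr 2
  ext x
  simp only [mem_Ioo, mem_ofPred_eq]
  refine and_congr_right fun hx => ?_
  rw [ENNReal.ofReal_lt_ofReal_iff_of_nonneg hx.le]

/-- An `f` whose rearrangement has a finite tail splits into a part of measure at most `t`, carrying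
the values of `f^*` on `(0, t]`, and a remainder carrying the values of `f^*` beyond `t`. -/
theorem exists_split {𝕜 : Type*} [RCLike 𝕜] {α : ℝ≥0∞} (f : Fn 𝕜 α) {p q : ℝ} (hp : 0 < p)
    (hq : 0 < q) {t : ℝ} (ht : 0 < t) (htail : ∫⁻ s in Ioi t, rearrFn f s ^ q ≠ ⊤) :
    ∃ S, MeasurableSet S ∧
      ∫⁻ x in S, ‖f x‖ₑ ^ p ∂(ivolume α) ≤ ∫⁻ s in Ioc 0 t, rearrFn f s ^ p ∧
      ∫⁻ x in Sᶜ, ‖f x‖ₑ ^ q ∂(ivolume α) ≤ ∫⁻ s in Ioi t, rearrFn f s ^ q := by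
  have hfm := measurable_enorm_fn f
  rcases eq_or_ne (rearrFn f t) 0 with h0 | h0
  -- if `f^*` vanishes from `t` on, then all of `f` belongs to the first part
  · refine ⟨univ, MeasurableSet.univ, ?_, by simp⟩
    rw [Measure.restrict_univ, ← lintegral_rearr_rpow α hfm hp, setLIntegral_Ioc_add_Ioi _ ht.le]
    have : ∫⁻ s in Ioi t, rearr α (fun x => ‖f x‖ₑ) s ^ p = 0 := by
      rw [setLIntegral_congr_fun (g := fun _ => 0) measurableSet_Ioi, lintegral_zero]
      intro s hs
      have : rearrFn f s = 0 := le_antisymm (h0 ▸ rearrFn_antitone f (le_of_lt hs)) zero_le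
      change rearrFn f s ^ p = 0
      rw [this, ENNReal.zero_rpow_of_pos hp]
    rw [this, add_zero]
    rfl
  -- a level set of infinite measure would make the tail of `f^*` diverge
  have hdfin : ∀ s, 0 < s → ivolume α {x | s < ‖f x‖ₑ} ≠ ⊤ := by
    intro s hs htop
    refine htail (top_le_iff.1 ?_)
    calc (⊤ : ℝ≥0∞) = ∫⁻ _ in Ioi t, s ^ q := by
          rw [setLIntegral_const, Real.volume_Ioi, ENNReal.mul_top]
          exact (ENNReal.rpow_pos_of_nonneg hs hq.le).ne'
      _ ≤ _ := by
        refine lintegral_mono fun u => ENNReal.rpow_le_rpow (le_of_lt ?_) hq.le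
        exact lt_rearr_iff.2 (htop ▸ ENNReal.ofReal_lt_top)
  set l := rearrFn f t with hl
  set A : Set ℝ := {x | l < ‖f x‖ₑ} with hA
  set B : Set ℝ := {x | ‖f x‖ₑ = l} with hB
  have hAm : MeasurableSet A := measurableSet_lt measurable_const hfm
  have hBm : MeasurableSet B := hfm (measurableSet_singleton l)
  have hAt : ivolume α A ≤ ENNReal.ofReal t :=
    not_lt.1 fun h => lt_irrefl _ (lt_rearr_iff.2 h)
  obtain ⟨u, hu, hu', hlim⟩ := exists_seq_strictMono_tendsto' (pos_iff_ne_zero.2 h0)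
  have hge : ENNReal.ofReal t ≤ ivolume α {x | l ≤ ‖f x‖ₑ} := by
    have hI : {x | l ≤ ‖f x‖ₑ} = ⋂ n, {x | u n < ‖f x‖ₑ} := by
      ext x
      simp only [mem_iInter, mem_ofPred_eq]
      exact ⟨fun h n => (hu' n).2.trans_le h, fun h => le_of_tendsto' hlim fun n => (h n).le⟩
    have hanti : Antitone fun n => {x | u n < ‖f x‖ₑ} := by
      intro m n hmn x hx
      exact (hu.monotone hmn).trans_lt hx
    rw [hI, hanti.measure_iInter
      (fun n => (measurableSet_lt measurable_const hfm).nullMeasurableSet) ⟨0, hdfin _ (hu' 0).1⟩]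
    exact le_iInf fun n => (lt_rearr_iff.1 (hu' n).2).le
  have hAB : {x | l ≤ ‖f x‖ₑ} = A ∪ B := by
    ext x
    simp only [hA, hB, mem_union, mem_ofPred_eq]
    rw [le_iff_lt_or_eq, eq_comm (a := l)]
  have hBfin : ivolume α B ≠ ⊤ := by
    refine ne_top_of_le_ne_top (hdfin _ (hu' 0).1) (measure_mono fun x hx => ?_)
    have hx : ‖f x‖ₑ = l := hx
    exact (hu' 0).2.trans_eq hx.symm
  -- a part of `{|f| = f^*(t)}` fills up `{|f| > f^*(t)}` to a set of measure exactly `t`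
  obtain ⟨B', hB'B, hB'm, hB'⟩ := exists_measurableSet_subset_measure_eq (ivolume α) hBm hBfin
    (v := ENNReal.ofReal t - ivolume α A) (by
      rw [tsub_le_iff_left]
      exact hge.trans (hAB ▸ measure_union_le _ _))
  have hdisj : Disjoint A B' := Set.disjoint_left.2 fun x hx hx' => by
    have h1 : l < ‖f x‖ₑ := hx
    have h2 : ‖f x‖ₑ = l := hB'B hx'
    exact absurd h1 (not_lt.2 h2.le)
  have hS : ivolume α (A ∪ B') = ENNReal.ofReal t := by
    rw [measure_union hdisj hB'm, hB', add_tsub_cancel_of_le hAt]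
  have hSm := hAm.union hB'm
  refine ⟨A ∪ B', hSm, ?_, ?_⟩
  · refine lintegral_rpow_le_of_measure_lt_le hfm (measurable_rearrFn f) hp fun s => ?_
    have : {y | s < rearrFn f y} = {y | ENNReal.ofReal y < ivolume α {x | s < ‖f x‖ₑ}} := by
      ext y; exact lt_rearr_iff
    rw [this, volume_restrict_Ioc_ofReal_lt,
      Measure.restrict_apply (measurableSet_lt measurable_const hfm)]
    exact le_min (measure_mono inter_subset_left) (hS ▸ measure_mono inter_subset_right)
  · refine lintegral_rpow_le_of_measure_lt_le hfm (measurable_rearrFn f) hq fun s => ?_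
    have hsm : MeasurableSet {x | s < ‖f x‖ₑ} := measurableSet_lt measurable_const hfm
    rw [Measure.restrict_apply hsm, ← sdiff_eq]
    rcases le_or_gt l s with hls | hls
    · have : {x | s < ‖f x‖ₑ} \ (A ∪ B') = ∅ := by
        refine eq_empty_iff_forall_notMem.2 fun x hx => hx.2 (Or.inl ?_)
        exact hls.trans_lt hx.1
      rw [this, measure_empty]
      exact zero_le
    · have hsub : A ∪ B' ⊆ {x | s < ‖f x‖ₑ} := by
        intro x hx
        refine hls.trans_le ?_
        have : x ∈ {x | l ≤ ‖f x‖ₑ} := hAB ▸ (union_subset_union_right A hB'B) hx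
        exact this
      rw [measure_sdiff hsub hSm.nullMeasurableSet (hS ▸ ENNReal.ofReal_ne_top), hS,
        tsub_le_iff_left]
      have h1 := measure_lt_rearr α (fun x => ‖f x‖ₑ) s
      rw [← h1, ← Ioc_union_Ioi_eq_Ioi ht.le]
      refine (Measure.restrict_union_le _ _ _).trans ?_
      rw [Measure.add_apply]
      gcongr
      · refine (measure_mono (subset_univ _)).trans ?_
        simp
      · exact le_rfl

/-! ### The two-sided majorization of the image of a function -/

theorem ENNReal.add_rpow_le_two_rpow_mul (a b : ℝ≥0∞) {p : ℝ} (hp : 0 < p) :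
    (a + b) ^ p ≤ 2 ^ p * (a ^ p + b ^ p) := by
  wlog hab : a ≤ b generalizing a b
  · rw [add_comm a, add_comm (a ^ p)]
    exact this b a (le_of_not_ge hab)
  calc (a + b) ^ p ≤ (2 * b) ^ p := by
        refine ENNReal.rpow_le_rpow ?_ hp.le
        rw [two_mul]
        gcongr
    _ = 2 ^ p * b ^ p := ENNReal.mul_rpow_of_nonneg _ _ hp.le
    _ ≤ _ := by gcongr; exact le_add_self

theorem lintegral_Ioi_comp_div {h : ℝ → ℝ≥0∞} (hh : Measurable h) {c : ℝ} (hc : 0 < c) (a : ℝ) :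
    ∫⁻ u in Ioi a, h (u / c) = ENNReal.ofReal c * ∫⁻ u in Ioi (a / c), h u := by
  have h1 : Measure.map (fun u : ℝ => u * c⁻¹) volume = ENNReal.ofReal |c| • volume := by
    rw [Real.map_volume_mul_right (inv_ne_zero hc.ne'), inv_inv]
  have h2 : ∫⁻ u in Ioi (a / c), h u ∂(Measure.map (fun u : ℝ => u * c⁻¹) volume) =
      ∫⁻ u in Ioi a, h (u / c) := by
    rw [setLIntegral_map measurableSet_Ioi hh (measurable_mul_const _)]
    have : (fun u : ℝ => u * c⁻¹) ⁻¹' Ioi (a / c) = Ioi a := by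
      ext u
      rw [mem_preimage, ← div_eq_mul_inv, mem_Ioi, mem_Ioi, div_lt_div_iff_of_pos_right hc]
    rw [this]
    rfl
  rw [← h2, h1, Measure.restrict_smul, lintegral_smul_measure, abs_of_pos hc, smul_eq_mul]

/-- If `g ≤ g₁ + g₂` with `g₁` of size `l` in the `L_p`-mean and `g₂` of size `l` in the `L_q`-mean
at the scale `t`, then the head of `g^*` has size `l` in `L_p`, and its tail has size `l` in
`L_q`. -/
theorem exists_head_tail_bound {p q : ℝ} (hp : 0 < p) (hpq : p < q) :
    ∃ C : ℝ≥0∞, C ≠ ⊤ ∧ ∀ (α : ℝ≥0∞) (g g₁ g₂ : ℝ → ℝ≥0∞), Measurable g₁ → Measurable g₂ →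
      (∀ᵐ x ∂(ivolume α), g x ≤ g₁ x + g₂ x) → ∀ (t : ℝ) (l : ℝ≥0∞), 0 < t → l ≠ ⊤ →
      ∫⁻ x, g₁ x ^ p ∂(ivolume α) ≤ ENNReal.ofReal t * l ^ p →
      ∫⁻ x, g₂ x ^ q ∂(ivolume α) ≤ ENNReal.ofReal t * l ^ q →
      ∫⁻ s in Ioc 0 t, rearr α g s ^ p ≤ C * (ENNReal.ofReal t * l ^ p) ∧
      ∫⁻ s in Ioi t, rearr α g s ^ q ≤ C * (ENNReal.ofReal t * l ^ q) := by
  have hq : 0 < q := hp.trans hpq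
  set D : ℝ≥0∞ := 2 ^ ((q - p) / p) with hD
  have hDt : D ≠ ⊤ := ENNReal.rpow_ne_top_of_nonneg (div_nonneg (by linarith) hp.le) (by simp)
  refine ⟨max (2 ^ p * 5) (2 ^ q * (2 * D + 2)), ?_, ?_⟩
  · have h1 : (2 : ℝ≥0∞) ^ p ≠ ⊤ := ENNReal.rpow_ne_top_of_nonneg hp.le (by simp)
    have h2 : (2 : ℝ≥0∞) ^ q ≠ ⊤ := ENNReal.rpow_ne_top_of_nonneg hq.le (by simp)
    exact (max_lt (by finiteness) (by finiteness)).ne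
  intro α g g₁ g₂ hg₁ hg₂ hg t l ht hlt h₁ h₂
  rcases eq_or_ne l 0 with rfl | hl0
  · have hz : ∀ᵐ x ∂(ivolume α), g x = 0 := by
      rw [ENNReal.zero_rpow_of_pos hp, mul_zero] at h₁
      rw [ENNReal.zero_rpow_of_pos hq, mul_zero] at h₂
      have e1 := (lintegral_eq_zero_iff (hg₁.pow_const p)).1 (le_antisymm h₁ zero_le)
      have e2 := (lintegral_eq_zero_iff (hg₂.pow_const q)).1 (le_antisymm h₂ zero_le)
      filter_upwards [hg, e1, e2] with x hx h1 h2
      have h1 : g₁ x ^ p = 0 := h1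
      have h2 : g₂ x ^ q = 0 := h2
      rw [ENNReal.rpow_eq_zero_iff_of_pos hp] at h1
      rw [ENNReal.rpow_eq_zero_iff_of_pos hq] at h2
      rw [h1, h2, add_zero] at hx
      exact le_antisymm hx zero_le
    have hr : ∀ s, rearr α g s = 0 := fun s => by
      rw [rearr_congr_ae hz]
      exact le_antisymm (sInf_le (by simp)) zero_le
    simp [hr, hp, hq]
  have hg1r := measurable_rearr α g₁
  have hg2r := measurable_rearr α g₂
  have hdil : ∀ (k : ℝ → ℝ≥0∞) (r : ℝ), Measurable fun s : ℝ => rearr α k (s / 2) ^ r := fun k r =>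
    ((measurable_rearr α k).comp (measurable_id.div_const 2)).pow_const r
  have hsub : ∀ u, 0 < u → rearr α g u ≤ rearr α g₁ (u / 2) + rearr α g₂ (u / 2) := by
    intro u hu
    have := rearr_add_le hg (half_pos hu).le (half_pos hu).le
    rwa [add_halves] at this
  have hI1 : ∫⁻ u in Ioi (0 : ℝ), rearr α g₁ (u / 2) ^ p ≤ 2 * (ENNReal.ofReal t * l ^ p) := by
    rw [lintegral_Ioi_comp_div (hg1r.pow_const p) two_pos, zero_div, ENNReal.ofReal_ofNat,
      lintegral_rearr_rpow α hg₁ hp]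
    gcongr
  have hI2 : ∫⁻ u in Ioi (0 : ℝ), rearr α g₂ (u / 2) ^ q ≤ 2 * (ENNReal.ofReal t * l ^ q) := by
    rw [lintegral_Ioi_comp_div (hg2r.pow_const q) two_pos, zero_div, ENNReal.ofReal_ofNat,
      lintegral_rearr_rpow α hg₂ hq]
    gcongr
  have hadd : ∀ (r : ℝ), 0 < r → ∀ S ⊆ Ioi (0 : ℝ), MeasurableSet S →
      ∫⁻ s in S, rearr α g s ^ r ≤ 2 ^ r * ((∫⁻ s in S, rearr α g₁ (s / 2) ^ r) +
        ∫⁻ s in S, rearr α g₂ (s / 2) ^ r) := by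
    intro r hr S hS hSm
    rw [← lintegral_add_left (hdil g₁ r),
      ← lintegral_const_mul]
    · refine setLIntegral_mono' hSm fun u hu => ?_
      refine (ENNReal.rpow_le_rpow (hsub u (hS hu)) hr.le).trans ?_
      exact ENNReal.add_rpow_le_two_rpow_mul _ _ hr
    · exact (hdil g₁ r).add (hdil g₂ r)
  constructor
  · refine le_trans ?_ (mul_le_mul_left (le_max_left _ _) _)
    refine (hadd p hp _ Ioc_subset_Ioi_self measurableSet_Ioc).trans ?_
    have e1 : ∫⁻ s in Ioc 0 t, rearr α g₁ (s / 2) ^ p ≤ 2 * (ENNReal.ofReal t * l ^ p) :=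
      (lintegral_mono_set Ioc_subset_Ioi_self).trans hI1
    -- where `g₂^*` exceeds `l`, its `p`-th power is at most `l ^ (p - q)` times its `q`-th power
    have e2 : ∫⁻ s in Ioc 0 t, rearr α g₂ (s / 2) ^ p ≤ 3 * (ENNReal.ofReal t * l ^ p) := by
      calc ∫⁻ s in Ioc 0 t, rearr α g₂ (s / 2) ^ p
          ≤ ∫⁻ s in Ioc 0 t, (l ^ p + l ^ (p - q) * rearr α g₂ (s / 2) ^ q) := by
            refine lintegral_mono fun s => ?_
            rcases le_total (rearr α g₂ (s / 2)) l with h | h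
            · exact (ENNReal.rpow_le_rpow h hp.le).trans le_self_add
            · refine le_trans ?_ le_add_self
              have h' : rearr α g₂ (s / 2) ≠ 0 := fun h0 => hl0 (le_antisymm (h0 ▸ h) zero_le)
              set y := rearr α g₂ (s / 2)
              rcases eq_or_ne y ⊤ with hy | hy
              · rw [hy, ENNReal.top_rpow_of_pos hq, ENNReal.mul_top
                  (ENNReal.rpow_pos (pos_iff_ne_zero.2 hl0) hlt).ne']
                exact le_top
              · calc y ^ p = y ^ (p - q) * y ^ q := by
                      rw [← ENNReal.rpow_add _ _ h' hy, sub_add_cancel]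
                  _ ≤ _ := by
                      gcongr ?_ * _
                      rw [← neg_sub q p, ENNReal.rpow_neg, ENNReal.rpow_neg]
                      exact ENNReal.inv_le_inv.2 (ENNReal.rpow_le_rpow h (by linarith))
        _ = ENNReal.ofReal t * l ^ p + l ^ (p - q) * ∫⁻ s in Ioc 0 t, rearr α g₂ (s / 2) ^ q := by
            rw [lintegral_add_left measurable_const, lintegral_const_mul, setLIntegral_const,
              Real.volume_Ioc, sub_zero, mul_comm (l ^ p)]
            exact hdil g₂ q
        _ ≤ ENNReal.ofReal t * l ^ p + l ^ (p - q) * (2 * (ENNReal.ofReal t * l ^ q)) := by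
            gcongr
            exact (lintegral_mono_set Ioc_subset_Ioi_self).trans hI2
        _ = ENNReal.ofReal t * l ^ p + 2 * ENNReal.ofReal t * (l ^ (p - q) * l ^ q) := by ring
        _ = 3 * (ENNReal.ofReal t * l ^ p) := by
            rw [← ENNReal.rpow_add _ _ hl0 hlt, sub_add_cancel]
            ring
    calc _ ≤ 2 ^ p * (2 * (ENNReal.ofReal t * l ^ p) + 3 * (ENNReal.ofReal t * l ^ p)) := by gcongr
      _ = _ := by ring
  · refine le_trans ?_ (mul_le_mul_left (le_max_right _ _) _)
    refine (hadd q hq _ (Ioi_subset_Ioi ht.le) measurableSet_Ioi).trans ?_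
    have e2 : ∫⁻ s in Ioi t, rearr α g₂ (s / 2) ^ q ≤ 2 * (ENNReal.ofReal t * l ^ q) :=
      (lintegral_mono_set (Ioi_subset_Ioi ht.le)).trans hI2
    -- Chebyshev's inequality bounds `g₁^*(u / 2)` for `u ≥ t`
    have hcheb : ∀ u, t < u → rearr α g₁ (u / 2) ^ p ≤ 2 * l ^ p := by
      intro u hu
      have h3 := ((rearr_antitone α g₁).rpow hp.le).le_setLIntegral_Ioc 0 (u / 2)
      have h4 : ∫⁻ s in Ioc 0 (u / 2), rearr α g₁ s ^ p ≤ ENNReal.ofReal t * l ^ p :=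
        (lintegral_mono_set Ioc_subset_Ioi_self).trans
          ((lintegral_rearr_rpow α hg₁ hp).trans_le h₁)
      have h5 : rearr α g₁ (u / 2) ^ p * ENNReal.ofReal (t / 2) ≤
          2 * l ^ p * ENNReal.ofReal (t / 2) := by
        calc _ ≤ rearr α g₁ (u / 2) ^ p * ENNReal.ofReal (u / 2 - 0) := by
              gcongr
              linarith
          _ ≤ ENNReal.ofReal t * l ^ p := h3.trans h4
          _ = 2 * l ^ p * ENNReal.ofReal (t / 2) := by
              rw [mul_right_comm, ← ENNReal.ofReal_ofNat, ← ENNReal.ofReal_mul zero_le_two]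
              congr 2
              ring
      exact (ENNReal.mul_le_mul_iff_left (ENNReal.ofReal_pos.2 (half_pos ht)).ne'
        ENNReal.ofReal_ne_top).1 h5
    have e1 : ∫⁻ s in Ioi t, rearr α g₁ (s / 2) ^ q ≤ 2 * D * (ENNReal.ofReal t * l ^ q) := by
      calc ∫⁻ s in Ioi t, rearr α g₁ (s / 2) ^ q
          ≤ ∫⁻ s in Ioi t, (2 * l ^ p) ^ ((q - p) / p) * rearr α g₁ (s / 2) ^ p := by
            refine setLIntegral_mono' measurableSet_Ioi fun u hu => ?_
            have h6 : rearr α g₁ (u / 2) ^ q =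
                (rearr α g₁ (u / 2) ^ p) ^ ((q - p) / p) * rearr α g₁ (u / 2) ^ p := by
              rw [← ENNReal.rpow_mul, mul_div_cancel₀ _ hp.ne',
                ← ENNReal.rpow_add_of_nonneg _ _ (by linarith) hp.le, sub_add_cancel]
            rw [h6]
            gcongr ?_ * _
            exact ENNReal.rpow_le_rpow (hcheb u hu) (div_nonneg (by linarith) hp.le)
        _ ≤ (2 * l ^ p) ^ ((q - p) / p) * (2 * (ENNReal.ofReal t * l ^ p)) := by
            rw [lintegral_const_mul _ (hdil g₁ p)]
            gcongr
            exact (lintegral_mono_set (Ioi_subset_Ioi ht.le)).trans hI1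
        _ = 2 * D * (ENNReal.ofReal t * (l ^ (q - p) * l ^ p)) := by
            rw [ENNReal.mul_rpow_of_nonneg _ _ (div_nonneg (by linarith) hp.le), ← ENNReal.rpow_mul,
              mul_div_cancel₀ _ hp.ne']
            ring
        _ = _ := by
            rw [← ENNReal.rpow_add_of_nonneg _ _ (by linarith) hp.le, sub_add_cancel]
    calc _ ≤ 2 ^ q * (2 * D * (ENNReal.ofReal t * l ^ q) + 2 * (ENNReal.ofReal t * l ^ q)) := by
          gcongr
      _ = _ := by ring

/-! ### Combining left and right majorization -/

/-- A set `W` in `(0, t]` is covered by `(0, sup W]` if the supremum is attained, and otherwise by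
an increasing sequence of intervals `(0, a]` with `a ∈ W`. -/
theorem measure_le_of_forall_Ioc_le {ν : Measure ℝ} {W : Set ℝ} {b : ℝ≥0∞} {t : ℝ}
    (hW : W ⊆ Ioc 0 t) (h : ∀ a ∈ W, ν (Ioc 0 a) ≤ b) : ν W ≤ b := by
  rcases W.eq_empty_or_nonempty with rfl | hne
  · simp
  have hbdd : BddAbove W := ⟨t, fun a ha => (hW ha).2⟩
  by_cases hmem : sSup W ∈ W
  · exact (measure_mono fun x hx => mem_Ioc.2 ⟨(hW hx).1, le_csSup hbdd hx⟩).trans (h _ hmem)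
  · obtain ⟨u, hu, hlim, huW⟩ := exists_seq_tendsto_sSup hne hbdd
    have hsub : W ⊆ ⋃ n, Ioc 0 (u n) := by
      intro x hx
      have hlt : x < sSup W := lt_of_le_of_ne (le_csSup hbdd hx) fun h => hmem (h ▸ hx)
      obtain ⟨n, hn⟩ := (hlim.eventually (lt_mem_nhds hlt)).exists
      exact mem_iUnion.2 ⟨n, (hW hx).1, hn.le⟩
    have hmono : Monotone fun n => Ioc 0 (u n) := fun m n hmn => Ioc_subset_Ioc_right (hu hmn)
    refine (measure_mono hsub).trans ?_
    rw [hmono.measure_iUnion]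
    exact iSup_le fun n => h _ (huW n)

/-- A set `W` in `(t, ∞)` is covered by `[inf W, ∞)` if the infimum is attained, and otherwise by an
increasing sequence of half-lines `[a, ∞)` with `a ∈ W`. -/
theorem measure_le_of_forall_Ici_le {ν : Measure ℝ} {W : Set ℝ} {b : ℝ≥0∞} {t : ℝ}
    (hW : W ⊆ Ioi t) (h : ∀ a ∈ W, ν (Ici a) ≤ b) : ν W ≤ b := by
  rcases W.eq_empty_or_nonempty with rfl | hne
  · simp
  have hbdd : BddBelow W := ⟨t, fun a ha => le_of_lt (hW ha)⟩
  by_cases hmem : sInf W ∈ W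
  · exact (measure_mono fun x hx => csInf_le hbdd hx).trans (h _ hmem)
  · obtain ⟨u, hu, hlim, huW⟩ := exists_seq_tendsto_sInf hne hbdd
    have hsub : W ⊆ ⋃ n, Ici (u n) := by
      intro x hx
      have hlt : sInf W < x := lt_of_le_of_ne (csInf_le hbdd hx) fun h => hmem (h ▸ hx)
      obtain ⟨n, hn⟩ := (hlim.eventually (gt_mem_nhds hlt)).exists
      exact mem_iUnion.2 ⟨n, hn.le⟩
    have hmono : Monotone fun n => Ici (u n) := fun m n hmn => Ici_subset_Ici.2 (hu hmn)
    refine (measure_mono hsub).trans ?_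
    rw [hmono.measure_iUnion]
    exact iSup_le fun n => h _ (huW n)

theorem measurableSet_head_le (F G : ℝ → ℝ≥0∞) :
    MeasurableSet {t : ℝ | ∫⁻ s in Ioc 0 t, G s ≤ ∫⁻ s in Ioc 0 t, F s} := by
  have h : ∀ F : ℝ → ℝ≥0∞, Monotone fun t : ℝ => ∫⁻ s in Ioc 0 t, F s := fun F a b hab =>
    lintegral_mono_set (Ioc_subset_Ioc_right hab)
  exact measurableSet_le (h G).measurable (h F).measurable

/-- The part of a nonincreasing function `G` sitting over the points where its head is dominated by
that of `F` has a rearrangement whose head is dominated by twice that of `F`. -/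
theorem head_rearr_indicator_le {α : ℝ≥0∞} {F G : ℝ → ℝ≥0∞} (hF : Antitone F) (hG : Antitone G)
    {t : ℝ} (ht : 0 < t) :
    ∫⁻ s in Ioc 0 t, rearr α
      ({t : ℝ | ∫⁻ s in Ioc 0 t, G s ≤ ∫⁻ s in Ioc 0 t, F s}.indicator G) s ≤
    2 * ∫⁻ s in Ioc 0 t, F s := by
  set A : Set ℝ := {t : ℝ | ∫⁻ s in Ioc 0 t, G s ≤ ∫⁻ s in Ioc 0 t, F s} with hA
  have hAm : MeasurableSet A := measurableSet_head_le F G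
  have hA' : ∀ a ∈ A, ∫⁻ s in Ioc 0 a, G s ≤ ∫⁻ s in Ioc 0 a, F s := fun a ha => ha
  have hGm : Measurable (A.indicator G) := hG.measurable.indicator hAm
  set b := ∫⁻ s in Ioc 0 t, F s with hb
  have ht0 : ENNReal.ofReal t ≠ 0 := (ENNReal.ofReal_pos.2 ht).ne'
  -- The part of `A` beyond `t` carries values at most `b / t`, by comparison of averages; the part
  -- up to `t` has mass at most `b`, being a limit of heads of `G` that end in `A`.
  set H₁ : ℝ → ℝ≥0∞ := (Iic t).indicator (A.indicator G)
  set H₂ : ℝ → ℝ≥0∞ := (Ioi t).indicator (A.indicator G)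
  have hle : ∀ s, 0 < s → rearr α (A.indicator G) s ≤ rearr α H₁ s + b / ENNReal.ofReal t := by
    intro s hs
    have h1 := rearr_add_le (α := α) (F := A.indicator G) (G := H₁) (H := H₂)
      (Eventually.of_forall fun x => by
        rcases le_or_gt x t with hx | hx
        · rw [show H₁ x = A.indicator G x from indicator_of_mem (mem_Iic.2 hx) _]
          exact le_self_add
        · rw [show H₂ x = A.indicator G x from indicator_of_mem hx _]
          exact le_add_self) hs.le le_rfl
    rw [add_zero] at h1
    refine h1.trans (add_le_add_right (rearr_zero_le_of_ae_le (Eventually.of_forall fun x => ?_)) _)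
    by_cases hx : x ∈ Ioi t
    · rw [show H₂ x = A.indicator G x from indicator_of_mem hx _]
      by_cases hxA : x ∈ A
      · rw [indicator_of_mem hxA, ENNReal.le_div_iff_mul_le (Or.inl ht0)
          (Or.inl ENNReal.ofReal_ne_top)]
        have hx0 : 0 < x := ht.trans hx
        have h2 := hG.le_setLIntegral_Ioc 0 x
        rw [sub_zero] at h2
        have h3 := hF.setLIntegral_average_le ht (le_of_lt hx)
        have h4 : G x * ENNReal.ofReal t * ENNReal.ofReal x ≤ b * ENNReal.ofReal x := by
          calc _ = G x * ENNReal.ofReal x * ENNReal.ofReal t := by ring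
            _ ≤ (∫⁻ s in Ioc 0 x, F s) * ENNReal.ofReal t := by
              gcongr
              exact h2.trans (hA' x hxA)
            _ ≤ _ := h3
        exact (ENNReal.mul_le_mul_iff_left (ENNReal.ofReal_pos.2 hx0).ne'
          ENNReal.ofReal_ne_top).1 h4
      · rw [indicator_of_notMem hxA]
        exact zero_le
    · rw [show H₂ x = 0 from indicator_of_notMem hx _]
      exact zero_le
  calc _ ≤ ∫⁻ s in Ioc 0 t, (rearr α H₁ s + b / ENNReal.ofReal t) :=
        setLIntegral_mono' measurableSet_Ioc fun s hs => hle s hs.1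
    _ = (∫⁻ s in Ioc 0 t, rearr α H₁ s) + b := by
        rw [lintegral_add_left (measurable_rearr _ _), setLIntegral_const, Real.volume_Ioc,
          sub_zero, ENNReal.div_mul_cancel ht0 ENNReal.ofReal_ne_top]
    _ ≤ b + b := by
        gcongr
        calc ∫⁻ s in Ioc 0 t, rearr α H₁ s ≤ ∫⁻ s in Ioi 0, rearr α H₁ s :=
              lintegral_mono_set Ioc_subset_Ioi_self
          _ = ∫⁻ x, H₁ x ∂(ivolume α) := lintegral_rearr α (hGm.indicator measurableSet_Iic)
          _ ≤ ∫⁻ x in Ioi 0, H₁ x := lintegral_mono' (ivolume_le_restrict_Ioi α) le_rfl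
          _ = ∫⁻ x in A ∩ Ioc 0 t, G x := by
              rw [← lintegral_indicator measurableSet_Ioi, ← lintegral_indicator
                (hAm.inter measurableSet_Ioc)]
              congr 1
              ext x
              simp only [H₁, indicator_apply, mem_Ioi, mem_Iic, mem_inter_iff, mem_Ioc]
              by_cases h1 : 0 < x <;> by_cases h2 : x ≤ t <;> by_cases h3 : x ∈ A <;>
                simp [h1, h2, h3]
          _ ≤ b := by
              rw [← withDensity_apply _ (hAm.inter measurableSet_Ioc)]
              refine measure_le_of_forall_Ioc_le (t := t) inter_subset_right fun a ha => ?_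
              rw [withDensity_apply _ measurableSet_Ioc]
              exact (hA' a ha.1).trans (lintegral_mono_set (Ioc_subset_Ioc_right ha.2.2))
    _ = 2 * b := (two_mul b).symm

/-- The part of `G` sitting over a set of points where its tail is dominated by that of `F` has a
rearrangement whose tail is dominated by that of `F`. -/
theorem tail_rearr_indicator_le {α : ℝ≥0∞} {F G : ℝ → ℝ≥0∞} {A : Set ℝ} (hA : MeasurableSet A)
    (hGm : Measurable G)
    (h : ∀ a ∈ A, 0 < a → ∫⁻ s in Ioi a, G s ≤ ∫⁻ s in Ioi a, F s) {t : ℝ} (ht : 0 < t) :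
    ∫⁻ s in Ioi t, rearr α (A.indicator G) s ≤ ∫⁻ s in Ioi t, F s := by
  have hm : Measurable (A.indicator G) := hGm.indicator hA
  set H₁ : ℝ → ℝ≥0∞ := (Ioc 0 t).indicator fun _ => ⊤
  set H₂ : ℝ → ℝ≥0∞ := (Ioi t).indicator (A.indicator G)
  -- a piece supported in a set of measure `t` does not affect the tail beyond `t`
  have hH₁ : rearr α H₁ t = 0 := by
    refine le_antisymm (sInf_le ?_) zero_le
    change ivolume α {x | 0 < H₁ x} ≤ ENNReal.ofReal t
    calc _ ≤ volume (Ioc 0 t) := (ivolume_le_volume α _).trans (measure_mono fun x hx => by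
            by_contra hn
            have hx : 0 < H₁ x := hx
            rw [show H₁ x = 0 from indicator_of_notMem hn _] at hx
            exact lt_irrefl _ hx)
      _ = _ := by rw [Real.volume_Ioc, sub_zero]
  have hle : ∀ s, 0 ≤ s → rearr α (A.indicator G) (t + s) ≤ rearr α H₂ s := by
    intro s hs
    have h1 := rearr_add_le (α := α) (F := A.indicator G) (G := H₁) (H := H₂) (by
      filter_upwards [ae_ivolume_mem α] with x hx
      rcases le_or_gt x t with hxt | hxt
      · rw [show H₁ x = ⊤ from indicator_of_mem (mem_Ioc.2 ⟨hx.1, hxt⟩) _]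
        simp
      · rw [show H₂ x = A.indicator G x from indicator_of_mem hxt _]
        exact le_add_self) ht.le hs
    rwa [hH₁, zero_add] at h1
  calc ∫⁻ s in Ioi t, rearr α (A.indicator G) s
      = ∫⁻ s in Ioi 0, rearr α (A.indicator G) (t + s) := by
        rw [← (measurePreserving_add_left volume t).setLIntegral_comp_preimage measurableSet_Ioi
          (measurable_rearr _ _)]
        simp
    _ ≤ ∫⁻ s in Ioi 0, rearr α H₂ s :=
        setLIntegral_mono' measurableSet_Ioi fun s hs => hle s (le_of_lt hs)
    _ = ∫⁻ x, H₂ x ∂(ivolume α) := lintegral_rearr α (hm.indicator measurableSet_Ioi)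
    _ ≤ ∫⁻ x, H₂ x := lintegral_mono' (ivolume_le_volume α) le_rfl
    _ = ∫⁻ x in A ∩ Ioi t, G x := by
        rw [lintegral_indicator measurableSet_Ioi, ← Measure.restrict_restrict hA,
          lintegral_indicator hA]
    _ ≤ ∫⁻ s in Ioi t, F s := by
        rw [← withDensity_apply _ (hA.inter measurableSet_Ioi)]
        refine measure_le_of_forall_Ici_le (t := t) inter_subset_right fun a ha => ?_
        rw [withDensity_apply _ measurableSet_Ici, setLIntegral_congr Ioi_ae_eq_Ici.symm]
        exact (h a ha.1 (ht.trans ha.2)).trans (lintegral_mono_set (Ioi_subset_Ioi (le_of_lt ha.2)))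

/-! ### Membership in Lebesgue spaces and restriction to a set -/

section

variable {𝕜 : Type*} [RCLike 𝕜] {α : ℝ≥0∞}

theorem eLpNorm_ofReal_eq (f : ℝ → 𝕜) (μ : Measure ℝ) {p : ℝ} (hp : 0 < p) :
    eLpNorm f (ENNReal.ofReal p) μ = (∫⁻ x, ‖f x‖ₑ ^ p ∂μ) ^ (1 / p) := by
  rw [eLpNorm_eq_lintegral_rpow_enorm_toReal (ENNReal.ofReal_pos.2 hp).ne' ENNReal.ofReal_ne_top,
    ENNReal.toReal_ofReal hp.le]

theorem mem_LpSubmodule_iff {f : Fn 𝕜 α} {p : ℝ} (hp : 0 < p) :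
    f ∈ Lp.LpSubmodule 𝕜 𝕜 (ENNReal.ofReal p) (ivolume α) ↔
      ∫⁻ x, ‖f x‖ₑ ^ p ∂(ivolume α) ≠ ⊤ := by
  change eLpNorm f (ENNReal.ofReal p) (ivolume α) < ⊤ ↔ _
  rw [eLpNorm_ofReal_eq _ _ hp, lt_top_iff_ne_top, ne_eq,
    ENNReal.rpow_eq_top_iff_of_pos (by positivity)]

theorem eLpNorm_ofReal_le_iff {f g : ℝ → 𝕜} {μ : Measure ℝ} {p : ℝ} (hp : 0 < p) :
    eLpNorm f (ENNReal.ofReal p) μ ≤ eLpNorm g (ENNReal.ofReal p) μ ↔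
      ∫⁻ x, ‖f x‖ₑ ^ p ∂μ ≤ ∫⁻ x, ‖g x‖ₑ ^ p ∂μ := by
  rw [eLpNorm_ofReal_eq _ _ hp, eLpNorm_ofReal_eq _ _ hp,
    ENNReal.rpow_le_rpow_iff (by positivity)]

/-- The restriction `f 1_S`. -/
noncomputable def cutFn (f : Fn 𝕜 α) {S : Set ℝ} (hS : MeasurableSet S) : Fn 𝕜 α :=
  AEEqFun.mk (S.indicator f) (f.measurable.indicator hS).aestronglyMeasurable

theorem coeFn_cutFn (f : Fn 𝕜 α) {S : Set ℝ} (hS : MeasurableSet S) :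
    cutFn f hS =ᵐ[ivolume α] S.indicator f := AEEqFun.coeFn_mk _ _

theorem cutFn_add_cutFn_compl (f : Fn 𝕜 α) {S : Set ℝ} (hS : MeasurableSet S) :
    cutFn f hS + cutFn f hS.compl = f := by
  refine AEEqFun.ext ?_
  filter_upwards [AEEqFun.coeFn_add (cutFn f hS) (cutFn f hS.compl), coeFn_cutFn f hS,
    coeFn_cutFn f hS.compl] with x h1 h2 h3
  rw [h1, Pi.add_apply, h2, h3, indicator_self_add_compl_apply]

theorem lintegral_cutFn (f : Fn 𝕜 α) {S : Set ℝ} (hS : MeasurableSet S) {p : ℝ} (hp : 0 < p) :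
    ∫⁻ x, ‖cutFn f hS x‖ₑ ^ p ∂(ivolume α) = ∫⁻ x in S, ‖f x‖ₑ ^ p ∂(ivolume α) := by
  rw [← lintegral_indicator hS]
  refine lintegral_congr_ae ?_
  filter_upwards [coeFn_cutFn f hS] with x hx
  rw [hx]
  by_cases h : x ∈ S
  · rw [indicator_of_mem h, indicator_of_mem h]
  · rw [indicator_of_notMem h, indicator_of_notMem h, enorm_zero, ENNReal.zero_rpow_of_pos hp]

theorem measure_one_lt_le_lintegral_rpow {α : ℝ≥0∞} {h : ℝ → ℝ≥0∞} (hm : Measurable h) {p : ℝ}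
    (hp : 0 < p) : ivolume α {x | 1 < h x} ≤ ∫⁻ x, h x ^ p ∂(ivolume α) := by
  have h1 := mul_meas_ge_le_lintegral (μ := ivolume α) (hm.pow_const p) 1
  rw [one_mul] at h1
  refine (measure_mono fun x hx => ?_).trans h1
  have hx : 1 < h x := hx
  exact ENNReal.one_le_rpow hx.le hp

theorem memLZero_of_mem_LpSum {f : Fn 𝕜 α} {p q : ℝ} (hp : 0 < p) (hq : 0 < q)
    (hf : f ∈ LpSum 𝕜 α (ENNReal.ofReal p) (ENNReal.ofReal q)) : MemLZero f := by
  obtain ⟨g, hg, h, hh, rfl⟩ := Submodule.mem_sup.1 hf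
  rw [mem_LpSubmodule_iff hp] at hg
  rw [mem_LpSubmodule_iff hq] at hh
  refine (memLZero_iff_finiteDistr _).2 ⟨2, by simp, ?_⟩
  calc _ ≤ ivolume α ({x | 1 < ‖g x‖ₑ} ∪ {x | 1 < ‖h x‖ₑ}) := by
        refine measure_mono_ae ?_
        filter_upwards [AEEqFun.coeFn_add g h] with x hx h2
        have h2 : 2 < ‖(g + h) x‖ₑ := h2
        by_contra hn
        have hn' : ¬ (1 < ‖g x‖ₑ) ∧ ¬ (1 < ‖h x‖ₑ) := not_or.1 hn
        rw [hx, Pi.add_apply] at h2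
        refine absurd (h2.trans_le (enorm_add_le _ _)) (not_lt.2 ?_)
        rw [← one_add_one_eq_two]
        exact add_le_add (not_lt.1 hn'.1) (not_lt.1 hn'.2)
    _ ≤ _ := measure_union_le _ _
    _ < ⊤ := ENNReal.add_lt_top.2
      ⟨(measure_one_lt_le_lintegral_rpow (measurable_enorm_fn g) hp).trans_lt hg.lt_top,
        (measure_one_lt_le_lintegral_rpow (measurable_enorm_fn h) hq).trans_lt hh.lt_top⟩

end

theorem exists_const_rpow_ge {C : ℝ≥0∞} (hC : C ≠ ⊤) {p q : ℝ} (hp : 0 < p) (hq : 0 < q) :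
    ∃ r : ℝ, 0 < r ∧ C ≤ ENNReal.ofReal r ^ p ∧ C ≤ ENNReal.ofReal r ^ q := by
  set D : ℝ≥0∞ := max (max (C ^ (1 / p)) (C ^ (1 / q))) 1 with hD
  have hDt : D ≠ ⊤ := by
    have h1 : C ^ (1 / p) ≠ ⊤ := ENNReal.rpow_ne_top_of_nonneg (by positivity) hC
    have h2 : C ^ (1 / q) ≠ ⊤ := ENNReal.rpow_ne_top_of_nonneg (by positivity) hC
    exact (max_lt (max_lt h1.lt_top h2.lt_top) ENNReal.one_lt_top).ne
  have hD0 : D ≠ 0 := (lt_of_lt_of_le one_pos (le_max_right _ _)).ne'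
  refine ⟨D.toReal, ENNReal.toReal_pos hD0 hDt, ?_, ?_⟩
  · rw [ENNReal.ofReal_toReal hDt]
    calc C = (C ^ (1 / p)) ^ p := by
          rw [← ENNReal.rpow_mul, one_div_mul_cancel hp.ne', ENNReal.rpow_one]
      _ ≤ D ^ p := ENNReal.rpow_le_rpow ((le_max_left _ _).trans (le_max_left _ _)) hp.le
  · rw [ENNReal.ofReal_toReal hDt]
    calc C = (C ^ (1 / q)) ^ q := by
          rw [← ENNReal.rpow_mul, one_div_mul_cancel hq.ne', ENNReal.rpow_one]
      _ ≤ D ^ q := ENNReal.rpow_le_rpow ((le_max_right _ _).trans (le_max_left _ _)) hq.le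

/-! ### Interpolation from left and right monotonicity -/

theorem lintegral_rearrFn_smul_rpow {𝕜 : Type*} [RCLike 𝕜] {α : ℝ≥0∞} (f : Fn 𝕜 α) {r : ℝ}
    (hr : 0 < r) {p : ℝ} (hp : 0 < p) (S : Set ℝ) :
    ∫⁻ s in S, rearrFn ((r : 𝕜) • f) s ^ p = ENNReal.ofReal r ^ p * ∫⁻ s in S, rearrFn f s ^ p := by
  rw [← lintegral_const_mul _ ((measurable_rearrFn f).pow_const p)]
  refine lintegral_congr fun s => ?_
  rw [rearrFn_smul f hr, ENNReal.mul_rpow_of_nonneg _ _ hp.le]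

namespace SymmetricSpace

variable {𝕜 : Type*} [RCLike 𝕜] {α : ℝ≥0∞} {E : SymmetricSpace 𝕜 α}

theorem qnorm_smul_ofReal {f : Fn 𝕜 α} (hf : f ∈ E.carrier) {r : ℝ} (hr : 0 ≤ r) :
    E.qnorm ((r : 𝕜) • f) = r * E.qnorm f := by
  rw [E.qnorm_smul _ f hf, RCLike.norm_ofReal, abs_of_nonneg hr]

/-- If at each `t` the head or the tail of `k^*` is dominated by that of `f^*`, then `k^*` is the
sum of two pieces to which left and right monotonicity apply. -/
theorem exists_domBy_of_head_or_tail {p q : ℝ} (hp : 0 < p) (hq : 0 < q) (hL : E.LeftMonotone p)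
    (hR : E.RightMonotone q) : ∃ C : ℝ, 0 < C ∧ ∀ f ∈ E.carrier, ∀ k : ℝ → ℝ≥0∞, Measurable k →
      (∀ᵐ x ∂(ivolume α), k x < ⊤) → FiniteDistr α k →
      (∀ t, 0 < t → ∫⁻ s in Ioc 0 t, rearr α k s ^ p ≤ ∫⁻ s in Ioc 0 t, rearrFn f s ^ p ∨
        ∫⁻ s in Ioi t, rearr α k s ^ q ≤ ∫⁻ s in Ioi t, rearrFn f s ^ q) →
      E.DomBy k (C * E.qnorm f) := by
  obtain ⟨C₁, hC₁, H₁⟩ := hL.exists_domBy hp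
  obtain ⟨C₂, hC₂, H₂⟩ := hR.exists_domBy hq
  obtain ⟨K, hK1, hK⟩ := E.exists_quasi_const
  -- `r ^ p ≥ 2` absorbs the factor of `head_rearr_indicator_le`
  obtain ⟨r, hr, hrp, -⟩ := exists_const_rpow_ge (C := 2) (by simp) hp hp
  refine ⟨K * (C₁ * r + C₂), by positivity, fun f hf k hk hkfin hk0 hmaj => ?_⟩
  set G := rearr α k with hG
  have hGanti : Antitone G := rearr_antitone α k
  set A : Set ℝ := {t : ℝ | ∫⁻ s in Ioc 0 t, G s ^ p ≤ ∫⁻ s in Ioc 0 t, rearrFn f s ^ p} with hA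
  have hAm : MeasurableSet A := measurableSet_head_le _ _
  have hGfin : ∀ᵐ x ∂(ivolume α), G x < ⊤ :=
    ae_ivolume_of_forall_pos fun t ht => rearr_lt_top hk hkfin hk0 ht
  have hG0 : FiniteDistr α G := by
    obtain ⟨s, hs, hlt⟩ := hk0
    exact ⟨s, hs, by rwa [hG, ivolume_lt_rearr]⟩
  have hind : ∀ (B : Set ℝ) (x : ℝ), B.indicator G x ≤ G x := fun B x =>
    indicator_le_self' (fun _ _ => zero_le) x
  have hpow : ∀ (B : Set ℝ) (r : ℝ), 0 < r → (fun x => B.indicator G x ^ r) =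
      B.indicator fun x => G x ^ r := by
    intro B r hr
    ext x
    by_cases h : x ∈ B
    · rw [indicator_of_mem h, indicator_of_mem h]
    · rw [indicator_of_notMem h, indicator_of_notMem h, ENNReal.zero_rpow_of_pos hr]
  have D₁ := H₁ _ (E.carrier.smul_mem (r : 𝕜) hf) (A.indicator G) (hGanti.measurable.indicator hAm)
    (hGfin.mono fun x hx => (hind A x).trans_lt hx)
    (hG0.mono_ae (Eventually.of_forall (hind A))) fun t ht => by
      rw [lintegral_rearrFn_smul_rpow f hr hp]
      simp_rw [← rearr_rpow α _ hp, hpow A p hp]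
      exact (head_rearr_indicator_le ((rearrFn_antitone f).rpow hp.le) (hGanti.rpow hp.le) ht).trans
        (by gcongr)
  have D₂ := H₂ f hf (Aᶜ.indicator G) (hGanti.measurable.indicator hAm.compl)
    (hGfin.mono fun x hx => (hind _ x).trans_lt hx)
    (hG0.mono_ae (Eventually.of_forall (hind _))) fun t ht => by
      simp_rw [← rearr_rpow α _ hq, hpow Aᶜ q hq]
      refine tail_rearr_indicator_le hAm.compl (hGanti.measurable.pow_const q) ?_ ht
      intro a ha ha0
      exact (hmaj a ha0).resolve_left ha
  refine DomBy.of_rearr hk ?_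
  rw [qnorm_smul_ofReal hf hr.le] at D₁
  refine (D₁.add hK hK1 D₂).mono (Eventually.of_forall fun x => ?_) (by ring_nf; rfl)
  rw [indicator_self_add_compl_apply]

theorem inf_le_carrier {p q : ℝ} (hp : 0 < p) (hq : 0 < q) (hL : E.LeftMonotone p)
    (hR : E.RightMonotone q) :
    Lp.LpSubmodule 𝕜 𝕜 (ENNReal.ofReal p) (ivolume α) ⊓
      Lp.LpSubmodule 𝕜 𝕜 (ENNReal.ofReal q) (ivolume α) ≤ E.carrier := by
  rintro h ⟨h₁, h₂⟩
  have h₁ := (mem_LpSubmodule_iff hp).1 h₁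
  have h₂ := (mem_LpSubmodule_iff hq).1 h₂
  have hm := measurable_enorm_fn h
  obtain ⟨C, hC, H⟩ := exists_domBy_of_head_or_tail hp hq hL hR
  obtain ⟨f, hf, hf0⟩ := E.exists_ne_zero
  obtain ⟨s, hs0, hst, hms⟩ := exists_distr_pos hf0
  obtain ⟨v, hv0, hv⟩ := ENNReal.lt_iff_exists_real_btwn.1 hms
  obtain ⟨hv1, hv2⟩ := hv
  have hv1 : 0 < v := ENNReal.ofReal_pos.1 hv1
  have hfs : ∀ u, u ≤ v → s ≤ rearrFn f u := fun u hu =>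
    (lt_rearr_iff.2 ((ENNReal.ofReal_le_ofReal hu).trans_lt hv2)).le
  have hw : ENNReal.ofReal (v / 2) ≠ 0 := (ENNReal.ofReal_pos.2 (half_pos hv1)).ne'
  -- a multiple `r` of `f` which is large on `(0, v]` compared with the norms of `h`
  have hex : ∃ r : ℝ, 0 < r ∧
      ∫⁻ x, ‖h x‖ₑ ^ p ∂(ivolume α) ≤
        ENNReal.ofReal r ^ p * (s ^ p * ENNReal.ofReal (v / 2)) ∧
      ∫⁻ x, ‖h x‖ₑ ^ q ∂(ivolume α) ≤
        ENNReal.ofReal r ^ q * (s ^ q * ENNReal.ofReal (v / 2)) := by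
    have e1 : s ^ p * ENNReal.ofReal (v / 2) ≠ 0 :=
      mul_ne_zero (ENNReal.rpow_pos hs0 hst).ne' hw
    have e2 : s ^ q * ENNReal.ofReal (v / 2) ≠ 0 :=
      mul_ne_zero (ENNReal.rpow_pos hs0 hst).ne' hw
    have e3 : s ^ p * ENNReal.ofReal (v / 2) ≠ ⊤ :=
      ENNReal.mul_ne_top (ENNReal.rpow_ne_top_of_nonneg hp.le hst) ENNReal.ofReal_ne_top
    have e4 : s ^ q * ENNReal.ofReal (v / 2) ≠ ⊤ :=
      ENNReal.mul_ne_top (ENNReal.rpow_ne_top_of_nonneg hq.le hst) ENNReal.ofReal_ne_top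
    obtain ⟨r, hr, hrp, hrq⟩ := exists_const_rpow_ge
      (C := max ((∫⁻ x, ‖h x‖ₑ ^ p ∂(ivolume α)) / (s ^ p * ENNReal.ofReal (v / 2)))
        ((∫⁻ x, ‖h x‖ₑ ^ q ∂(ivolume α)) / (s ^ q * ENNReal.ofReal (v / 2))))
      (max_lt (ENNReal.div_lt_top h₁ e1) (ENNReal.div_lt_top h₂ e2)).ne hp hq
    refine ⟨r, hr, ?_, ?_⟩
    · exact (ENNReal.div_le_iff e1 e3).1 ((le_max_left _ _).trans hrp)
    · exact (ENNReal.div_le_iff e2 e4).1 ((le_max_right _ _).trans hrq)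
  obtain ⟨r, hr, hrp, hrq⟩ := hex
  refine (domBy_enorm_iff.1 (H _ (E.carrier.smul_mem (r : 𝕜) hf) _ hm
    (Eventually.of_forall fun _ => enorm_lt_top) ?_ ?_)).1
  · exact (memLZero_iff_finiteDistr h).1 (memLZero_of_mem_LpSum hp hq
      (Submodule.mem_sup_left ((mem_LpSubmodule_iff hp).2 h₁)))
  · intro t ht
    have hhalf : v - v / 2 = v / 2 := by ring
    rcases le_or_gt (v / 2) t with hvt | hvt
    · left
      rw [lintegral_rearrFn_smul_rpow f hr hp]
      calc _ ≤ ∫⁻ s in Ioi 0, rearr α (fun x => ‖h x‖ₑ) s ^ p :=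
            lintegral_mono_set Ioc_subset_Ioi_self
        _ = ∫⁻ x, ‖h x‖ₑ ^ p ∂(ivolume α) := lintegral_rearr_rpow α hm hp
        _ ≤ _ := hrp
        _ ≤ _ := by
          gcongr
          calc _ ≤ rearrFn f (v / 2) ^ p * ENNReal.ofReal (v / 2 - 0) := by
                rw [sub_zero]
                gcongr
                exact hfs _ (by linarith)
            _ ≤ ∫⁻ s in Ioc 0 (v / 2), rearrFn f s ^ p :=
                ((rearrFn_antitone f).rpow hp.le).le_setLIntegral_Ioc 0 (v / 2)
            _ ≤ _ := lintegral_mono_set (Ioc_subset_Ioc_right hvt)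
    · right
      rw [lintegral_rearrFn_smul_rpow f hr hq]
      calc _ ≤ ∫⁻ s in Ioi 0, rearr α (fun x => ‖h x‖ₑ) s ^ q :=
            lintegral_mono_set (Ioi_subset_Ioi ht.le)
        _ = ∫⁻ x, ‖h x‖ₑ ^ q ∂(ivolume α) := lintegral_rearr_rpow α hm hq
        _ ≤ _ := hrq
        _ ≤ _ := by
          gcongr
          calc _ ≤ rearrFn f v ^ q * ENNReal.ofReal (v - v / 2) := by
                rw [hhalf]
                gcongr
                exact hfs _ le_rfl
            _ ≤ ∫⁻ s in Ioc (v / 2) v, rearrFn f s ^ q :=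
                ((rearrFn_antitone f).rpow hq.le).le_setLIntegral_Ioc (v / 2) v
            _ ≤ _ := lintegral_mono_set fun x hx => hvt.trans hx.1

theorem carrier_le_LpSum {p q : ℝ} (hp : 0 < p) (hq : 0 < q) (hL : E.LeftMonotone p)
    (hR : E.RightMonotone q) :
    E.carrier ≤ LpSum 𝕜 α (ENNReal.ofReal p) (ENNReal.ofReal q) := by
  intro f hf
  obtain ⟨S, hS, h₁, h₂⟩ := exists_split f hp hq one_pos (hR.setLIntegral_ne_top hq hf one_pos)
  rw [← cutFn_add_cutFn_compl f hS]
  refine Submodule.add_mem_sup ((mem_LpSubmodule_iff hp).2 ?_) ((mem_LpSubmodule_iff hq).2 ?_)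
  · rw [lintegral_cutFn f hS hp]
    exact ne_top_of_le_ne_top (hL.setLIntegral_ne_top hp hf 1) h₁
  · rw [lintegral_cutFn f hS.compl hq]
    exact ne_top_of_le_ne_top (hR.setLIntegral_ne_top hq hf one_pos) h₂

/-- Left and right monotonicity imply interpolation: at each scale `t`, an operator contracting
`L_p` and `L_q` maps the head and the tail of `f` to functions controlled in `L_p` and in `L_q`, so
that the head or the tail of `(T f)^*` at `t` is dominated by that of a multiple of `f^*`. -/
theorem isInterpolation_of_monotone {p q : ℝ} (hp : 0 < p) (hpq : p < q) (hL : E.LeftMonotone p)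
    (hR : E.RightMonotone q) : E.IsInterpolation (ENNReal.ofReal p) (ENNReal.ofReal q) := by
  have hq : 0 < q := hp.trans hpq
  refine ⟨inf_le_carrier hp hq hL hR, carrier_le_LpSum hp hq hL hR, ?_⟩
  obtain ⟨C, hC, H⟩ := exists_domBy_of_head_or_tail hp hq hL hR
  obtain ⟨D, hD, hbound⟩ := exists_head_tail_bound hp hpq
  obtain ⟨r, hr, hrp, hrq⟩ := exists_const_rpow_ge hD hp hq
  refine ⟨C * r, by positivity, fun T hTp hTq f hf => ?_⟩
  rw [mul_assoc, ← qnorm_smul_ofReal hf hr.le]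
  refine domBy_enorm_iff.1 (H _ (E.carrier.smul_mem (r : 𝕜) hf) _ (measurable_enorm_fn _)
    (Eventually.of_forall fun _ => enorm_lt_top)
    ((memLZero_iff_finiteDistr _).1 (memLZero_of_mem_LpSum hp hq (T f).2)) fun t ht => ?_)
  obtain ⟨S, hS, h₁, h₂⟩ := exists_split (f : Fn 𝕜 α) hp hq ht (hR.setLIntegral_ne_top hq hf ht)
  have hfin₁ := hL.setLIntegral_ne_top hp hf t
  have hfin₂ := hR.setLIntegral_ne_top hq hf ht
  set a := ∫⁻ s in Ioc 0 t, rearrFn (f : Fn 𝕜 α) s ^ p with ha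
  set b := ∫⁻ s in Ioi t, rearrFn (f : Fn 𝕜 α) s ^ q with hb
  have hm₁ : cutFn (f : Fn 𝕜 α) hS ∈ Lp.LpSubmodule 𝕜 𝕜 (ENNReal.ofReal p) (ivolume α) := by
    rw [mem_LpSubmodule_iff hp, lintegral_cutFn _ hS hp]
    exact ne_top_of_le_ne_top hfin₁ h₁
  have hm₂ : cutFn (f : Fn 𝕜 α) hS.compl ∈ Lp.LpSubmodule 𝕜 𝕜 (ENNReal.ofReal q) (ivolume α) := by
    rw [mem_LpSubmodule_iff hq, lintegral_cutFn _ hS.compl hq]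
    exact ne_top_of_le_ne_top hfin₂ h₂
  set f₁ : ↥(LpSum 𝕜 α (ENNReal.ofReal p) (ENNReal.ofReal q)) :=
    ⟨cutFn (f : Fn 𝕜 α) hS, Submodule.mem_sup_left hm₁⟩ with hf₁
  set f₂ : ↥(LpSum 𝕜 α (ENNReal.ofReal p) (ENNReal.ofReal q)) :=
    ⟨cutFn (f : Fn 𝕜 α) hS.compl, Submodule.mem_sup_right hm₂⟩ with hf₂
  have hff : f = f₁ + f₂ := Subtype.ext (cutFn_add_cutFn_compl (f : Fn 𝕜 α) hS).symm
  have hT : (T f : Fn 𝕜 α) = (T f₁ : Fn 𝕜 α) + (T f₂ : Fn 𝕜 α) := by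
    rw [hff, map_add]
    rfl
  have hT₁ : ∫⁻ x, ‖(T f₁ : Fn 𝕜 α) x‖ₑ ^ p ∂(ivolume α) ≤ a :=
    ((eLpNorm_ofReal_le_iff hp).1 (hTp f₁ hm₁)).trans ((lintegral_cutFn _ hS hp).trans_le h₁)
  have hT₂ : ∫⁻ x, ‖(T f₂ : Fn 𝕜 α) x‖ₑ ^ q ∂(ivolume α) ≤ b :=
    ((eLpNorm_ofReal_le_iff hq).1 (hTq f₂ hm₂)).trans ((lintegral_cutFn _ hS.compl hq).trans_le h₂)
  have hle : ∀ᵐ x ∂(ivolume α), ‖(T f : Fn 𝕜 α) x‖ₑ ≤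
      ‖(T f₁ : Fn 𝕜 α) x‖ₑ + ‖(T f₂ : Fn 𝕜 α) x‖ₑ := by
    rw [hT]
    filter_upwards [AEEqFun.coeFn_add (T f₁ : Fn 𝕜 α) (T f₂ : Fn 𝕜 α)] with x hx
    rw [hx]
    exact enorm_add_le _ _
  have ht0 : ENNReal.ofReal t ≠ 0 := (ENNReal.ofReal_pos.2 ht).ne'
  -- the larger of the two normalized means decides whether the head or the tail is dominated
  set l : ℝ≥0∞ := max ((a / ENNReal.ofReal t) ^ (1 / p)) ((b / ENNReal.ofReal t) ^ (1 / q)) with hl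
  have hlt : l ≠ ⊤ := (max_lt
    (ENNReal.rpow_lt_top_of_nonneg (by positivity) (ENNReal.div_lt_top hfin₁ ht0).ne)
    (ENNReal.rpow_lt_top_of_nonneg (by positivity) (ENNReal.div_lt_top hfin₂ ht0).ne)).ne
  have hroot : ∀ (c : ℝ≥0∞) (u : ℝ), 0 < u →
      ENNReal.ofReal t * ((c / ENNReal.ofReal t) ^ (1 / u)) ^ u = c := by
    intro c u hu
    rw [← ENNReal.rpow_mul, one_div_mul_cancel hu.ne', ENNReal.rpow_one,
      ENNReal.mul_div_cancel ht0 ENNReal.ofReal_ne_top]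
  have hal : a ≤ ENNReal.ofReal t * l ^ p := by
    rw [← hroot a p hp]
    gcongr
    exact le_max_left _ _
  have hbl : b ≤ ENNReal.ofReal t * l ^ q := by
    rw [← hroot b q hq]
    gcongr
    exact le_max_right _ _
  obtain ⟨B₁, B₂⟩ := hbound α _ _ _ (measurable_enorm_fn (T f₁ : Fn 𝕜 α))
    (measurable_enorm_fn (T f₂ : Fn 𝕜 α)) hle t l ht hlt (hT₁.trans hal) (hT₂.trans hbl)
  rw [lintegral_rearrFn_smul_rpow _ hr hp, lintegral_rearrFn_smul_rpow _ hr hq]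
  rcases le_total ((b / ENNReal.ofReal t) ^ (1 / q)) ((a / ENNReal.ofReal t) ^ (1 / p)) with h | h
  · left
    refine B₁.trans ?_
    rw [hl, max_eq_left h, hroot a p hp]
    gcongr
  · right
    refine B₂.trans ?_
    rw [hl, max_eq_right h, hroot b q hq]
    gcongr

end SymmetricSpace

/-! ### Dilations and the Boyd indices -/

theorem volume_preimage_div (S : Set ℝ) {t : ℝ} (ht : 0 < t) :
    volume ((fun x : ℝ => x / t) ⁻¹' S) = ENNReal.ofReal t * volume S := by
  have := Real.volume_preimage_mul_right (inv_ne_zero ht.ne') S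
  rwa [inv_inv, abs_of_pos ht] at this

theorem mem_interval_of_le {α : ℝ≥0∞} {x y : ℝ} (hy0 : 0 < y) (hyx : y ≤ x)
    (hx : ENNReal.ofReal x < α) : y ∈ {x : ℝ | 0 < x ∧ ENNReal.ofReal x < α} :=
  ⟨hy0, (ENNReal.ofReal_le_ofReal hyx).trans_lt hx⟩

namespace SymmetricSpace

variable {𝕜 : Type*} [RCLike 𝕜] {α : ℝ≥0∞} {E : SymmetricSpace 𝕜 α}

theorem coeFn_dilation (f : Fn 𝕜 α) (t : ℝ) : ∀ᵐ x ∂(ivolume α), dilation t f x =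
    {x : ℝ | 0 < x ∧ ENNReal.ofReal x < α}.indicator f (x / t) := AEEqFun.coeFn_mk _ _

theorem distr_dilation_le (f : Fn 𝕜 α) {t : ℝ} (ht : 0 < t) (s : ℝ≥0∞) :
    ivolume α {x | s < ‖dilation t f x‖ₑ} ≤ ENNReal.ofReal t * ivolume α {x | s < ‖f x‖ₑ} := by
  calc ivolume α {x | s < ‖dilation t f x‖ₑ}
      ≤ ivolume α ((fun x : ℝ => x / t) ⁻¹'
          ({x | s < ‖f x‖ₑ} ∩ {x : ℝ | 0 < x ∧ ENNReal.ofReal x < α})) := by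
        refine measure_mono_ae ?_
        filter_upwards [coeFn_dilation f t] with x hx hs
        have hs : s < ‖dilation t f x‖ₑ := hs
        rw [hx] at hs
        by_cases h : x / t ∈ {x : ℝ | 0 < x ∧ ENNReal.ofReal x < α}
        · rw [indicator_of_mem h] at hs
          exact ⟨hs, h⟩
        · rw [indicator_of_notMem h, enorm_zero] at hs
          exact absurd hs not_lt_zero
    _ ≤ volume _ := ivolume_le_volume α _
    _ = _ := by
        rw [volume_preimage_div _ ht]
        exact congrArg _ (Measure.restrict_apply
          (measurableSet_lt measurable_const (measurable_enorm_fn f))).symm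

theorem exists_dilation_bound (E : SymmetricSpace 𝕜 α) {t : ℝ} (ht : 0 < t) :
    ∃ C : ℝ, 0 ≤ C ∧ ∀ f ∈ E.carrier,
      dilation t f ∈ E.carrier ∧ E.qnorm (dilation t f) ≤ C * E.qnorm f := by
  obtain ⟨n, hn⟩ := exists_nat_gt t
  obtain ⟨C, hC, H⟩ := E.exists_domBy_of_distr_le_mul (n + 1)
  refine ⟨C, hC.le, fun f hf => domBy_enorm_iff.1 (H _ _ _ (measurable_enorm_fn _) (fun s => ?_)
    (domBy_of_mem hf))⟩
  refine (distr_dilation_le f ht s).trans ?_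
  gcongr
  rw [← ENNReal.ofReal_natCast]
  refine ENNReal.ofReal_le_ofReal ?_
  push_cast
  linarith

theorem dilationNorm_nonneg (E : SymmetricSpace 𝕜 α) (t : ℝ) : 0 ≤ E.dilationNorm t :=
  Real.sInf_nonneg fun _ hC => hC.1

/-- The infimum defining the operator norm of a dilation is attained. -/
theorem dilation_mem {t : ℝ} (ht : 0 < t) {f : Fn 𝕜 α} (hf : f ∈ E.carrier) :
    dilation t f ∈ E.carrier ∧ E.qnorm (dilation t f) ≤ E.dilationNorm t * E.qnorm f := by
  obtain ⟨C, hC, H⟩ := E.exists_dilation_bound ht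
  refine ⟨(H f hf).1, ?_⟩
  have hne : {C : ℝ | 0 ≤ C ∧ ∀ f ∈ E.carrier,
      E.qnorm (dilation t f) ≤ C * E.qnorm f}.Nonempty := ⟨C, hC, fun f hf => (H f hf).2⟩
  rcases (E.qnorm_nonneg f hf).eq_or_lt with h0 | h0
  · have := (H f hf).2
    rw [← h0, mul_zero] at this ⊢
    exact this
  · rw [← div_le_iff₀ h0]
    refine le_csInf hne fun D hD => ?_
    rw [div_le_iff₀ h0]
    exact hD.2 f hf

theorem DomBy.dilation {t : ℝ} (ht : 0 < t) {h : ℝ → ℝ≥0∞} {c N : ℝ} (H : E.DomBy h c)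
    (hN : E.dilationNorm t ≤ N) : E.DomBy (fun x =>
      {x : ℝ | 0 < x ∧ ENNReal.ofReal x < α}.indicator h (x / t)) (N * c) := by
  have hc := H.nonneg
  obtain ⟨f, hf, hfc, hle⟩ := H
  obtain ⟨h1, h2⟩ := dilation_mem ht hf
  refine ⟨_, h1, h2.trans ?_, ?_⟩
  · exact mul_le_mul hN hfc (E.qnorm_nonneg f hf) ((E.dilationNorm_nonneg t).trans hN)
  · have hle' : ∀ᵐ x ∂(ivolume α), x / t ∈ {x : ℝ | 0 < x ∧ ENNReal.ofReal x < α} →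
        h (x / t) ≤ ‖f (x / t)‖ₑ := by
      have hle := (ae_restrict_iff' (measurableSet_interval α)).1 hle
      rw [ae_iff] at hle
      have h3 := volume_preimage_div {a | ¬ (a ∈ {x : ℝ | 0 < x ∧ ENNReal.ofReal x < α} →
        h a ≤ ‖f a‖ₑ)} ht
      rw [hle, mul_zero] at h3
      exact ae_mono (ivolume_le_volume α) (ae_iff.2 h3)
    filter_upwards [hle', coeFn_dilation f t] with x h3 h4
    rw [h4]
    by_cases hx : x / t ∈ {x : ℝ | 0 < x ∧ ENNReal.ofReal x < α}
    · rw [indicator_of_mem hx, indicator_of_mem hx]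
      exact h3 hx
    · rw [indicator_of_notMem hx]
      exact zero_le

theorem DomBy.dilation_pow {t : ℝ} (ht : 0 < t) {h : ℝ → ℝ≥0∞} {c N : ℝ} (H : E.DomBy h c)
    (hN : E.dilationNorm t ≤ N) (m : ℕ) : E.DomBy (fun x =>
      {x : ℝ | 0 < x ∧ ENNReal.ofReal x < α}.indicator h (x / t ^ m)) (N ^ m * c) := by
  induction m with
  | zero =>
    refine H.mono ?_ (by simp)
    filter_upwards [ae_ivolume_mem α] with x hx
    rw [pow_zero, div_one]
    exact indicator_le_self' (fun _ _ => zero_le) x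
  | succ m ih =>
    refine (ih.dilation ht hN).mono ?_ (by rw [pow_succ']; exact le_of_eq (by ring))
    filter_upwards [ae_ivolume_mem α] with x hx
    by_cases h1 : x / t ^ (m + 1) ∈ {x : ℝ | 0 < x ∧ ENNReal.ofReal x < α}
    · have h2 : x / t ∈ {x : ℝ | 0 < x ∧ ENNReal.ofReal x < α} := by
        have h0 : 0 < x / t := div_pos hx.1 ht
        rcases le_total t 1 with h | h
        · refine mem_interval_of_le h0 ?_ h1.2
          rw [pow_succ', ← div_div]
          refine (le_div_iff₀ (by positivity)).2 ?_
          exact mul_le_of_le_one_right h0.le (pow_le_one₀ ht.le h)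
        · exact mem_interval_of_le h0 (div_le_self hx.1.le h) hx.2
      rw [indicator_of_mem h2, div_div, ← pow_succ']
    · rw [indicator_of_notMem h1]
      exact zero_le

/-- If the dilation by `t` is bounded by less than `t ^ (1 / p)`, then a power `a = t ^ m` makes the
series `(∑ a⁻ᵏ f^*(· / aᵏ)ᵖ) ^ (1 / p)` converge in `E`. -/
theorem exists_domBy_dilation_series (E : SymmetricSpace 𝕜 α) {t p : ℝ} (ht : 0 < t) (hp : 0 < p)
    (hN : E.dilationNorm t < t ^ (1 / p)) : ∃ m : ℕ, m ≠ 0 ∧ ∃ C : ℝ, 0 < C ∧ ∀ f ∈ E.carrier,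
      E.DomBy (fun x => (∑' k : ℕ, ENNReal.ofReal (((t ^ m) ^ k)⁻¹) *
        rearrFn f (x / (t ^ m) ^ k) ^ p) ^ (1 / p)) (C * E.qnorm f) := by
  obtain ⟨K, hK1, hK⟩ := E.exists_quasi_const
  set N := E.dilationNorm t with hNdef
  have hN0 : 0 ≤ N := E.dilationNorm_nonneg t
  have hp' : 0 < 1 / p := by positivity
  set ρ : ℝ := N / t ^ (1 / p) with hρ
  have htp : 0 < t ^ (1 / p) := Real.rpow_pos_of_pos ht _
  have hρ0 : 0 ≤ ρ := by positivity
  have hρ1 : ρ < 1 := (div_lt_one htp).2 hN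
  have hlim : Tendsto (fun m : ℕ => 2 * K * ((2 : ℝ) ^ (1 / p) * ρ ^ m)) atTop (𝓝 0) := by
    have := ((tendsto_pow_atTop_nhds_zero_of_lt_one hρ0 hρ1).const_mul
      ((2 : ℝ) ^ (1 / p))).const_mul (2 * K)
    simpa using this
  obtain ⟨m, hm1, hm⟩ :=
    ((hlim.eventually (gt_mem_nhds one_pos)).and (eventually_ne_atTop 0)).exists
  set a := t ^ m with ha
  have ha0 : 0 < a := pow_pos ht m
  set r : ℝ := (2 : ℝ) ^ (1 / p) * ρ ^ m with hr
  have hr' : r = (2 / a) ^ (1 / p) * N ^ m := by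
    rw [hr, hρ, div_pow, Real.div_rpow zero_le_two ha0.le, ha, ← Real.rpow_natCast (t ^ (1 / p)),
      ← Real.rpow_mul ht.le, ← Real.rpow_natCast t, ← Real.rpow_mul ht.le, mul_comm (1 / p)]
    ring
  have h2p : (0 : ℝ) < 2 ^ (1 / p) := Real.rpow_pos_of_pos two_pos _
  refine ⟨m, hm, 2 ^ (1 / p) * (4 * K ^ 2), by positivity, fun f hf => ?_⟩
  set c : ℝ := (2 / a) ^ (1 / p) with hc
  have hc0 : 0 < c := Real.rpow_pos_of_pos (by positivity) _
  have hv : ∀ k : ℕ, E.DomBy (fun x => ENNReal.ofReal (c ^ k) * rearrFn f (x / a ^ k))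
      (E.qnorm f * r ^ k) := by
    intro k
    have h1 := ((domBy_rearr hf).dilation_pow ht le_rfl (m * k)).const_mul (r := c ^ k)
      (by positivity)
    refine h1.mono ?_ ?_
    · filter_upwards [ae_ivolume_mem α] with x hx
      gcongr
      rw [ha, ← pow_mul]
      by_cases h : x / t ^ (m * k) ∈ {x : ℝ | 0 < x ∧ ENNReal.ofReal x < α}
      · rw [indicator_of_mem h]
        rfl
      · rw [indicator_of_notMem h]
        refine le_of_eq (rearr_eq_zero _ (not_lt.1 fun hlt => h ⟨?_, hlt⟩))
        exact div_pos hx.1 (by positivity)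
    · rw [hr', mul_pow, pow_mul]
      exact le_of_eq (by ring)
  have hsup := domBy_iSup_of_geometric hK1 hK (by positivity) hm1.le hv
  have h3 := hsup.const_mul h2p.le
  refine h3.mono (Eventually.of_forall fun x => ?_) (le_of_eq (by ring))
  set M := ⨆ k : ℕ, ENNReal.ofReal (c ^ k) * rearrFn f (x / a ^ k) with hM
  have hterm : ∀ k : ℕ, ENNReal.ofReal ((a ^ k)⁻¹) * rearrFn f (x / a ^ k) ^ p ≤
      M ^ p * 2⁻¹ ^ k := by
    intro k
    have h4 : ENNReal.ofReal (c ^ k) * rearrFn f (x / a ^ k) ≤ M :=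
      le_iSup (fun k : ℕ => ENNReal.ofReal (c ^ k) * rearrFn f (x / a ^ k)) k
    have h5 := ENNReal.rpow_le_rpow h4 hp.le
    rw [ENNReal.mul_rpow_of_nonneg _ _ hp.le, ENNReal.ofReal_rpow_of_nonneg (by positivity) hp.le]
      at h5
    have h6 : (c ^ k) ^ p = 2 ^ k * (a ^ k)⁻¹ := by
      have hcp : c ^ p = 2 / a := by
        rw [hc, ← Real.rpow_mul (by positivity), one_div_mul_cancel hp.ne', Real.rpow_one]
      rw [← Real.rpow_natCast, ← Real.rpow_mul hc0.le, mul_comm, Real.rpow_mul hc0.le, hcp,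
        Real.rpow_natCast, div_pow, div_eq_mul_inv]
    rw [h6, ENNReal.ofReal_mul (by positivity)] at h5
    have h7 : ENNReal.ofReal ((2 : ℝ) ^ k) = 2 ^ k := by
      rw [ENNReal.ofReal_pow zero_le_two, ENNReal.ofReal_ofNat]
    rw [h7] at h5
    calc _ = 2⁻¹ ^ k * (2 ^ k * ENNReal.ofReal ((a ^ k)⁻¹) * rearrFn f (x / a ^ k) ^ p) := by
          rw [← mul_assoc, ← mul_assoc, ← mul_pow, ENNReal.inv_mul_cancel two_ne_zero
            ENNReal.ofNat_ne_top, one_pow, one_mul]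
      _ ≤ 2⁻¹ ^ k * M ^ p := by gcongr
      _ = _ := mul_comm _ _
  calc _ ≤ (∑' k : ℕ, M ^ p * 2⁻¹ ^ k) ^ (1 / p) :=
        ENNReal.rpow_le_rpow (ENNReal.tsum_le_tsum hterm) hp'.le
    _ = (2 * M ^ p) ^ (1 / p) := by
        rw [ENNReal.tsum_mul_left, ENNReal.tsum_geometric, ENNReal.one_sub_inv_two, inv_inv,
          mul_comm]
    _ = ENNReal.ofReal (2 ^ (1 / p)) * M := by
        rw [ENNReal.mul_rpow_of_nonneg _ _ hp'.le, ← ENNReal.rpow_mul, mul_one_div_cancel hp.ne',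
          ENNReal.rpow_one, ← ENNReal.ofReal_rpow_of_nonneg zero_le_two hp'.le,
          ENNReal.ofReal_ofNat]

theorem exists_dilationNorm_lt_of_lt_upperBoyd {p : ℝ} (hp : 0 < p)
    (h : ENNReal.ofReal p < 1 / E.upperBoyd) :
    ∃ t : ℝ, 1 < t ∧ E.dilationNorm t < t ^ (1 / p) := by
  rw [one_div, ENNReal.lt_inv_iff_lt_inv, ← ENNReal.ofReal_inv_of_pos hp, upperBoyd] at h
  simp only [iInf_lt_iff] at h
  obtain ⟨t, ht, h⟩ := h
  have ht : 1 < t := ht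
  have hlog : 0 < Real.log t := Real.log_pos ht
  refine ⟨t, ht, ?_⟩
  -- a vanishing norm has the junk logarithm `0`, but satisfies the bound trivially
  rcases (E.dilationNorm_nonneg t).eq_or_lt with h0 | h0
  · rw [← h0]
    positivity
  rw [ENNReal.ofReal_lt_ofReal_iff (by positivity), div_lt_iff₀ hlog] at h
  rw [← Real.log_lt_log_iff h0 (by positivity), Real.log_rpow (by linarith), one_div]
  exact h

theorem exists_dilationNorm_lt_of_lowerBoyd_lt {q : ℝ} (hq : 0 < q)
    (h : 1 / E.lowerBoyd < ENNReal.ofReal q) :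
    ∃ t : ℝ, 0 < t ∧ t < 1 ∧ E.dilationNorm t < t ^ (1 / q) := by
  rw [one_div, ENNReal.inv_lt_iff_inv_lt, ← ENNReal.ofReal_inv_of_pos hq, lowerBoyd] at h
  simp only [lt_iSup_iff] at h
  obtain ⟨t, ht, h⟩ := h
  have hlog : Real.log t < 0 := Real.log_neg ht.1 ht.2
  have ht0 := ht.1
  refine ⟨t, ht.1, ht.2, ?_⟩
  -- a vanishing norm has the junk logarithm `0`, but satisfies the bound trivially
  rcases (E.dilationNorm_nonneg t).eq_or_lt with h0 | h0
  · rw [← h0]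
    positivity
  have h := (ENNReal.ofReal_lt_ofReal_iff_of_nonneg (by positivity)).1 h
  rw [lt_div_iff_of_neg hlog] at h
  rw [← Real.log_lt_log_iff h0 (by positivity), Real.log_rpow ht0, one_div]
  exact h

/-- Cutting `(0, x]` at the points `x / a ^ k` bounds the head of `f^*` at `x` by `x` times a
dilation series, and the head of `g^*` at `x` is at least `x * g^*(x) ^ p`. -/
theorem leftMonotone_of_lt_upperBoyd {p : ℝ} (hp : 0 < p)
    (h : ENNReal.ofReal p < 1 / E.upperBoyd) : E.LeftMonotone p := by
  obtain ⟨t, ht, hN⟩ := exists_dilationNorm_lt_of_lt_upperBoyd hp h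
  have ht0 : 0 < t := by linarith
  obtain ⟨m, hm, C, hC, H⟩ := E.exists_domBy_dilation_series ht0 hp hN
  set a := t ^ m with ha
  have ha1 : 1 < a := one_lt_pow₀ ht hm
  have ha0 : 0 < a := by linarith
  refine leftMonotone_of_domBy hp (C := a ^ (1 / p) * C) (by positivity) fun f hf g _ hmaj => ?_
  refine ((H f hf).const_mul (r := a ^ (1 / p)) (by positivity)).mono ?_ (le_of_eq (by ring))
  filter_upwards [ae_ivolume_mem α] with x hx
  have hx0 : 0 < x := hx.1
  set S := ∑' k : ℕ, ENNReal.ofReal ((a ^ k)⁻¹) * rearrFn f (x / a ^ k) ^ p with hS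
  have hcover : Ioc 0 x ⊆ ⋃ k : ℕ, Ioc (x / a ^ (k + 1)) (x / a ^ k) := by
    intro y hy
    obtain ⟨k, hk1, hk2⟩ := exists_nat_pow_near (x := x / y) ((one_le_div hy.1).2 hy.2) ha1
    refine mem_iUnion.2 ⟨k, ?_, ?_⟩
    · rw [div_lt_iff₀ hy.1] at hk2
      rw [div_lt_iff₀ (by positivity), mul_comm]
      exact hk2
    · rw [le_div_iff₀ hy.1] at hk1
      rw [le_div_iff₀ (by positivity), mul_comm]
      exact hk1
  have hhead : ∫⁻ s in Ioc 0 x, rearrFn f s ^ p ≤ ENNReal.ofReal x * (ENNReal.ofReal a * S) := by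
    calc _ ≤ ∫⁻ s in ⋃ k : ℕ, Ioc (x / a ^ (k + 1)) (x / a ^ k), rearrFn f s ^ p :=
          lintegral_mono_set hcover
      _ ≤ ∑' k : ℕ, ∫⁻ s in Ioc (x / a ^ (k + 1)) (x / a ^ k), rearrFn f s ^ p :=
          lintegral_iUnion_le _ _
      _ ≤ ∑' k : ℕ, ENNReal.ofReal x * ENNReal.ofReal a *
            (ENNReal.ofReal ((a ^ (k + 1))⁻¹) * rearrFn f (x / a ^ (k + 1)) ^ p) := by
          refine ENNReal.tsum_le_tsum fun k => ?_
          refine (((rearrFn_antitone f).rpow hp.le).setLIntegral_Ioc_le _ _).trans ?_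
          rw [mul_comm, ← mul_assoc, ← ENNReal.ofReal_mul hx0.le, ← ENNReal.ofReal_mul
            (by positivity)]
          gcongr
          have h1 : x * a * (a ^ (k + 1))⁻¹ = x / a ^ k := by
            field_simp
            ring
          have h2 : 0 < x / a ^ (k + 1) := by positivity
          linarith
      _ = ENNReal.ofReal x * ENNReal.ofReal a * ∑' k : ℕ,
            ENNReal.ofReal ((a ^ (k + 1))⁻¹) * rearrFn f (x / a ^ (k + 1)) ^ p :=
          ENNReal.tsum_mul_left
      _ ≤ ENNReal.ofReal x * ENNReal.ofReal a * S := by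
          gcongr
          exact ENNReal.tsum_comp_le_tsum_of_injective (add_left_injective 1)
            (fun k : ℕ => ENNReal.ofReal ((a ^ k)⁻¹) * rearrFn f (x / a ^ k) ^ p)
      _ = _ := mul_assoc _ _ _
  have h1 : rearrFn g x ^ p ≤ ENNReal.ofReal a * S := by
    have h2 := ((rearrFn_antitone g).rpow hp.le).le_setLIntegral_Ioc 0 x
    rw [sub_zero, mul_comm] at h2
    exact (ENNReal.mul_le_mul_iff_right (ENNReal.ofReal_pos.2 hx0).ne' ENNReal.ofReal_ne_top).1
      (h2.trans ((hmaj x hx0).trans hhead))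
  calc rearrFn g x = (rearrFn g x ^ p) ^ (1 / p) := by
        rw [← ENNReal.rpow_mul, mul_one_div_cancel hp.ne', ENNReal.rpow_one]
    _ ≤ (ENNReal.ofReal a * S) ^ (1 / p) := ENNReal.rpow_le_rpow h1 (by positivity)
    _ = _ := by
        rw [ENNReal.mul_rpow_of_nonneg _ _ (by positivity),
          ENNReal.ofReal_rpow_of_nonneg ha0.le (by positivity)]

/-- Cutting `(x, ∞)` at the points `x / b ^ k` bounds the tail of `f^*` at `x` by `x` times a
dilation series. The tail of `g^*` at `x` only controls `g^*(2 x)`, which costs a factor `2` in the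
distribution function. -/
theorem rightMonotone_of_lowerBoyd_lt {q : ℝ} (hq : 0 < q)
    (h : 1 / E.lowerBoyd < ENNReal.ofReal q) : E.RightMonotone q := by
  obtain ⟨t, ht0, ht, hN⟩ := exists_dilationNorm_lt_of_lowerBoyd_lt hq h
  obtain ⟨m, hm, C, hC, H⟩ := E.exists_domBy_dilation_series ht0 hq hN
  obtain ⟨C', hC', H'⟩ := E.exists_domBy_of_distr_le_mul 2
  set b := t ^ m with hb
  have hb0 : 0 < b := by positivity
  have hb1 : b < 1 := pow_lt_one₀ ht0.le ht hm
  refine rightMonotone_of_domBy hq (C := C' * (b⁻¹ ^ (1 / q) * C)) (by positivity)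
    fun f hf g _ hmaj => ?_
  have key : E.DomBy (fun x => rearrFn g (2 * x)) (b⁻¹ ^ (1 / q) * C * E.qnorm f) := by
    refine ((H f hf).const_mul (r := b⁻¹ ^ (1 / q)) (by positivity)).mono ?_ (le_of_eq (by ring))
    filter_upwards [ae_ivolume_mem α] with x hx
    have hx0 : 0 < x := hx.1
    set S := ∑' k : ℕ, ENNReal.ofReal ((b ^ k)⁻¹) * rearrFn f (x / b ^ k) ^ q with hS
    have hcover : Ioi x ⊆ ⋃ k : ℕ, Ico (x / b ^ k) (x / b ^ (k + 1)) := by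
      intro y hy
      have hy : x < y := hy
      have hb' : 1 < b⁻¹ := (one_lt_inv₀ hb0).2 hb1
      obtain ⟨k, hk1, hk2⟩ := exists_nat_pow_near (x := y / x) ((one_le_div hx0).2 hy.le) hb'
      rw [le_div_iff₀ hx0, inv_pow] at hk1
      rw [div_lt_iff₀ hx0, inv_pow] at hk2
      refine mem_iUnion.2 ⟨k, ?_, ?_⟩
      · rw [div_eq_inv_mul]; exact hk1
      · rw [div_eq_inv_mul]; exact hk2
    have htail : ∫⁻ s in Ioi x, rearrFn f s ^ q ≤
        ENNReal.ofReal x * (ENNReal.ofReal b⁻¹ * S) := by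
      calc _ ≤ ∫⁻ s in ⋃ k : ℕ, Ico (x / b ^ k) (x / b ^ (k + 1)), rearrFn f s ^ q :=
            lintegral_mono_set hcover
        _ ≤ ∑' k : ℕ, ∫⁻ s in Ico (x / b ^ k) (x / b ^ (k + 1)), rearrFn f s ^ q :=
            lintegral_iUnion_le _ _
        _ ≤ ∑' k : ℕ, ENNReal.ofReal x * ENNReal.ofReal b⁻¹ *
              (ENNReal.ofReal ((b ^ k)⁻¹) * rearrFn f (x / b ^ k) ^ q) := by
            refine ENNReal.tsum_le_tsum fun k => ?_
            rw [setLIntegral_congr Ico_ae_eq_Ioc]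
            refine (((rearrFn_antitone f).rpow hq.le).setLIntegral_Ioc_le _ _).trans ?_
            rw [mul_comm, ← mul_assoc, ← ENNReal.ofReal_mul hx0.le, ← ENNReal.ofReal_mul
              (by positivity)]
            gcongr
            have h1 : x * b⁻¹ * (b ^ k)⁻¹ = x / b ^ (k + 1) := by
              field_simp
              ring
            have h2 : 0 < x / b ^ k := by positivity
            linarith
        _ = ENNReal.ofReal x * ENNReal.ofReal b⁻¹ * S := ENNReal.tsum_mul_left
        _ = _ := mul_assoc _ _ _
    have h1 : rearrFn g (2 * x) ^ q ≤ ENNReal.ofReal b⁻¹ * S := by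
      have h2 := ((rearrFn_antitone g).rpow hq.le).le_setLIntegral_Ioc x (2 * x)
      rw [show 2 * x - x = x by ring, mul_comm] at h2
      exact (ENNReal.mul_le_mul_iff_right (ENNReal.ofReal_pos.2 hx0).ne' ENNReal.ofReal_ne_top).1
        (h2.trans ((lintegral_mono_set Ioc_subset_Ioi_self).trans ((hmaj x hx0).trans htail)))
    calc rearrFn g (2 * x) = (rearrFn g (2 * x) ^ q) ^ (1 / q) := by
          rw [← ENNReal.rpow_mul, mul_one_div_cancel hq.ne', ENNReal.rpow_one]
      _ ≤ (ENNReal.ofReal b⁻¹ * S) ^ (1 / q) := ENNReal.rpow_le_rpow h1 (by positivity)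
      _ = _ := by
          rw [ENNReal.mul_rpow_of_nonneg _ _ (by positivity),
            ENNReal.ofReal_rpow_of_nonneg (by positivity) (by positivity)]
  refine (H' _ _ _ (measurable_rearrFn g) (fun s => ?_) key).mono
    (Eventually.of_forall fun _ => le_rfl) (le_of_eq (by ring))
  have e1 : {x | s < rearrFn g x} = {x | ENNReal.ofReal x < ivolume α {x | s < ‖g x‖ₑ}} := by
    ext x; exact lt_rearr_iff
  have e2 : {x | s < rearrFn g (2 * x)} =
      {x | ENNReal.ofReal x < ivolume α {x | s < ‖g x‖ₑ} / 2} := by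
    ext x
    refine lt_rearr_iff.trans ?_
    change _ ↔ ENNReal.ofReal x < _
    rw [ENNReal.lt_div_iff_mul_lt (Or.inl two_ne_zero) (Or.inl ENNReal.ofNat_ne_top),
      ENNReal.ofReal_mul zero_le_two, ENNReal.ofReal_ofNat, mul_comm]
  rw [e1, e2, ivolume_ofReal_lt, ivolume_ofReal_lt]
  have hd : ivolume α {x | s < ‖g x‖ₑ} ≤ α :=
    (measure_mono (subset_univ _)).trans_eq (ivolume_univ α)
  rw [min_eq_left hd, min_eq_left (ENNReal.half_le_self.trans hd), Nat.cast_ofNat,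
    ENNReal.mul_div_cancel two_ne_zero ENNReal.ofNat_ne_top]

end SymmetricSpace

/-! ### Transport of a left-majorized function -/

theorem restrict_Ioi_withDensity_Iic (F : ℝ → ℝ≥0∞) (x : ℝ) :
    ((volume.restrict (Ioi (0 : ℝ))).withDensity F) (Iic x) = ∫⁻ s in Ioc 0 x, F s := by
  rw [withDensity_apply _ measurableSet_Iic, Measure.restrict_restrict measurableSet_Iic,
    inter_comm, Ioi_inter_Iic]

/-- If the heads of `G` are dominated by those of `F`, then `G = 2 w (F ∘ φ)` with a weight `w ≤ 1`
and a map `φ` sending the measure `w ds` into Lebesgue measure. The map is the monotone transport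
of the mass `G / 2` into `F`; the factor `1 / 2` forces `F (φ s) ≥ G s / 2`. -/
theorem exists_left_transport {α : ℝ≥0∞} {F G : ℝ → ℝ≥0∞} (hF : Antitone F) (hG : Antitone G)
    (hFα : ∀ x, α ≤ ENNReal.ofReal x → F x = 0) (hFt : ∀ x, 0 < x → F x < ⊤)
    (hFint : ∀ x, ∫⁻ s in Ioc 0 x, F s ≠ ⊤)
    (hmaj : ∀ x, 0 < x → ∫⁻ s in Ioc 0 x, G s ≤ ∫⁻ s in Ioc 0 x, F s) :
    ∃ (φ : ℝ → ℝ) (w : ℝ → ℝ≥0∞), Measurable φ ∧ Measurable w ∧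
      (∀ᵐ s ∂(ivolume α), w s ≤ 1 ∧ G s = 2 * (w s * F (φ s)) ∧
        (w s ≠ 0 → F (φ s) ≠ 0 ∧ F (φ s) ≠ ⊤)) ∧
      ∀ k : ℝ → ℝ≥0∞, Measurable k →
        ∫⁻ s, w s * k (φ s) ∂(ivolume α) ≤ ∫⁻ x, k x ∂(ivolume α) := by
  set lam : Measure ℝ := volume.restrict (Ioi (0 : ℝ)) with hlam
  have hGhm : Measurable fun s => G s / 2 := hG.measurable.div_const 2
  set μ : Measure ℝ := lam.withDensity fun s => G s / 2 with hμ
  set ν : Measure ℝ := lam.withDensity F with hν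
  have hatμ : NullSingletonClass μ :=
    ⟨fun x => withDensity_absolutelyContinuous _ _ (measure_singleton x)⟩
  have hatν : NullSingletonClass ν :=
    ⟨fun x => withDensity_absolutelyContinuous _ _ (measure_singleton x)⟩
  have hνI : ∀ x, ν (Iic x) = ∫⁻ s in Ioc 0 x, F s := restrict_Ioi_withDensity_Iic F
  have hμI : ∀ x, μ (Iic x) = (∫⁻ s in Ioc 0 x, G s) / 2 := fun x => by
    rw [hμ, hlam, restrict_Ioi_withDensity_Iic]
    simp_rw [div_eq_mul_inv]
    rw [lintegral_mul_const _ hG.measurable]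
  have hGF : ∀ x, ∫⁻ s in Ioc 0 x, G s ≤ ∫⁻ s in Ioc 0 x, F s := fun x => by
    rcases le_or_gt x 0 with h | h
    · rw [Ioc_eq_empty (not_lt.2 h)]
      simp
    · exact hmaj x h
  have hGint : ∀ x, ∫⁻ s in Ioc 0 x, G s ≠ ⊤ := fun x => ne_top_of_le_ne_top (hFint x) (hGF x)
  have hle : μ univ ≤ ν univ :=
    le_of_tendsto_of_tendsto' (tendsto_measure_Iic_atTop μ) (tendsto_measure_Iic_atTop ν)
      fun x => by
        rw [hμI, hνI]
        exact ENNReal.half_le_self.trans (hGF x)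
  obtain ⟨φ, hφm, hmap, hφ⟩ := exists_transport (μ := μ) (ν := ν)
    (fun x => by rw [hμI]; exact (ENNReal.div_lt_top (hGint x) two_ne_zero).ne)
    (fun x => by rw [hνI]; exact hFint x) hle
  have hkey : ∀ᵐ s ∂μ, G s / 2 ≤ F (φ s) ∧ 0 < φ s := by
    filter_upwards [hφ] with s hs
    obtain ⟨hs0, hs⟩ := hs
    rw [hμI] at hs0 hs
    rw [hνI] at hs
    have hIG0 : ∫⁻ s in Ioc 0 s, G s ≠ 0 := fun h0 => by simp [h0] at hs0
    have hspos : 0 < s := by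
      by_contra hn
      rw [Ioc_eq_empty hn] at hIG0
      simp at hIG0
    have hφpos : 0 < φ s := by
      by_contra hn
      rw [Ioc_eq_empty hn] at hs
      rw [← hs] at hs0
      simp at hs0
    refine ⟨?_, hφpos⟩
    by_contra hlt
    have hlt := not_le.1 hlt
    rcases le_or_gt s (φ s) with hsφ | hsφ
    -- the head of `F` at `φ s` is half of that of `G` at `s`, too small if `s ≤ φ s`
    · have h1 : ∫⁻ s in Ioc 0 s, G s ≤ (∫⁻ s in Ioc 0 s, G s) / 2 := by
        rw [← hs]
        exact (hGF s).trans (lintegral_mono_set (Ioc_subset_Ioc_right hsφ))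
      exact absurd h1 (not_le.2 (ENNReal.half_lt_self hIG0 (hGint s)))
    -- otherwise `F < G s / 2` on `(φ s, s]`, so that the head of `F` cannot reach that of `G`
    · have h1 : ∫⁻ x in Ioc 0 s, G x ≤
          (∫⁻ x in Ioc 0 s, G x) / 2 + G s / 2 * ENNReal.ofReal (s - φ s) := by
        refine (hGF s).trans ?_
        rw [setLIntegral_Ioc_add_Ioc F hφpos.le hsφ.le, hs]
        gcongr
        refine (hF.setLIntegral_Ioc_le _ _).trans ?_
        gcongr
      have h2 : (∫⁻ x in Ioc 0 (φ s), G x) + G s * ENNReal.ofReal (s - φ s) ≤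
          ∫⁻ x in Ioc 0 s, G x := by
        rw [setLIntegral_Ioc_add_Ioc G hφpos.le hsφ.le]
        gcongr
        exact hG.le_setLIntegral_Ioc _ _
      have h3 : (∫⁻ x in Ioc 0 s, G x) + (∫⁻ x in Ioc 0 (φ s), G x) / 2 ≤
          ∫⁻ x in Ioc 0 s, G x := by
        calc _ ≤ (∫⁻ x in Ioc 0 s, G x) / 2 + G s / 2 * ENNReal.ofReal (s - φ s) +
              (∫⁻ x in Ioc 0 (φ s), G x) / 2 := by gcongr
          _ = (∫⁻ x in Ioc 0 s, G x) / 2 + ((∫⁻ x in Ioc 0 (φ s), G x) +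
                G s * ENNReal.ofReal (s - φ s)) / 2 := by
              simp_rw [div_eq_mul_inv]
              ring
          _ ≤ (∫⁻ x in Ioc 0 s, G x) / 2 + (∫⁻ x in Ioc 0 s, G x) / 2 := by gcongr
          _ = _ := ENNReal.add_halves _
      have h4 : (∫⁻ x in Ioc 0 (φ s), G x) / 2 ≤ 0 := by
        refine (ENNReal.add_le_add_iff_left (hGint s)).1 ?_
        rwa [add_zero]
      have h5 : ∫⁻ x in Ioc 0 (φ s), G x = 0 := by
        have := le_antisymm h4 zero_le
        rw [ENNReal.div_eq_zero_iff] at this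
        exact this.resolve_right ENNReal.ofNat_ne_top
      have h6 := hG.le_setLIntegral_Ioc 0 (φ s)
      rw [h5, sub_zero] at h6
      have h7 := le_antisymm h6 zero_le
      rw [mul_eq_zero] at h7
      have h8 : G (φ s) = 0 := h7.resolve_right (ENNReal.ofReal_pos.2 hφpos).ne'
      have h9 : G s = 0 := le_antisymm (h8 ▸ hG hsφ.le) zero_le
      simp [h9] at hlt
  have hwm : Measurable fun s => G s / 2 / F (φ s) := hGhm.div (hF.measurable.comp hφm)
  refine ⟨φ, fun s => G s / 2 / F (φ s), hφm, hwm, ?_, ?_⟩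
  · rw [hμ, ae_withDensity_iff hGhm] at hkey
    have hkey' := ae_mono (ivolume_le_restrict_Ioi α) hkey
    filter_upwards [hkey'] with s hs
    rcases eq_or_ne (G s / 2) 0 with h0 | h0
    · have hG0 : G s = 0 := (ENNReal.div_eq_zero_iff.1 h0).resolve_right ENNReal.ofNat_ne_top
      simp [hG0]
    · obtain ⟨h1, h2⟩ := hs h0
      have hF0 : F (φ s) ≠ 0 := fun h => h0 (le_antisymm (h ▸ h1) zero_le)
      have hFt' := (hFt _ h2).ne
      refine ⟨ENNReal.div_le_of_le_mul (by rwa [one_mul]), ?_, fun _ => ⟨hF0, hFt'⟩⟩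
      rw [ENNReal.div_mul_cancel hF0 hFt', ENNReal.mul_div_cancel two_ne_zero ENNReal.ofNat_ne_top]
  · intro k hk
    have hdm : Measurable fun x => k x / F x := hk.div hF.measurable
    calc ∫⁻ s, G s / 2 / F (φ s) * k (φ s) ∂(ivolume α)
        ≤ ∫⁻ s, G s / 2 / F (φ s) * k (φ s) ∂lam :=
          lintegral_mono' (ivolume_le_restrict_Ioi α) le_rfl
      _ = ∫⁻ s, G s / 2 * (k (φ s) / F (φ s)) ∂lam := by
          refine lintegral_congr fun s => ?_
          simp_rw [div_eq_mul_inv]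
          ring
      _ = ∫⁻ s, k (φ s) / F (φ s) ∂μ := by
          exact (lintegral_withDensity_eq_lintegral_mul _ hGhm (hdm.comp hφm)).symm
      _ = ∫⁻ x, k x / F x ∂(μ.map φ) := (lintegral_map hdm hφm).symm
      _ ≤ ∫⁻ x, k x / F x ∂ν := lintegral_mono' hmap le_rfl
      _ = ∫⁻ x, F x * (k x / F x) ∂lam := by
          rw [hν, lintegral_withDensity_eq_lintegral_mul _ hF.measurable hdm]
          rfl
      _ = ∫⁻ x in {x : ℝ | 0 < x ∧ ENNReal.ofReal x < α}, F x * (k x / F x) := by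
          have hsub : {x : ℝ | 0 < x ∧ ENNReal.ofReal x < α} ⊆ Ioi 0 := fun x hx => hx.1
          rw [hlam, ← lintegral_indicator measurableSet_Ioi,
            ← lintegral_indicator (measurableSet_interval α)]
          refine lintegral_congr fun x => ?_
          by_cases hx : x ∈ {x : ℝ | 0 < x ∧ ENNReal.ofReal x < α}
          · rw [indicator_of_mem hx, indicator_of_mem (hsub hx)]
          · rw [indicator_of_notMem hx]
            by_cases hx0 : x ∈ Ioi (0 : ℝ)
            · rw [indicator_of_mem hx0, hFα x (not_lt.1 fun h => hx ⟨hx0, h⟩), zero_mul]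
            · rw [indicator_of_notMem hx0]
      _ ≤ ∫⁻ x, k x ∂(ivolume α) := lintegral_mono fun x => ENNReal.mul_div_le

/-- A map sending the measure `w ds` into Lebesgue measure pulls null sets back to null sets, up to
the set where `w` vanishes. -/
theorem ae_comp_of_transport {α : ℝ≥0∞} {φ : ℝ → ℝ} {w : ℝ → ℝ≥0∞} (hφ : Measurable φ)
    (hw : Measurable w) (h : ∀ k : ℝ → ℝ≥0∞, Measurable k →
      ∫⁻ s, w s * k (φ s) ∂(ivolume α) ≤ ∫⁻ x, k x ∂(ivolume α)) {P : ℝ → Prop}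
    (hP : ∀ᵐ x ∂(ivolume α), P x) : ∀ᵐ s ∂(ivolume α), w s ≠ 0 → P (φ s) := by
  set B := toMeasurable (ivolume α) {x | ¬ P x} with hB
  have hBm : MeasurableSet B := measurableSet_toMeasurable _ _
  have hB0 : ivolume α B = 0 := by rw [hB, measure_toMeasurable]; exact hP
  have hkm : Measurable (B.indicator fun _ => (1 : ℝ≥0∞)) := measurable_const.indicator hBm
  have h1 := h _ hkm
  rw [lintegral_indicator hBm, setLIntegral_one, hB0] at h1
  have h2 := (lintegral_eq_zero_iff (hw.mul (hkm.comp hφ))).1 (le_antisymm h1 zero_le)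
  filter_upwards [h2] with s hs hws
  by_contra hn
  have hsB : φ s ∈ B := subset_toMeasurable _ _ hn
  have hs : w s * B.indicator (fun _ => (1 : ℝ≥0∞)) (φ s) = 0 := hs
  rw [indicator_of_mem hsB, mul_one] at hs
  exact hws hs

/-! ### Weighted composition operators, and interpolation spaces for `(L_p, L_∞)` -/

section

variable {𝕜 : Type*} [RCLike 𝕜] {α : ℝ≥0∞}

theorem aestronglyMeasurable_weightedComp {φ : ℝ → ℝ} {w : ℝ → ℝ≥0∞} (hφ : Measurable φ)
    (hw : Measurable w) (h : Fn 𝕜 α) :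
    AEStronglyMeasurable (fun s => (((w s).toReal : ℝ) : 𝕜) * h (φ s)) (ivolume α) :=
  ((RCLike.measurable_ofReal.comp hw.ennreal_toReal).mul
    (h.measurable.comp hφ)).aestronglyMeasurable

/-- The weighted composition operator `h ↦ w (h ∘ φ)` on classes of functions. It respects equality
almost everywhere by `hac`, and is defined through the representatives of the classes. -/
noncomputable def weightedComp {φ : ℝ → ℝ} {w : ℝ → ℝ≥0∞} (hφ : Measurable φ) (hw : Measurable w)
    (hac : ∀ P : ℝ → Prop, (∀ᵐ x ∂(ivolume α), P x) → ∀ᵐ s ∂(ivolume α), w s ≠ 0 → P (φ s)) :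
    Fn 𝕜 α →ₗ[𝕜] Fn 𝕜 α where
  toFun h := AEEqFun.mk _ (aestronglyMeasurable_weightedComp hφ hw h)
  map_add' h k := by
    rw [AEEqFun.mk_add_mk]
    refine AEEqFun.mk_eq_mk.2 ?_
    filter_upwards [hac _ (AEEqFun.coeFn_add h k)] with s h1
    rw [Pi.add_apply]
    rcases eq_or_ne (w s) 0 with h0 | h0
    · simp [h0]
    · rw [h1 h0, Pi.add_apply, mul_add]
  map_smul' c h := by
    refine Eq.trans (AEEqFun.mk_eq_mk.2 ?_)
      (AEEqFun.smul_mk c _ (aestronglyMeasurable_weightedComp hφ hw h))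
    filter_upwards [hac _ (AEEqFun.coeFn_smul c h)] with s h1
    change _ = c • ((((w s).toReal : ℝ) : 𝕜) * h (φ s))
    rcases eq_or_ne (w s) 0 with h0 | h0
    · simp [h0]
    · rw [h1 h0, Pi.smul_apply, smul_eq_mul, smul_eq_mul, mul_left_comm]

theorem enorm_weightedComp {φ : ℝ → ℝ} {w : ℝ → ℝ≥0∞} (hφ : Measurable φ) (hw : Measurable w)
    (hac : ∀ P : ℝ → Prop, (∀ᵐ x ∂(ivolume α), P x) → ∀ᵐ s ∂(ivolume α), w s ≠ 0 → P (φ s))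
    (hw1 : ∀ᵐ s ∂(ivolume α), w s ≤ 1) (h : Fn 𝕜 α) :
    ∀ᵐ s ∂(ivolume α), ‖weightedComp hφ hw hac h s‖ₑ = w s * ‖h (φ s)‖ₑ := by
  filter_upwards [hw1, AEEqFun.coeFn_mk (μ := ivolume α)
    (fun s => (((w s).toReal : ℝ) : 𝕜) * h (φ s)) ((RCLike.measurable_ofReal.comp
      hw.ennreal_toReal).mul (h.measurable.comp hφ)).aestronglyMeasurable] with s h1 h2
  refine (congrArg _ h2).trans ?_
  rw [enorm_mul, ← ofReal_norm (((w s).toReal : ℝ) : 𝕜), RCLike.norm_ofReal,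
    abs_of_nonneg ENNReal.toReal_nonneg, ENNReal.ofReal_toReal (h1.trans_lt ENNReal.one_lt_top).ne]

end

namespace SymmetricSpace

variable {𝕜 : Type*} [RCLike 𝕜] {α : ℝ≥0∞} {E : SymmetricSpace 𝕜 α}

theorem setLIntegral_rearrFn_ne_top_of_mem_LpSum_top {f : Fn 𝕜 α} {p : ℝ} (hp : 0 < p)
    (hf : f ∈ LpSum 𝕜 α (ENNReal.ofReal p) ∞) (t : ℝ) :
    ∫⁻ s in Ioc 0 t, rearrFn f s ^ p ≠ ⊤ := by
  obtain ⟨g, hg, h, hh, rfl⟩ := Submodule.mem_sup.1 hf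
  rw [mem_LpSubmodule_iff hp] at hg
  have hh : eLpNorm h ∞ (ivolume α) < ⊤ := hh
  rw [eLpNorm_exponent_top] at hh
  set B := eLpNormEssSup h (ivolume α)
  have hle : ∀ s, 0 < s → rearrFn (g + h) s ≤ rearrFn g s + B := by
    intro s hs
    have h1 := rearr_add_le (α := α) (F := fun x => ‖(g + h) x‖ₑ) (G := fun x => ‖g x‖ₑ)
      (H := fun x => ‖h x‖ₑ) (by
        filter_upwards [AEEqFun.coeFn_add g h] with x hx
        rw [hx]
        exact enorm_add_le _ _) hs.le le_rfl
    rw [add_zero] at h1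
    refine h1.trans (add_le_add_right (rearr_zero_le_of_ae_le ?_) _)
    exact enorm_ae_le_eLpNormEssSup _ _
  refine ne_top_of_le_ne_top (b := 2 ^ p * ((∫⁻ s in Ioc 0 t, rearrFn g s ^ p) +
    B ^ p * ENNReal.ofReal t)) ?_ ?_
  · refine ENNReal.mul_ne_top (ENNReal.rpow_ne_top_of_nonneg hp.le (by simp))
      (ENNReal.add_ne_top.2 ⟨?_, ENNReal.mul_ne_top (ENNReal.rpow_ne_top_of_nonneg hp.le hh.ne)
        ENNReal.ofReal_ne_top⟩)
    refine ne_top_of_le_ne_top hg ?_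
    rw [← lintegral_rearr_rpow α (measurable_enorm_fn g) hp]
    exact lintegral_mono_set Ioc_subset_Ioi_self
  · calc _ ≤ ∫⁻ s in Ioc 0 t, 2 ^ p * (rearrFn g s ^ p + B ^ p) := by
          refine setLIntegral_mono' measurableSet_Ioc fun s hs => ?_
          exact (ENNReal.rpow_le_rpow (hle s hs.1) hp.le).trans
            (ENNReal.add_rpow_le_two_rpow_mul _ _ hp)
      _ = _ := by
          rw [lintegral_const_mul _ (((measurable_rearrFn g).pow_const p).add_const _),
            lintegral_add_left ((measurable_rearrFn g).pow_const p), setLIntegral_const,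
            Real.volume_Ioc, sub_zero]

/-- If the heads of `(g^*)^p` are dominated by those of `(f^*)^p`, then `g^*` is, up to the factor
`2 ^ (1 / p)`, the image of `f^*` under an operator `h ↦ w ^ (1 / p) * (h ∘ φ)` which contracts both
`L_p` and `L_∞`. -/
theorem leftMonotone_of_isInterpolation_top {p : ℝ} (hp : 0 < p)
    (h : E.IsInterpolation (ENNReal.ofReal p) ∞) : E.LeftMonotone p := by
  obtain ⟨-, hsum, C, hC, H⟩ := h
  have hp' : 0 < 1 / p := by positivity
  refine leftMonotone_of_domBy hp (C := 2 ^ (1 / p) * C) (by positivity) fun f hf g _ hmaj => ?_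
  obtain ⟨φ, w, hφ, hw, hwG, hmap⟩ := exists_left_transport (α := α)
    ((rearrFn_antitone f).rpow hp.le) ((rearrFn_antitone g).rpow hp.le)
    (fun x hx => by
      rw [rearrFn, rearr_eq_zero _ hx, ENNReal.zero_rpow_of_pos hp])
    (fun x hx => ENNReal.rpow_lt_top_of_nonneg hp.le (rearrFn_lt_top (E.memLZero f hf) hx).ne)
    (setLIntegral_rearrFn_ne_top_of_mem_LpSum_top hp (hsum hf)) hmaj
  set v : ℝ → ℝ≥0∞ := fun s => w s ^ (1 / p) with hv
  have hvm : Measurable v := hw.pow_const _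
  have hv0 : ∀ s, v s ≠ 0 → w s ≠ 0 := fun s hs h0 => hs (by
    rw [hv]
    simp only [h0]
    exact ENNReal.zero_rpow_of_pos hp')
  have hv1 : ∀ᵐ s ∂(ivolume α), v s ≤ 1 := hwG.mono fun s hs => ENNReal.rpow_le_one hs.1 hp'.le
  have hvp : ∀ s, v s ^ p = w s := fun s => by
    rw [hv, ← ENNReal.rpow_mul, one_div_mul_cancel hp.ne', ENNReal.rpow_one]
  have hac : ∀ P : ℝ → Prop, (∀ᵐ x ∂(ivolume α), P x) → ∀ᵐ s ∂(ivolume α), v s ≠ 0 → P (φ s) :=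
    fun P hP => (ae_comp_of_transport hφ hw hmap hP).mono fun s hs h0 => hs (hv0 s h0)
  set T₀ : Fn 𝕜 α →ₗ[𝕜] Fn 𝕜 α := weightedComp hφ hvm hac with hT₀
  have hT₀e : ∀ k : Fn 𝕜 α, ∀ᵐ s ∂(ivolume α), ‖T₀ k s‖ₑ = v s * ‖k (φ s)‖ₑ :=
    enorm_weightedComp hφ hvm hac hv1
  have hTp : ∀ k : Fn 𝕜 α, eLpNorm (T₀ k) (ENNReal.ofReal p) (ivolume α) ≤
      eLpNorm k (ENNReal.ofReal p) (ivolume α) := by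
    intro k
    rw [eLpNorm_ofReal_le_iff hp]
    calc ∫⁻ s, ‖T₀ k s‖ₑ ^ p ∂(ivolume α) = ∫⁻ s, w s * ‖k (φ s)‖ₑ ^ p ∂(ivolume α) := by
          refine lintegral_congr_ae ((hT₀e k).mono fun s hs => ?_)
          simp only [hs]
          rw [ENNReal.mul_rpow_of_nonneg _ _ hp.le, hvp]
      _ ≤ _ := hmap (fun x => ‖k x‖ₑ ^ p) ((measurable_enorm_fn k).pow_const p)
  have hTinf : ∀ k : Fn 𝕜 α, eLpNorm (T₀ k) ∞ (ivolume α) ≤ eLpNorm k ∞ (ivolume α) := by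
    intro k
    rw [eLpNorm_exponent_top, eLpNorm_exponent_top]
    refine eLpNormEssSup_le_of_ae_enorm_bound ?_
    filter_upwards [hT₀e k, hac _ (enorm_ae_le_eLpNormEssSup k (ivolume α)), hv1] with s h1 h2 h3
    rw [h1]
    rcases eq_or_ne (v s) 0 with h0 | h0
    · rw [h0, zero_mul]
      exact zero_le
    · calc v s * ‖k (φ s)‖ₑ ≤ 1 * _ := mul_le_mul' h3 (h2 h0)
        _ = _ := one_mul _
  have hTmem : ∀ k ∈ LpSum 𝕜 α (ENNReal.ofReal p) ∞, T₀ k ∈ LpSum 𝕜 α (ENNReal.ofReal p) ∞ := by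
    intro k hk
    obtain ⟨k₁, hk₁, k₂, hk₂, rfl⟩ := Submodule.mem_sup.1 hk
    rw [map_add]
    exact Submodule.add_mem_sup ((hTp k₁).trans_lt hk₁) ((hTinf k₂).trans_lt hk₂)
  have hfr := toFn_rearr_mem hf
  set fr : Fn 𝕜 α := toFn 𝕜 α (rearr α fun x => ‖f x‖ₑ) (measurable_rearr _ _) with hfrdef
  have hfre : ∀ᵐ x ∂(ivolume α), ‖fr x‖ₑ = rearrFn f x := enorm_toFn _ _
    (ae_ivolume_of_forall_pos fun _ ht => rearrFn_lt_top (E.memLZero f hf) ht)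
  obtain ⟨h1, h2⟩ := H (T₀.restrict hTmem) (fun k _ => hTp k) (fun k _ => hTinf k)
    ⟨fr, hsum hfr.1⟩ hfr.1
  have h1 : T₀ fr ∈ E.carrier := h1
  have h2 : E.qnorm (T₀ fr) ≤ C * E.qnorm f := by
    rw [← hfr.2]
    exact h2
  refine ((domBy_enorm_iff.2 ⟨h1, h2⟩).const_mul (r := 2 ^ (1 / p)) (by positivity)).mono ?_
    (le_of_eq (by ring))
  filter_upwards [hwG, hT₀e fr, hac _ hfre] with s e1 e2 e3
  have e4 : rearrFn g s = 2 ^ (1 / p) * (v s * rearrFn f (φ s)) := by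
    calc rearrFn g s = (rearrFn g s ^ p) ^ (1 / p) := by
          rw [← ENNReal.rpow_mul, mul_one_div_cancel hp.ne', ENNReal.rpow_one]
      _ = _ := by
          rw [e1.2.1, ENNReal.mul_rpow_of_nonneg _ _ hp'.le, ENNReal.mul_rpow_of_nonneg _ _ hp'.le,
            ← ENNReal.rpow_mul (rearrFn f (φ s)), mul_one_div_cancel hp.ne', ENNReal.rpow_one]
  rw [e4, e2, ← ENNReal.ofReal_rpow_of_nonneg zero_le_two hp'.le, ENNReal.ofReal_ofNat]
  rcases eq_or_ne (v s) 0 with h0 | h0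
  · simp [h0]
  · rw [e3 h0]

end SymmetricSpace

/-! ### Convexity and the Fatou property -/

theorem rearr_min (α : ℝ≥0∞) (F : ℝ → ℝ≥0∞) (L : ℝ≥0∞) (t : ℝ) :
    rearr α (fun x => min (F x) L) t = min (rearr α F t) L := by
  refine eq_of_forall_lt_iff fun s => ?_
  rw [lt_min_iff, lt_rearr_iff, lt_rearr_iff]
  by_cases hs : s < L
  · simp [hs]
  · simp [hs]

theorem sum_indicator_eq_natCast_mul {M a : ℕ} {P : Fin M → Set ℝ} {x : ℝ}
    (h : ∀ y : ℝ, ∑ i, (P i).indicator (fun _ => y) x = a * y) (z : ℝ≥0∞) :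
    ∑ i, (P i).indicator (fun _ => z) x = a * z := by
  classical
  have h1 := h 1
  simp only [indicator_apply, Finset.sum_ite, Finset.sum_const, nsmul_eq_mul, mul_one, mul_zero,
    add_zero] at h1 ⊢
  have h2 := Nat.cast_injective (R := ℝ) h1
  rw [h2]

namespace SymmetricSpace

variable {𝕜 : Type*} [RCLike 𝕜] {α : ℝ≥0∞} {E : SymmetricSpace 𝕜 α}

theorem enorm_powSum {r : ℝ} (hr : 0 < r) {n : ℕ} (x : Fin n → Fn 𝕜 α) :
    ∀ᵐ s ∂(ivolume α), ‖powSum r x s‖ₑ = (∑ i, ‖x i s‖ₑ ^ r) ^ (1 / r) := by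
  have h := AEEqFun.coeFn_mk (μ := ivolume α)
    (fun s => (((∑ i, ‖x i s‖ ^ r) ^ (1 / r) : ℝ) : 𝕜))
    (RCLike.measurable_ofReal.comp
      ((Finset.measurable_sum _ fun i _ => (x i).measurable.norm.pow_const r).pow_const
        (1 / r))).aestronglyMeasurable
  filter_upwards [h] with s hs
  have h0 : 0 ≤ ∑ i, ‖x i s‖ ^ r := Finset.sum_nonneg fun i _ => by positivity
  refine (congrArg _ hs).trans ?_
  rw [← ofReal_norm, RCLike.norm_ofReal, abs_of_nonneg (by positivity),
    ← ENNReal.ofReal_rpow_of_nonneg h0 (by positivity),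
    ENNReal.ofReal_sum_of_nonneg fun i _ => by positivity]
  congr 1
  refine Finset.sum_congr rfl fun i _ => ?_
  rw [← ofReal_norm, ENNReal.ofReal_rpow_of_nonneg (norm_nonneg _) hr.le]

theorem powSum_mem {r : ℝ} (hr : 0 < r) {n : ℕ} {x : Fin n → Fn 𝕜 α} (hx : ∀ i, x i ∈ E.carrier) :
    powSum r x ∈ E.carrier := by
  obtain ⟨C, -, H⟩ := exists_domBy_sum E n
  have h1 := H (fun i s => ‖x i s‖ₑ) (∑ i, E.qnorm (x i))
    (Finset.sum_nonneg fun i _ => E.qnorm_nonneg _ (hx i)) fun i =>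
      domBy_enorm_iff.2 ⟨hx i, Finset.single_le_sum (f := fun i => E.qnorm (x i))
        (fun i _ => E.qnorm_nonneg _ (hx i)) (Finset.mem_univ i)⟩
  refine (domBy_enorm_iff.1 ((h1.const_mul (r := (n : ℝ) ^ (1 / r)) (by positivity)).mono ?_
    le_rfl)).1
  filter_upwards [enorm_powSum hr x] with s hs
  rw [hs, ← ENNReal.ofReal_rpow_of_nonneg (by positivity) (by positivity), ENNReal.ofReal_natCast]
  set Y := ∑ i, ‖x i s‖ₑ with hY
  calc (∑ i, ‖x i s‖ₑ ^ r) ^ (1 / r) ≤ (∑ _i : Fin n, Y ^ r) ^ (1 / r) := by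
        refine ENNReal.rpow_le_rpow (Finset.sum_le_sum fun i _ => ENNReal.rpow_le_rpow ?_ hr.le)
          (by positivity)
        exact Finset.single_le_sum (f := fun i => ‖x i s‖ₑ) (fun _ _ => zero_le)
          (Finset.mem_univ i)
    _ = _ := by
        rw [Finset.sum_const, Finset.card_univ, Fintype.card_fin, nsmul_eq_mul,
          ENNReal.mul_rpow_of_nonneg _ _ (by positivity), ← ENNReal.rpow_mul,
          mul_one_div_cancel hr.ne', ENNReal.rpow_one]

/-- Power means of functions dominated in a `p`-convex space are dominated, uniformly in the number
of functions. -/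
theorem PConvex.exists_domBy {p : ℝ} (hp : 0 < p) (H : E.PConvex p) : ∃ C : ℝ, 0 < C ∧
    ∀ (n : ℕ) [NeZero n] (h : Fin n → ℝ → ℝ≥0∞) (c : ℝ), (∀ i, Measurable (h i)) →
      (∀ i, E.DomBy (h i) c) →
      E.DomBy (fun s => ((∑ i, h i s ^ p) / n) ^ (1 / p)) (C * c) := by
  obtain ⟨C, hC⟩ := H
  refine ⟨max C 1, by positivity, fun n _ h c hm hc => ?_⟩
  have hn : (0 : ℝ) < n := by exact_mod_cast NeZero.pos n
  have hc0 : 0 ≤ c := (hc ⟨0, NeZero.pos n⟩).nonneg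
  set x : Fin n → Fn 𝕜 α := fun i => toFn 𝕜 α (h i) (hm i) with hx
  have hxm : ∀ i, x i ∈ E.carrier := fun i => ((hc i).toFn_mem (hm i)).1
  have h1 : E.qnorm (powSum p x) ≤ max C 1 * ((n : ℝ) ^ (1 / p) * c) := by
    have h0 : 0 ≤ ∑ i, E.qnorm (x i) ^ p :=
      Finset.sum_nonneg fun i _ => Real.rpow_nonneg (E.qnorm_nonneg _ (hxm i)) _
    refine (hC n x hxm).trans (mul_le_mul (le_max_left _ _) ?_ (by positivity) (by positivity))
    calc (∑ i, E.qnorm (x i) ^ p) ^ (1 / p) ≤ (∑ _i : Fin n, c ^ p) ^ (1 / p) :=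
          Real.rpow_le_rpow h0 (Finset.sum_le_sum fun i _ => Real.rpow_le_rpow
            (E.qnorm_nonneg _ (hxm i)) ((hc i).toFn_mem (hm i)).2 hp.le) (by positivity)
      _ = _ := by
          rw [Finset.sum_const, Finset.card_univ, Fintype.card_fin, nsmul_eq_mul,
            Real.mul_rpow hn.le (by positivity), ← Real.rpow_mul hc0, mul_one_div_cancel hp.ne',
            Real.rpow_one]
  have h2 := (domBy_enorm_iff.2 ⟨powSum_mem hp hxm, h1⟩).const_mul
    (r := ((n : ℝ) ^ (1 / p))⁻¹) (by positivity)
  refine h2.mono ?_ (le_of_eq (by field_simp))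
  filter_upwards [enorm_powSum hp x, ae_all_iff.2 fun i =>
    enorm_toFn (𝕜 := 𝕜) (h i) (hm i) (hc i).ae_lt_top] with s h3 h4
  rw [h3]
  simp only [hx, h4]
  rw [div_eq_mul_inv, ENNReal.mul_rpow_of_nonneg _ _ (by positivity), mul_comm,
    ENNReal.inv_rpow, ENNReal.ofReal_inv_of_pos (by positivity),
    ← ENNReal.ofReal_rpow_of_nonneg hn.le (by positivity), ENNReal.ofReal_natCast]

theorem finiteDistr_rearrFn {g : Fn 𝕜 α} (hg : MemLZero g) : FiniteDistr α (rearrFn g) := by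
  obtain ⟨s, hs, h⟩ := (memLZero_iff_finiteDistr g).1 hg
  exact ⟨s, hs, (ivolume_lt_rearr α _ s).trans_lt h⟩

/-- In a `p`-convex space with the Fatou property, left majorization is controlled as long as the
integrals are finite: by transport `(g^*)^p`, cut off where the transport weight is small, is up to
constants an average of `p`-th powers of functions whose distribution is dominated by that of
`f`. -/
theorem PConvex.exists_domBy_rearrFn {p : ℝ} (hp : 0 < p) (hE : E.Fatou) (H : E.PConvex p) :
    ∃ C : ℝ, 0 < C ∧ ∀ f ∈ E.carrier, ∀ g : Fn 𝕜 α, MemLZero g →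
      (∀ t, ∫⁻ s in Ioc 0 t, rearrFn f s ^ p ≠ ⊤) →
      (∀ t, 0 < t → ∫⁻ s in Ioc 0 t, rearrFn g s ^ p ≤ ∫⁻ s in Ioc 0 t, rearrFn f s ^ p) →
      E.DomBy (rearrFn g) (C * E.qnorm f) := by
  obtain ⟨C, hC, H⟩ := H.exists_domBy hp
  have hp' : 0 < 1 / p := by positivity
  refine ⟨(4 * 2 ^ p) ^ (1 / p) * C, by positivity, fun f hf g hg hfin hmaj => ?_⟩
  obtain ⟨φ, w, hφ, hw, hwG, hmap⟩ := exists_left_transport (α := α)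
    ((rearrFn_antitone f).rpow hp.le) ((rearrFn_antitone g).rpow hp.le)
    (fun x hx => by
      rw [rearrFn, rearr_eq_zero _ hx, ENNReal.zero_rpow_of_pos hp])
    (fun x hx => ENNReal.rpow_lt_top_of_nonneg hp.le (rearrFn_lt_top (E.memLZero f hf) hx).ne)
    hfin hmaj
  have hlevel : ∀ n : ℕ, MeasurableSet {s | (((n + 1 : ℕ) : ℝ≥0∞))⁻¹ ≤ w s} := fun n =>
    measurableSet_le measurable_const hw
  -- exhaust `{w > 0}` by the sets `{w ≥ 1 / (n + 1)}`
  refine Fatou.domBy_of_tendsto hE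
    (h := fun n => {s | (((n + 1 : ℕ) : ℝ≥0∞))⁻¹ ≤ w s}.indicator (rearrFn g))
    (fun n => (measurable_rearrFn g).indicator (hlevel n)) ?_ ?_ (measurable_rearrFn g)
    (ae_ivolume_of_forall_pos fun _ ht => rearrFn_lt_top hg ht) (finiteDistr_rearrFn hg) ?_
  · intro s m n hmn
    refine indicator_le_indicator_of_subset (fun x hx => ?_) (fun _ => zero_le) s
    have hx : (((m + 1 : ℕ) : ℝ≥0∞))⁻¹ ≤ w x := hx
    refine le_trans (ENNReal.inv_le_inv.2 ?_) hx
    exact_mod_cast Nat.succ_le_succ hmn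
  · intro n
    set M := n + 1 with hM
    have hMt : ((M : ℕ) : ℝ≥0∞) ≠ ⊤ := ENNReal.natCast_ne_top M
    have hM0 : ((M : ℕ) : ℝ≥0∞) ≠ 0 := by simp [hM]
    set j : ℝ → ℤ := fun s => dyadicExp (rearrFn f (φ s)) with hj
    have hjm : Measurable j := measurable_dyadicExp.comp ((measurable_rearrFn f).comp hφ)
    -- `a / M` is `w` rounded down to a multiple of `1 / M`, and at least `w / 2` where `w ≥ 1 / M`
    set a : ℝ → ℕ := fun s => min ⌊((M : ℝ≥0∞) * w s).toReal⌋₊ M with ha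
    have ham : Measurable a :=
      (Nat.measurable_floor.comp (hw.const_mul _).ennreal_toReal).min measurable_const
    obtain ⟨P, hPm, hPsum, hPdist⟩ := exists_average α j hjm M a ham fun s => min_le_right _ _
    have haw : ∀ᵐ s ∂(ivolume α), (a s : ℝ≥0∞) / M ≤ w s := by
      filter_upwards [hwG] with s hs
      have hwt : (M : ℝ≥0∞) * w s ≠ ⊤ :=
        ENNReal.mul_ne_top hMt (hs.1.trans_lt ENNReal.one_lt_top).ne
      refine ENNReal.div_le_of_le_mul ?_
      calc (a s : ℝ≥0∞) ≤ (⌊((M : ℝ≥0∞) * w s).toReal⌋₊ : ℝ≥0∞) := by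
            exact_mod_cast min_le_left _ _
        _ = ENNReal.ofReal (⌊((M : ℝ≥0∞) * w s).toReal⌋₊ : ℝ) := (ENNReal.ofReal_natCast _).symm
        _ ≤ ENNReal.ofReal ((M : ℝ≥0∞) * w s).toReal :=
            ENNReal.ofReal_le_ofReal (Nat.floor_le ENNReal.toReal_nonneg)
        _ = w s * M := by rw [ENNReal.ofReal_toReal hwt, mul_comm]
    have hwa : ∀ᵐ s ∂(ivolume α), (M : ℝ≥0∞)⁻¹ ≤ w s → w s ≤ 2 * ((a s : ℝ≥0∞) / M) := by
      filter_upwards [hwG] with s hs hMs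
      have hwt : (M : ℝ≥0∞) * w s ≠ ⊤ :=
        ENNReal.mul_ne_top hMt (hs.1.trans_lt ENNReal.one_lt_top).ne
      have h1 : (1 : ℝ≥0∞) ≤ M * w s := by
        rw [← ENNReal.mul_inv_cancel hM0 hMt]
        gcongr
      have h1r : (1 : ℝ) ≤ ((M : ℝ≥0∞) * w s).toReal := by
        rw [← ENNReal.toReal_one]
        exact ENNReal.toReal_mono hwt h1
      have h2r : ((M : ℝ≥0∞) * w s).toReal ≤ M := by
        rw [← ENNReal.toReal_natCast M]
        refine ENNReal.toReal_mono hMt ?_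
        calc (M : ℝ≥0∞) * w s ≤ M * 1 := by gcongr; exact hs.1
          _ = M := mul_one _
      have haeq : a s = ⌊((M : ℝ≥0∞) * w s).toReal⌋₊ :=
        min_eq_left (Nat.floor_le_of_le h2r)
      have h3 : ((M : ℝ≥0∞) * w s).toReal ≤ 2 * (a s : ℝ) := by
        have h4 := Nat.lt_floor_add_one ((M : ℝ≥0∞) * w s).toReal
        have h5 : (1 : ℝ) ≤ ⌊((M : ℝ≥0∞) * w s).toReal⌋₊ := by
          exact_mod_cast (Nat.one_le_floor_iff _).2 h1r
        rw [haeq]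
        linarith
      rw [← mul_div_assoc, ENNReal.le_div_iff_mul_le (Or.inl hM0) (Or.inl hMt), mul_comm,
        ← ENNReal.ofReal_toReal hwt]
      refine (ENNReal.ofReal_le_ofReal h3).trans_eq ?_
      rw [ENNReal.ofReal_mul zero_le_two, ENNReal.ofReal_ofNat, ENNReal.ofReal_natCast]
    -- copies of `f^* ∘ φ`, rounded down to powers of `2`, cut off to the sets of the average
    set h : Fin M → ℝ → ℝ≥0∞ := fun i => (P i).indicator fun s => dyadic (j s) with hh
    have hhm : ∀ i, Measurable (h i) := fun i =>
      (measurable_dyadic.comp hjm).indicator (hPm i)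
    have hdom : ∀ i, E.DomBy (h i) (E.qnorm f) := by
      intro i
      refine (domBy_rearr hf).of_distr (hhm i) fun σ => ?_
      have hset : {x | σ < h i x} = j ⁻¹' {m | σ < dyadic m} ∩ P i := by
        ext x
        by_cases hx : x ∈ P i
        · simp [hh, hx]
        · simp [hh, hx]
      have hlm : MeasurableSet {x | σ < rearrFn f x} :=
        measurableSet_lt measurable_const (measurable_rearrFn f)
      rw [hset, hPdist, ← lintegral_indicator (hjm (MeasurableSet.of_discrete))]
      calc _ ≤ ∫⁻ s, w s * {x | σ < rearrFn f x}.indicator (fun _ => 1) (φ s) ∂(ivolume α) := by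
            refine lintegral_mono_ae ?_
            filter_upwards [haw, hwG] with s h1 h2
            by_cases hs : s ∈ j ⁻¹' {m | σ < dyadic m}
            · rw [indicator_of_mem hs]
              rcases eq_or_ne (w s) 0 with h0 | h0
              · exact h1.trans (by rw [h0]; exact zero_le)
              · have h3 := h2.2.2 h0
                have h4 : rearrFn f (φ s) ≠ 0 := fun h => h3.1 (by
                  rw [h]; exact ENNReal.zero_rpow_of_pos hp)
                have h5 : rearrFn f (φ s) ≠ ⊤ := fun h => h3.2 (by
                  rw [h]; exact ENNReal.top_rpow_of_pos hp)
                have h6 : φ s ∈ {x | σ < rearrFn f x} :=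
                  lt_of_lt_of_le (show σ < dyadic (j s) from hs) (dyadic_le h4 h5)
                rw [indicator_of_mem h6, mul_one]
                exact h1
            · rw [indicator_of_notMem hs]
              exact zero_le
        _ ≤ ∫⁻ x, {x | σ < rearrFn f x}.indicator (fun _ => 1) x ∂(ivolume α) :=
            hmap _ (measurable_const.indicator hlm)
        _ = _ := by
            rw [lintegral_indicator hlm, setLIntegral_one]
            rfl
    refine ((H M h _ hhm hdom).const_mul (r := (4 * 2 ^ p) ^ (1 / p)) (by positivity)).mono ?_
      (le_of_eq (by ring))
    filter_upwards [hwG, hwa] with s h1 h2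
    rw [indicator_apply]
    split_ifs with hs
    · have hs : (M : ℝ≥0∞)⁻¹ ≤ w s := hs
      have h3 := h2 hs
      have hw0 : w s ≠ 0 := fun h0 => by
        rw [h0, nonpos_iff_eq_zero, ENNReal.inv_eq_zero] at hs
        exact hMt hs
      have h5 : rearrFn f (φ s) ≠ ⊤ := fun h => (h1.2.2 hw0).2 (by
        rw [h]; exact ENNReal.top_rpow_of_pos hp)
      have h6 : ∑ i, h i s ^ p = a s * dyadic (j s) ^ p := by
        rw [← sum_indicator_eq_natCast_mul (hPsum s)]
        refine Finset.sum_congr rfl fun i _ => ?_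
        by_cases hi : s ∈ P i
        · simp [hh, hi]
        · simp [hh, hi, hp]
      rw [h6, ← ENNReal.ofReal_rpow_of_nonneg (by positivity) hp'.le,
        ← ENNReal.mul_rpow_of_nonneg _ _ hp'.le, ENNReal.ofReal_mul (by positivity),
        ← ENNReal.ofReal_rpow_of_nonneg zero_le_two hp.le, ENNReal.ofReal_ofNat,
        ENNReal.ofReal_ofNat]
      rw [← ENNReal.rpow_le_rpow_iff hp, ← ENNReal.rpow_mul, one_div_mul_cancel hp.ne',
        ENNReal.rpow_one, h1.2.1]
      calc 2 * (w s * rearrFn f (φ s) ^ p)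
          ≤ 2 * (2 * ((a s : ℝ≥0∞) / M) * (2 * dyadic (j s)) ^ p) := by
            gcongr
            exact le_two_mul_dyadic h5
        _ = _ := by
            rw [ENNReal.mul_rpow_of_nonneg _ _ hp.le, div_eq_mul_inv, div_eq_mul_inv]
            ring
    · exact zero_le
  · filter_upwards [hwG] with s hs
    rcases eq_or_ne (w s) 0 with h0 | h0
    · have h1 : rearrFn g s = 0 := by
        have := hs.2.1
        rw [h0, zero_mul, mul_zero] at this
        exact (ENNReal.rpow_eq_zero_iff_of_pos hp).1 this
      refine tendsto_const_nhds.congr fun n => ?_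
      rw [indicator_apply, h1]
      simp
    · refine tendsto_const_nhds.congr' ?_
      obtain ⟨N, hN⟩ := ENNReal.exists_inv_nat_lt h0
      filter_upwards [eventually_ge_atTop N] with n hn
      rw [indicator_of_mem]
      refine le_trans (ENNReal.inv_le_inv.2 ?_) hN.le
      exact_mod_cast hn.trans (Nat.le_succ n)

/-- The multiples of the indicator function of `(0, 1]` are not bounded in `E`. -/
theorem not_forall_domBy_indicator (hα : 0 < α) (c : ℝ) :
    ¬ ∀ r : ℝ, 0 < r → E.DomBy (fun x => ENNReal.ofReal r * (Ioc (0 : ℝ) 1).indicator 1 x) c := by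
  intro h
  have hm : Measurable ((Ioc (0 : ℝ) 1).indicator (1 : ℝ → ℝ≥0∞)) :=
    measurable_one.indicator measurableSet_Ioc
  set u : Fn 𝕜 α := toFn 𝕜 α _ hm with hu
  have hr : ∀ r : ℝ, 0 < r → u ∈ E.carrier ∧ E.qnorm u ≤ r⁻¹ * c := fun r hr => by
    refine (((h r hr).const_mul (r := r⁻¹) (by positivity)).mono ?_ le_rfl).toFn_mem hm
    refine Eventually.of_forall fun x => ?_
    rw [← mul_assoc, ← ENNReal.ofReal_mul (by positivity), inv_mul_cancel₀ hr.ne',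
      ENNReal.ofReal_one, one_mul]
  have h0 : E.qnorm u ≤ 0 := by
    have ht : Tendsto (fun r : ℝ => r⁻¹ * c) atTop (𝓝 (0 * c)) :=
      tendsto_inv_atTop_zero.mul_const c
    rw [zero_mul] at ht
    exact ge_of_tendsto ht ((eventually_gt_atTop 0).mono fun r h => (hr r h).2)
  have hu0 : u = 0 := (E.qnorm_eq_zero_iff u (hr 1 one_pos).1).1
    (le_antisymm h0 (E.qnorm_nonneg u (hr 1 one_pos).1))
  have h1 : ∀ᵐ x ∂(ivolume α), x ∉ Ioc (0 : ℝ) 1 := by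
    filter_upwards [enorm_toFn (𝕜 := 𝕜) (α := α) _ hm (Eventually.of_forall fun x =>
      (indicator_le_self' (fun _ _ => zero_le) x).trans_lt ENNReal.one_lt_top),
      AEEqFun.coeFn_zero (μ := ivolume α) (β := 𝕜)] with x h2 h3 hx
    rw [← hu, hu0, h3, indicator_of_mem hx] at h2
    simp at h2
  have h2 : ivolume α (Ioc 0 1) = 0 := by
    rw [ae_iff] at h1
    simpa only [not_not, ofPred_mem_eq] using h1
  have h3 := ivolume_ofReal_lt α (min α 1)
  have h4 : ivolume α {x | ENNReal.ofReal x < min α 1} ≤ ivolume α (Ioc 0 1) := by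
    refine measure_mono_ae ?_
    filter_upwards [ae_ivolume_mem α] with x hx hx1
    refine ⟨hx.1, ?_⟩
    have h5 : ENNReal.ofReal x < 1 := lt_of_lt_of_le hx1 (min_le_right _ _)
    exact (ENNReal.ofReal_lt_one.1 h5).le
  rw [h3, h2] at h4
  have : 0 < min α (min α 1) := lt_min hα (lt_min hα one_pos)
  exact absurd h4 (not_le.2 (by simpa using this))

/-- If the integral diverged, then truncations of `f` would majorize arbitrarily large multiples of
the indicator function of `(0, 1]`. -/
theorem PConvex.setLIntegral_ne_top (hα : 0 < α) {p : ℝ} (hp : 0 < p) (hE : E.Fatou)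
    (H : E.PConvex p) {f : Fn 𝕜 α} (hf : f ∈ E.carrier) (t : ℝ) :
    ∫⁻ s in Ioc 0 t, rearrFn f s ^ p ≠ ⊤ := by
  intro htop
  obtain ⟨C, hC, H⟩ := H.exists_domBy_rearrFn hp hE
  have hf0 := E.memLZero f hf
  have htop1 := ((rearrFn_antitone f).rpow hp.le).setLIntegral_Ioc_eq_top
    (fun t ht => ENNReal.rpow_lt_top_of_nonneg hp.le (rearrFn_lt_top hf0 ht).ne) htop one_pos
  refine not_forall_domBy_indicator (E := E) hα (C * E.qnorm f) fun r hr => ?_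
  -- truncating `f` at a high level keeps the integral over `(0, 1]` above `r ^ p`
  have hlim : Tendsto (fun n : ℕ => ∫⁻ s in Ioc (0 : ℝ) 1, min (rearrFn f s) n ^ p)
      atTop (𝓝 ⊤) := by
    rw [← htop1]
    refine lintegral_tendsto_of_tendsto_of_monotone
      (fun n => (((measurable_rearrFn f).min measurable_const).pow_const p).aemeasurable)
      (Eventually.of_forall fun s m n hmn => ?_) (Eventually.of_forall fun s => ?_)
    · dsimp only
      gcongr
    · refine (ENNReal.continuous_rpow_const.tendsto _).comp ?_
      have := (tendsto_const_nhds (x := rearrFn f s)).min ENNReal.tendsto_nat_nhds_top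
      rwa [min_top_right] at this
  obtain ⟨n, hn⟩ := (hlim.eventually (lt_mem_nhds
    (ENNReal.rpow_lt_top_of_nonneg hp.le (ENNReal.ofReal_ne_top (r := r))))).exists
  have hkm : Measurable fun x => min (rearrFn f x) n :=
    (measurable_rearrFn f).min measurable_const
  have hkfin : ∀ x, min (rearrFn f x) n < ⊤ := fun x =>
    (min_le_right _ _).trans_lt (ENNReal.natCast_lt_top n)
  set k : Fn 𝕜 α := toFn 𝕜 α _ hkm with hk
  have hkE : k ∈ E.carrier ∧ E.qnorm k ≤ E.qnorm f :=
    ((domBy_rearr hf).mono (Eventually.of_forall fun x => min_le_left _ _) le_rfl).toFn_mem hkm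
  have hkr : ∀ s, rearrFn k s = min (rearrFn f s) n := fun s => by
    rw [hk, rearrFn_toFn hkm (Eventually.of_forall hkfin), rearr_min]
    congr 1
    exact congrFun (rearr_rearr α _) s
  have hgm : Measurable fun x => ENNReal.ofReal r * (Ioc (0 : ℝ) 1).indicator (1 : ℝ → ℝ≥0∞) x :=
    (measurable_one.indicator measurableSet_Ioc).const_mul _
  have hgle : ∀ x, ENNReal.ofReal r * (Ioc (0 : ℝ) 1).indicator (1 : ℝ → ℝ≥0∞) x ≤
      ENNReal.ofReal r := fun x =>
    (mul_le_mul_right (indicator_le_self' (fun _ _ => zero_le) x) _).trans_eq (mul_one _)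
  have hgfin : ∀ x, ENNReal.ofReal r * (Ioc (0 : ℝ) 1).indicator (1 : ℝ → ℝ≥0∞) x < ⊤ := fun x =>
    (hgle x).trans_lt ENNReal.ofReal_lt_top
  set g : Fn 𝕜 α := toFn 𝕜 α _ hgm with hg
  have hg0 : MemLZero g := by
    rw [memLZero_iff_finiteDistr]
    refine FiniteDistr.mono_ae ⟨ENNReal.ofReal r, ENNReal.ofReal_ne_top, ?_⟩
      (enorm_toFn_le _ hgm)
    have : {x | ENNReal.ofReal r < ENNReal.ofReal r *
        (Ioc (0 : ℝ) 1).indicator (1 : ℝ → ℝ≥0∞) x} = ∅ :=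
      eq_empty_of_forall_notMem fun x hx => absurd (hgle x) (not_le.2 hx)
    rw [this, measure_empty]
    exact ENNReal.zero_lt_top
  have hgr : ∀ s, rearrFn g s ≤ (Iic (1 : ℝ)).indicator (fun _ => ENNReal.ofReal r) s := by
    intro s
    rw [hg, rearrFn_toFn hgm (Eventually.of_forall hgfin)]
    refine le_of_forall_lt fun σ hσ => ?_
    have h1 := lt_rearr_iff.1 hσ
    have h2 : {x | σ < ENNReal.ofReal r * (Ioc (0 : ℝ) 1).indicator (1 : ℝ → ℝ≥0∞) x} ⊆
        Ioc 0 1 := by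
      intro x hx
      by_contra hx'
      have hx : σ < ENNReal.ofReal r * (Ioc (0 : ℝ) 1).indicator (1 : ℝ → ℝ≥0∞) x := hx
      rw [indicator_of_notMem hx', mul_zero] at hx
      exact not_lt_zero hx
    have h3 : ENNReal.ofReal s < 1 := by
      refine h1.trans_le ((measure_mono h2).trans ((ivolume_le_volume α _).trans ?_))
      rw [Real.volume_Ioc, sub_zero, ENNReal.ofReal_one]
    have hs1 : s ∈ Iic (1 : ℝ) := (ENNReal.ofReal_lt_one.1 h3).le
    rw [indicator_of_mem hs1]
    obtain ⟨x, hx⟩ := nonempty_of_measure_ne_zero (zero_le.trans_lt h1).ne'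
    exact lt_of_lt_of_le hx (hgle x)
  have hkanti : Antitone fun s => rearrFn k s ^ p := (rearrFn_antitone k).rpow hp.le
  have hkt : ∀ t, ∫⁻ s in Ioc 0 t, rearrFn k s ^ p ≠ ⊤ := fun t => by
    refine ne_top_of_le_ne_top (b := (n : ℝ≥0∞) ^ p * ENNReal.ofReal t) (ENNReal.mul_ne_top
      (ENNReal.rpow_ne_top_of_nonneg hp.le (ENNReal.natCast_ne_top n)) ENNReal.ofReal_ne_top) ?_
    calc _ ≤ ∫⁻ _ in Ioc 0 t, (n : ℝ≥0∞) ^ p := by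
          refine lintegral_mono fun s => ?_
          rw [hkr]
          exact ENNReal.rpow_le_rpow (min_le_right _ _) hp.le
      _ = _ := by rw [setLIntegral_const, Real.volume_Ioc, sub_zero]
  have hk1 : ENNReal.ofReal r ^ p ≤ ∫⁻ s in Ioc 0 1, rearrFn k s ^ p := by
    simp_rw [hkr]
    exact hn.le
  have hgt : ∀ t ≤ 1, ∫⁻ s in Ioc 0 t, rearrFn g s ^ p ≤ ENNReal.ofReal r ^ p * ENNReal.ofReal t :=
    fun t _ => by
      calc _ ≤ ∫⁻ _ in Ioc 0 t, ENNReal.ofReal r ^ p := by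
            refine lintegral_mono fun s => ENNReal.rpow_le_rpow ((hgr s).trans ?_) hp.le
            exact indicator_le_self' (fun _ _ => zero_le) s
        _ = _ := by rw [setLIntegral_const, Real.volume_Ioc, sub_zero]
  have hmaj : ∀ t, 0 < t → ∫⁻ s in Ioc 0 t, rearrFn g s ^ p ≤ ∫⁻ s in Ioc 0 t, rearrFn k s ^ p := by
    intro t ht
    rcases le_total t 1 with ht1 | ht1
    · have h1 := hkanti.setLIntegral_average_le ht ht1
      rw [ENNReal.ofReal_one, mul_one] at h1
      exact (hgt t ht1).trans ((mul_le_mul_left hk1 _).trans h1)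
    · rw [setLIntegral_Ioc_add_Ioc _ zero_le_one ht1, setLIntegral_Ioc_add_Ioc _ zero_le_one ht1]
      have h2 := hgt 1 le_rfl
      rw [ENNReal.ofReal_one, mul_one] at h2
      refine add_le_add (h2.trans hk1) ((setLIntegral_mono' measurableSet_Ioc (g := 0)
        fun s hs => ?_).trans (by simp))
      have h3 := hgr s
      rw [indicator_of_notMem (notMem_Iic.2 hs.1)] at h3
      rw [le_antisymm h3 zero_le, ENNReal.zero_rpow_of_pos hp]
      exact le_rfl
  refine ((H k hkE.1 g hg0 hkt hmaj).of_rearr (measurable_enorm_fn g)).mono ?_ ?_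
  · exact (enorm_toFn _ hgm (Eventually.of_forall hgfin)).mono fun x hx => hx.ge
  · exact mul_le_mul_of_nonneg_left hkE.2 hC.le

theorem leftMonotone_of_fatou_of_pConvex (hα : 0 < α) {p : ℝ} (hp : 0 < p) (hE : E.Fatou)
    (H : E.PConvex p) : E.LeftMonotone p := by
  obtain ⟨C, hC, h⟩ := H.exists_domBy_rearrFn hp hE
  exact leftMonotone_of_domBy hp hC fun f hf g hg hmaj =>
    h f hf g hg (H.setLIntegral_ne_top hα hp hE hf) hmaj

end SymmetricSpace

/-! ### Transport of a right-majorized function -/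

/-- Domination of tails survives truncation, at the price of a factor `2` and of truncating the
larger tail at a larger point. -/
theorem exists_setLIntegral_le_two_mul {F G : ℝ → ℝ≥0∞} (hG : Antitone G)
    (hGt : ∀ x, 0 < x → G x < ⊤)
    (hmaj : ∀ x, 0 < x → ∫⁻ s in Ioi x, G s ≤ ∫⁻ s in Ioi x, F s) {ε R : ℝ} (hε : 0 < ε) :
    ∃ R', R ≤ R' ∧
      ∀ t, ε ≤ t → t ≤ R → ∫⁻ s in Ioc t R, G s ≤ 2 * ∫⁻ s in Ioc t R', F s := by
  set c := ∫⁻ s in Ioc ε R, G s with hc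
  have hct : c ≠ ⊤ := ne_top_of_le_ne_top
    (ENNReal.mul_ne_top (hGt ε hε).ne ENNReal.ofReal_ne_top) (hG.setLIntegral_Ioc_le ε R)
  obtain ⟨R', hR', hmin⟩ : ∃ R', R ≤ R' ∧
      min ((∫⁻ s in Ioi R, F s) / 2) c ≤ ∫⁻ s in Ioc R R', F s := by
    rcases eq_or_ne (∫⁻ s in Ioi R, F s) 0 with h0 | h0
    · exact ⟨R, le_rfl, by simp [h0]⟩
    have hlt : min ((∫⁻ s in Ioi R, F s) / 2) c < ∫⁻ s in Ioi R, F s := by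
      rcases eq_or_ne (∫⁻ s in Ioi R, F s) ⊤ with ht | ht
      · rw [ht]
        exact (min_le_right _ _).trans_lt hct.lt_top
      · exact (min_le_left _ _).trans_lt (ENNReal.half_lt_self h0 ht)
    have hatn : NullSingletonClass ((volume.restrict (Ioi R)).withDensity F) :=
      ⟨fun x => withDensity_absolutelyContinuous _ _ (measure_singleton x)⟩
    have hlim := tendsto_measure_Iic_atTop ((volume.restrict (Ioi R)).withDensity F)
    rw [withDensity_apply _ MeasurableSet.univ, Measure.restrict_univ] at hlim
    obtain ⟨R', h1, h2⟩ := ((hlim.eventually (lt_mem_nhds hlt)).and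
      (eventually_ge_atTop R)).exists
    refine ⟨R', h2, ?_⟩
    rw [withDensity_apply _ measurableSet_Iic, Measure.restrict_restrict measurableSet_Iic,
      inter_comm, Ioi_inter_Iic] at h1
    exact h1.le
  refine ⟨R', hR', fun t ht htR => ?_⟩
  rw [setLIntegral_Ioc_add_Ioc F htR hR']
  rcases min_le_iff.1 hmin with h | h
  · calc ∫⁻ s in Ioc t R, G s ≤ ∫⁻ s in Ioi t, G s := lintegral_mono_set Ioc_subset_Ioi_self
      _ ≤ ∫⁻ s in Ioi t, F s := hmaj t (hε.trans_le ht)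
      _ = (∫⁻ s in Ioc t R, F s) + ((∫⁻ s in Ioi R, F s) / 2 + (∫⁻ s in Ioi R, F s) / 2) := by
          rw [ENNReal.add_halves, setLIntegral_Ioc_add_Ioi F htR]
      _ ≤ ((∫⁻ s in Ioc t R, F s) + ∫⁻ s in Ioc t R, F s) +
          ((∫⁻ s in Ioc R R', F s) + ∫⁻ s in Ioc R R', F s) := by
          gcongr
          exact le_self_add
      _ = _ := by ring
  · calc ∫⁻ s in Ioc t R, G s ≤ c := lintegral_mono_set (Ioc_subset_Ioc_left ht)
      _ ≤ (∫⁻ s in Ioc t R, F s) + ∫⁻ s in Ioc R R', F s := h.trans le_add_self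
      _ ≤ _ := by
          rw [two_mul]
          exact le_self_add

theorem lintegral_ivolume_of_forall_eq_zero {α : ℝ≥0∞} {h : ℝ → ℝ≥0∞}
    (h0 : ∀ x, ¬ (0 < x ∧ ENNReal.ofReal x < α) → h x = 0) :
    ∫⁻ x, h x ∂(ivolume α) = ∫⁻ x, h x := by
  rw [ivolume, ← lintegral_indicator (measurableSet_interval α)]
  congr 1
  rw [indicator_eq_self]
  intro x hx
  by_contra hn
  exact hx (h0 x hn)

/-- If the tails of `G` are dominated by those of `F`, then on the set where `F < G`, cut off at
`ε` and `R`, a quarter of Lebesgue measure is the image under a map `ψ` of a measure `w du` with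
`w ≤ 1`, `w = F / (G ∘ ψ)` and `w` of bounded support. The map is the monotone transport, matching
right tails, of part of the mass `F` onto a quarter of the mass `G`. -/
theorem exists_right_transport {α : ℝ≥0∞} {F G : ℝ → ℝ≥0∞} (hF : Antitone F) (hG : Antitone G)
    (hFα : ∀ x, α ≤ ENNReal.ofReal x → F x = 0) (hGα : ∀ x, α ≤ ENNReal.ofReal x → G x = 0)
    (hFt : ∀ x, 0 < x → F x < ⊤) (hGt : ∀ x, 0 < x → G x < ⊤)
    (hmaj : ∀ x, 0 < x → ∫⁻ s in Ioi x, G s ≤ ∫⁻ s in Ioi x, F s) {ε R : ℝ} (hε : 0 < ε)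
    (hεR : ε ≤ R) :
    ∃ (ψ : ℝ → ℝ) (w : ℝ → ℝ≥0∞) (R' : ℝ), Measurable ψ ∧ Measurable w ∧
      (∀ᵐ u ∂(ivolume α), w u ≤ 1 ∧ w u * G (ψ u) ≤ F u ∧
        (w u ≠ 0 → u ∈ Ioc 0 R' ∧ ψ u ∈ {s | F s < G s} ∩ Ioc ε R)) ∧
      ∀ k : ℝ → ℝ≥0∞, Measurable k →
        ∫⁻ s in {s | F s < G s} ∩ Ioc ε R, k s / 4 ∂(ivolume α) ≤
          ∫⁻ u, w u * k (ψ u) ∂(ivolume α) := by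
  obtain ⟨R', hRR', hR'⟩ := exists_setLIntegral_le_two_mul hG hGt hmaj (R := R) hε
  set Hs : Set ℝ := {s | F s < G s} ∩ Ioc ε R with hHs
  have hHm : MeasurableSet Hs :=
    (measurableSet_lt hF.measurable hG.measurable).inter measurableSet_Ioc
  have hG4 : Measurable fun s => G s / 4 := hG.measurable.div_const 4
  have hHG : ∀ s ∈ Hs, G s ≠ 0 ∧ G s ≠ ⊤ := fun s hs =>
    ⟨(zero_le.trans_lt hs.1).ne', (hGt s (hε.trans hs.2.1)).ne⟩
  set μ₀ : Measure ℝ := (volume.restrict (Ioc ε R')).withDensity F with hμ₀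
  set ν : Measure ℝ := (volume.restrict Hs).withDensity fun s => G s / 4 with hν
  have hatμ₀ : NullSingletonClass μ₀ :=
    ⟨fun x => withDensity_absolutelyContinuous _ _ (measure_singleton x)⟩
  have hatν : NullSingletonClass ν :=
    ⟨fun x => withDensity_absolutelyContinuous _ _ (measure_singleton x)⟩
  have hμ₀univ : μ₀ univ = ∫⁻ s in Ioc ε R', F s := by
    rw [hμ₀, withDensity_apply _ MeasurableSet.univ, Measure.restrict_univ]
  have hμ₀fin : IsFiniteMeasure μ₀ := ⟨by
    rw [hμ₀univ]
    exact (hF.setLIntegral_Ioc_le ε R').trans_lt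
      (ENNReal.mul_lt_top (hFt ε hε) ENNReal.ofReal_lt_top)⟩
  have hνapply : ∀ B, MeasurableSet B → ν B = (∫⁻ s in B ∩ Hs, G s) / 4 := fun B hB => by
    rw [hν, withDensity_apply _ hB, Measure.restrict_restrict hB]
    simp_rw [div_eq_mul_inv]
    rw [lintegral_mul_const _ hG.measurable]
  have hνuniv : ν univ ≤ μ₀ univ := by
    rw [hνapply _ MeasurableSet.univ, hμ₀univ, univ_inter]
    refine ENNReal.div_le_of_le_mul ?_
    calc ∫⁻ s in Hs, G s ≤ ∫⁻ s in Ioc ε R, G s := lintegral_mono_set inter_subset_right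
      _ ≤ 2 * ∫⁻ s in Ioc ε R', F s := hR' ε le_rfl hεR
      _ ≤ (∫⁻ s in Ioc ε R', F s) * 4 := by
          rw [mul_comm]
          gcongr
          norm_num
  have hνfin : IsFiniteMeasure ν := ⟨hνuniv.trans_lt (measure_lt_top μ₀ _)⟩
  -- the upper set `A` carries the right part of the mass `F` that has the total mass of `ν`
  set A : Set ℝ := {x | μ₀ (Iic x) ≤ μ₀ univ - ν univ}ᶜ with hA
  have hAm : MeasurableSet A :=
    (measurableSet_le measure_Iic_mono.measurable measurable_const).compl
  have hAup : ∀ x ∈ A, ∀ y, x ≤ y → y ∈ A := fun x hx y hxy hy =>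
    hx ((measure_Iic_mono hxy).trans hy)
  set μ : Measure ℝ := μ₀.restrict A with hμ
  have hμuniv : μ univ = ν univ := by
    rw [hμ, Measure.restrict_apply_univ, hA, measure_compl hAm.of_compl (measure_ne_top _ _),
      measure_setOf_measure_Iic_le (fun x => measure_ne_top _ _) tsub_le_self]
    exact ENNReal.sub_sub_cancel (measure_ne_top _ _) hνuniv
  obtain ⟨ψ, hψm, hmap, hψ⟩ := exists_transport (μ := μ) (ν := ν)
    (fun x => measure_ne_top _ _) (fun x => measure_ne_top _ _) hμuniv.le
  have hmapeq : μ.map ψ = ν := Measure.eq_of_le_of_measure_univ_eq hmap (by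
    rw [Measure.map_apply hψm MeasurableSet.univ, preimage_univ, hμuniv])
  have hμIoi : ∀ u ∈ A ∩ Ioc ε R', μ (Ioi u) = ∫⁻ s in Ioc u R', F s := by
    intro u hu
    have h1 : Ioi u ∩ A = Ioi u := inter_eq_left.2 fun x hx => hAup u hu.1 x hx.le
    have h2 : Ioi u ∩ Ioc ε R' = Ioc u R' := by
      ext x
      exact ⟨fun h => ⟨h.1, h.2.2⟩, fun h => ⟨h.1, hu.2.1.trans h.1, h.2⟩⟩
    rw [hμ, Measure.restrict_apply measurableSet_Ioi, h1, hμ₀,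
      withDensity_apply _ measurableSet_Ioi, Measure.restrict_restrict measurableSet_Ioi, h2]
  have hsupp : ∀ᵐ u ∂μ, u ∈ A ∩ Ioc ε R' := by
    have h1 : ∀ᵐ u ∂μ, u ∈ A := ae_restrict_mem hAm
    have h2 : ∀ᵐ u ∂μ₀, u ∈ Ioc ε R' :=
      (withDensity_absolutelyContinuous _ _).ae_le (ae_restrict_mem measurableSet_Ioc)
    filter_upwards [h1, ae_restrict_of_ae h2] with u h1 h2 using ⟨h1, h2⟩
  have hψH : ∀ᵐ u ∂μ, ψ u ∈ Hs := by
    have h1 : ∀ᵐ s ∂ν, s ∈ Hs :=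
      (withDensity_absolutelyContinuous _ _).ae_le (ae_restrict_mem hHm)
    rw [← hmapeq] at h1
    exact ae_of_ae_map hψm.aemeasurable h1
  have hkey : ∀ᵐ u ∂μ, F u ≤ G (ψ u) ∧ u ∈ Ioc 0 R' ∧ ψ u ∈ Hs := by
    filter_upwards [hψ, hsupp, hψH, ae_measure_Iic_lt_univ (μ := μ) fun x => measure_ne_top _ _]
      with u hu hus hψs hulast
    refine ⟨?_, ⟨hε.trans hus.2.1, hus.2.2⟩, hψs⟩
    by_contra hlt
    have hlt := not_le.1 hlt
    have hIoi : ∀ (ρ : Measure ℝ) [IsFiniteMeasure ρ] (x : ℝ), ρ (Ioi x) = ρ univ - ρ (Iic x) :=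
      fun ρ _ x => by
        rw [← compl_Iic, measure_compl measurableSet_Iic (measure_ne_top _ _)]
    have htail : ∫⁻ s in Ioc u R', F s = (∫⁻ s in Ioi (ψ u) ∩ Hs, G s) / 4 := by
      rw [← hμIoi u hus, ← hνapply _ measurableSet_Ioi, hIoi, hIoi, hu.2, hμuniv]
    have hpos : ∫⁻ s in Ioc u R', F s ≠ 0 := by
      rw [← hμIoi u hus, hIoi]
      exact (tsub_pos_of_lt hulast).ne'
    have hfin : ∫⁻ s in Ioc u R', F s ≠ ⊤ := by
      rw [← hμIoi u hus]
      exact measure_ne_top _ _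
    -- if `G (ψ u) < F u`, then the mass of `F` beyond `u` is at most half of itself
    have hle : ∫⁻ s in Ioi (ψ u) ∩ Hs, G s ≤ 2 * ∫⁻ s in Ioc u R', F s := by
      rcases le_or_gt (ψ u) u with hsu | hsu
      · -- on `[ψ u, u]` one has `G ≤ G (ψ u) < F u ≤ F`
        have hsub : Ioi (ψ u) ∩ Hs ⊆ Ioc u R := by
          rintro x ⟨hx1, hx2⟩
          refine ⟨?_, hx2.2.2⟩
          by_contra hxu
          have h1 : G x ≤ F x := (hG (le_of_lt hx1)).trans (hlt.le.trans (hF (not_lt.1 hxu)))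
          exact absurd hx2.1 (not_lt.2 h1)
        refine (lintegral_mono_set hsub).trans ?_
        rcases le_total u R with huR | huR
        · exact hR' u hus.2.1.le huR
        · rw [Ioc_eq_empty (not_lt.2 huR)]
          simp
      · have hsub : Ioi (ψ u) ∩ Hs ⊆ Ioc (ψ u) R := fun x hx => ⟨hx.1, hx.2.2.2⟩
        refine (lintegral_mono_set hsub).trans ((hR' _ hψs.2.1.le hψs.2.2).trans ?_)
        gcongr
    have h2 : ∫⁻ s in Ioc u R', F s ≤ (∫⁻ s in Ioc u R', F s) / 2 := by
      calc ∫⁻ s in Ioc u R', F s ≤ (2 * ∫⁻ s in Ioc u R', F s) / 4 := by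
            conv_lhs => rw [htail]
            gcongr
        _ = _ := by
            rw [div_eq_mul_inv, div_eq_mul_inv, mul_comm 2, mul_assoc]
            congr 1
            rw [show (4 : ℝ≥0∞) = 2 * 2 by norm_num, ENNReal.mul_inv (by simp) (by simp),
              ← mul_assoc, ENNReal.mul_inv_cancel two_ne_zero ENNReal.ofNat_ne_top, one_mul]
    exact absurd h2 (not_le.2 (ENNReal.half_lt_self hpos hfin))
  set U : Set ℝ := A ∩ Ioc ε R' with hU
  have hUm : MeasurableSet U := hAm.inter measurableSet_Ioc
  have hμU : μ = (volume.restrict U).withDensity F := by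
    rw [hμ, hμ₀, restrict_withDensity hAm, Measure.restrict_restrict hAm]
  set w : ℝ → ℝ≥0∞ := U.indicator fun u => F u / G (ψ u) with hw
  have hwm : Measurable w := (hF.measurable.div (hG.measurable.comp hψm)).indicator hUm
  have hwF : ∀ u, F u = 0 → w u = 0 := fun u hu => by
    rw [hw, indicator_apply]
    split_ifs
    · rw [hu, ENNReal.zero_div]
    · rfl
  refine ⟨ψ, w, R', hψm, hwm, ?_, fun k hk => ?_⟩
  · rw [hμU, ae_withDensity_iff hF.measurable, ae_restrict_iff' hUm] at hkey
    filter_upwards [ae_restrict_of_ae hkey] with u hu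
    by_cases huU : u ∈ U
    · rcases eq_or_ne (F u) 0 with h0 | h0
      · simp [hwF u h0]
      · obtain ⟨h1, h2, h3⟩ := hu huU h0
        obtain ⟨h4, h5⟩ := hHG _ h3
        have hwu : w u = F u / G (ψ u) := indicator_of_mem huU _
        refine ⟨?_, ?_, fun _ => ⟨h2, h3⟩⟩
        · rw [hwu]
          exact ENNReal.div_le_of_le_mul (by rwa [one_mul])
        · rw [hwu, ENNReal.div_mul_cancel h4 h5]
    · have hwu : w u = 0 := indicator_of_notMem huU _
      simp [hwu]
  · have hdm : Measurable fun x => k x / G x := hk.div hG.measurable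
    refine le_of_eq ?_
    calc ∫⁻ s in Hs, k s / 4 ∂(ivolume α) = ∫⁻ s in Hs, k s / 4 := by
          rw [← lintegral_indicator hHm, ← lintegral_indicator hHm]
          refine lintegral_ivolume_of_forall_eq_zero fun x hx => ?_
          rw [indicator_of_notMem]
          intro hxH
          have hx0 : 0 < x := hε.trans hxH.2.1
          have hGx := hGα x (not_lt.1 fun h => hx ⟨hx0, h⟩)
          exact (hHG x hxH).1 hGx
      _ = ∫⁻ s in Hs, G s / 4 * (k s / G s) := by
          refine setLIntegral_congr_fun hHm fun s hs => ?_
          obtain ⟨h4, h5⟩ := hHG s hs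
          rw [div_eq_mul_inv, div_eq_mul_inv, div_eq_mul_inv]
          calc k s * 4⁻¹ = k s * 4⁻¹ * (G s * (G s)⁻¹) := by
                rw [ENNReal.mul_inv_cancel h4 h5, mul_one]
            _ = _ := by ring
      _ = ∫⁻ s, k s / G s ∂ν :=
          (lintegral_withDensity_eq_lintegral_mul _ hG4 hdm).symm
      _ = ∫⁻ u, k (ψ u) / G (ψ u) ∂μ := by rw [← hmapeq, lintegral_map hdm hψm]
      _ = ∫⁻ u in U, F u * (k (ψ u) / G (ψ u)) := by
          rw [hμU]
          exact lintegral_withDensity_eq_lintegral_mul _ hF.measurable (hdm.comp hψm)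
      _ = ∫⁻ u, w u * k (ψ u) := by
          rw [← lintegral_indicator hUm]
          refine lintegral_congr fun u => ?_
          rw [hw]
          by_cases hu : u ∈ U
          · rw [indicator_of_mem hu, indicator_of_mem hu]
            simp_rw [div_eq_mul_inv]
            ring
          · rw [indicator_of_notMem hu, indicator_of_notMem hu, zero_mul]
      _ = ∫⁻ u, w u * k (ψ u) ∂(ivolume α) := by
          refine (lintegral_ivolume_of_forall_eq_zero fun x hx => ?_).symm
          have hwx : w x = 0 := by
            by_cases hxU : x ∈ U
            · have hx0 : 0 < x := hε.trans hxU.2.1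
              exact hwF x (hFα x (not_lt.1 fun h => hx ⟨hx0, h⟩))
            · exact indicator_of_notMem hxU _
          rw [hwx, zero_mul]

/-! ### Concavity and the Fatou property -/

namespace SymmetricSpace

variable {𝕜 : Type*} [RCLike 𝕜] {α : ℝ≥0∞} {E : SymmetricSpace 𝕜 α}

theorem DomBy.of_forall_gt {h : ℝ → ℝ≥0∞} (hm : Measurable h) {c : ℝ}
    (H : ∀ d, c < d → E.DomBy h d) : E.DomBy h c := by
  have h1 := (H (c + 1) (lt_add_one c))
  exact (domBy_of_toFn_mem hm h1.ae_lt_top (h1.toFn_mem hm).1).mono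
    (Eventually.of_forall fun _ => le_rfl)
    (le_of_forall_gt_imp_ge_of_dense fun d hd => ((H d hd).toFn_mem hm).2)

/-- In a `q`-concave space, equidistributed functions are controlled by their power means,
uniformly in the number of functions. -/
theorem QConcave.exists_domBy {q : ℝ} (hq : 0 < q) (H : E.QConcave q) : ∃ C : ℝ, 0 < C ∧
    ∀ (n : ℕ) [NeZero n] (h : Fin n → ℝ → ℝ≥0∞) (b c : ℝ), (∀ i, Measurable (h i)) →
      (∀ i, E.DomBy (h i) b) →
      (∀ i s, ivolume α {x | s < h i x} = ivolume α {x | s < h 0 x}) →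
      E.DomBy (fun s => ((∑ i, h i s ^ q) / n) ^ (1 / q)) c → E.DomBy (h 0) (C * c) := by
  obtain ⟨C, hC⟩ := H
  refine ⟨max C 1, by positivity, fun n _ h b c hm hb hd hc => ?_⟩
  have hn : (0 : ℝ) < n := by exact_mod_cast NeZero.pos n
  have hnt : (n : ℝ≥0∞) ≠ ⊤ := ENNReal.natCast_ne_top n
  have hn0 : (n : ℝ≥0∞) ≠ 0 := by exact_mod_cast (NeZero.pos n).ne'
  set x : Fin n → Fn 𝕜 α := fun i => toFn 𝕜 α (h i) (hm i) with hx
  have hxm : ∀ i, x i ∈ E.carrier := fun i => ((hb i).toFn_mem (hm i)).1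
  have hxe : ∀ i, ∀ᵐ s ∂(ivolume α), ‖x i s‖ₑ = h i s := fun i =>
    enorm_toFn (h i) (hm i) (hb i).ae_lt_top
  have hxq : ∀ i, E.qnorm (x i) = E.qnorm (x 0) := fun i =>
    (toFn_mem_of_distr_eq (hxm 0) (hm i) (hb i).ae_lt_top fun s => by
      rw [hd i s, measure_lt_congr_ae (hxe 0)]).2
  have h0 := E.qnorm_nonneg _ (hxm 0)
  have hc0 := hc.nonneg
  have h1 := hC n x hxm
  simp only [hxq, Finset.sum_const, Finset.card_univ, Fintype.card_fin, nsmul_eq_mul] at h1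
  rw [Real.mul_rpow hn.le (by positivity), ← Real.rpow_mul h0, mul_one_div_cancel hq.ne',
    Real.rpow_one] at h1
  have h2 : E.qnorm (powSum q x) ≤ (n : ℝ) ^ (1 / q) * c := by
    refine (domBy_enorm_iff.1 ((hc.const_mul (r := (n : ℝ) ^ (1 / q)) (by positivity)).mono ?_
      le_rfl)).2
    filter_upwards [enorm_powSum hq x, ae_all_iff.2 hxe] with s h3 h4
    rw [h3]
    simp only [h4]
    rw [← ENNReal.ofReal_rpow_of_nonneg hn.le (by positivity), ENNReal.ofReal_natCast,
      ← ENNReal.mul_rpow_of_nonneg _ _ (by positivity), ENNReal.mul_div_cancel hn0 hnt]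
  have h3 : (n : ℝ) ^ (1 / q) * E.qnorm (x 0) ≤ (n : ℝ) ^ (1 / q) * (max C 1 * c) :=
    calc _ ≤ C * E.qnorm (powSum q x) := h1
      _ ≤ max C 1 * ((n : ℝ) ^ (1 / q) * c) :=
          mul_le_mul (le_max_left _ _) h2 (E.qnorm_nonneg _ (powSum_mem hq hxm)) (by positivity)
      _ = _ := by ring
  have h4 : E.qnorm (x 0) ≤ max C 1 * c := le_of_mul_le_mul_left h3 (by positivity)
  exact (domBy_enorm_iff.2 ⟨hxm 0, h4⟩).mono ((hxe 0).mono fun s hs => hs.ge) le_rfl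

/-- In a `q`-concave space, right majorization controls the part of `g^*` where `g^* > f^*`, cut off
near `0` and `∞`: by transport this part has, up to constants, the distribution of functions whose
power mean is close to `f^*`. -/
theorem QConcave.exists_domBy_indicator {q : ℝ} (hq : 0 < q) (H : E.QConcave q) :
    ∃ C : ℝ, 0 < C ∧ ∀ f ∈ E.carrier, ∀ g : Fn 𝕜 α, MemLZero g →
      (∀ t, 0 < t → ∫⁻ s in Ioi t, rearrFn g s ^ q ≤ ∫⁻ s in Ioi t, rearrFn f s ^ q) →
      ∀ ε R : ℝ, 0 < ε → ε ≤ R →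
      E.DomBy (({s | rearrFn f s < rearrFn g s} ∩ Ioc ε R).indicator (rearrFn g))
        (C * E.qnorm f) := by
  obtain ⟨C, hC, H⟩ := H.exists_domBy hq
  obtain ⟨C', hC', H'⟩ := exists_domBy_of_distr_le_mul E 4
  obtain ⟨K, hK1, hK⟩ := exists_quasi_const E
  have hq' : 0 < 1 / q := by positivity
  refine ⟨2 * C' * (C * (2 ^ (1 / q) * K)), by positivity, fun f hf g hg hmaj ε R hε hεR => ?_⟩
  have hf0 := E.memLZero f hf
  have hgm := measurable_rearrFn g
  have hfm := measurable_rearrFn f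
  obtain ⟨ψ, w, R', hψ, hw, hwG, hmap⟩ := exists_right_transport (α := α)
    ((rearrFn_antitone f).rpow hq.le) ((rearrFn_antitone g).rpow hq.le)
    (fun x hx => by
      rw [rearrFn, rearr_eq_zero _ hx, ENNReal.zero_rpow_of_pos hq])
    (fun x hx => by
      rw [rearrFn, rearr_eq_zero _ hx, ENNReal.zero_rpow_of_pos hq])
    (fun x hx => ENNReal.rpow_lt_top_of_nonneg hq.le (rearrFn_lt_top hf0 hx).ne)
    (fun x hx => ENNReal.rpow_lt_top_of_nonneg hq.le (rearrFn_lt_top hg hx).ne) hmaj hε hεR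
  have hset : {s | rearrFn f s ^ q < rearrFn g s ^ q} = {s | rearrFn f s < rearrFn g s} := by
    ext s
    exact ENNReal.rpow_lt_rpow_iff hq
  rw [hset] at hwG hmap
  set Hs : Set ℝ := {s | rearrFn f s < rearrFn g s} ∩ Ioc ε R with hHs
  have hHm : MeasurableSet Hs := (measurableSet_lt hfm hgm).inter measurableSet_Ioc
  have hgε : rearrFn g ε ≠ ⊤ := (rearrFn_lt_top hg hε).ne
  have hHg : ∀ s ∈ Hs, rearrFn g s ≠ 0 ∧ rearrFn g s ≠ ⊤ ∧ rearrFn g s ≤ rearrFn g ε :=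
    fun s hs => ⟨(zero_le.trans_lt hs.1).ne', (rearrFn_lt_top hg (hε.trans hs.2.1)).ne,
      rearrFn_antitone g hs.2.1.le⟩
  set j : ℝ → ℤ := fun u => dyadicExp (rearrFn g (ψ u)) with hj
  have hjm : Measurable j := measurable_dyadicExp.comp (hgm.comp hψ)
  -- a dominated majorant, on the support of `w`, of the truncation errors below
  obtain ⟨B, hB⟩ := SymmetricSpace.exists_domBy_indicator E R'
  have hB' := hB.const_mul (r := (rearrFn g ε).toReal) ENNReal.toReal_nonneg
  rw [ENNReal.ofReal_toReal hgε] at hB'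
  set B' := (rearrFn g ε).toReal * B with hBdef
  have hB'0 : 0 ≤ B' := hB'.nonneg
  -- the copies of `g^*` supplied by an average with `M` terms
  have hmain : ∀ d, C * (2 ^ (1 / q) * K) * E.qnorm f < d →
      E.DomBy (Hs.indicator fun s => rearrFn g s / 2) (C' * d) := by
    intro d hd
    obtain ⟨M, hM0, hMd⟩ : ∃ M : ℕ, M ≠ 0 ∧ C * (2 ^ (1 / q) * (K * (E.qnorm f +
        ((M : ℝ) ^ (1 / q))⁻¹ * B'))) ≤ d := by
      have h1 : Tendsto (fun M : ℕ => C * (2 ^ (1 / q) * (K * (E.qnorm f +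
          ((M : ℝ) ^ (1 / q))⁻¹ * B')))) atTop (𝓝 (C * (2 ^ (1 / q) * (K * (E.qnorm f +
          0 * B'))))) :=
        (((((tendsto_rpow_atTop hq').comp tendsto_natCast_atTop_atTop).inv_tendsto_atTop.mul_const
          B').const_add _).const_mul _ |>.const_mul _ |>.const_mul _)
      have h2 : C * (2 ^ (1 / q) * (K * (E.qnorm f + 0 * B'))) < d := by
        refine lt_of_eq_of_lt ?_ hd
        ring
      obtain ⟨M, h3, h4⟩ := ((h1.eventually (gt_mem_nhds h2)).and (eventually_ne_atTop 0)).exists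
      exact ⟨M, h4, h3.le⟩
    have : NeZero M := ⟨hM0⟩
    have hMpos : (0 : ℝ) < M := by exact_mod_cast Nat.pos_of_ne_zero hM0
    have hMt : (M : ℝ≥0∞) ≠ ⊤ := ENNReal.natCast_ne_top M
    have hM0' : (M : ℝ≥0∞) ≠ 0 := by exact_mod_cast hM0
    -- `a / M` is `w` rounded up to a multiple of `1 / M`, and vanishes where `w` does
    set a : ℝ → ℕ := fun s => min ⌈((M : ℝ≥0∞) * w s).toReal⌉₊ M with ha
    have ham : Measurable a :=
      (Nat.measurable_ceil.comp (hw.const_mul _).ennreal_toReal).min measurable_const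
    have hwt : ∀ u, w u ≤ 1 → (M : ℝ≥0∞) * w u ≠ ⊤ := fun u hu =>
      ENNReal.mul_ne_top hMt (hu.trans_lt ENNReal.one_lt_top).ne
    have haw : ∀ᵐ u ∂(ivolume α), w u ≤ (a u : ℝ≥0∞) / M := by
      filter_upwards [hwG] with u hu
      have hMw : (M : ℝ≥0∞) * w u ≤ M := by
        calc (M : ℝ≥0∞) * w u ≤ M * 1 := by gcongr; exact hu.1
          _ = M := mul_one _
      have h1 : (a u : ℝ≥0∞) = min (⌈((M : ℝ≥0∞) * w u).toReal⌉₊ : ℝ≥0∞) M := by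
        rw [ha]
        exact (Nat.mono_cast (α := ℝ≥0∞)).map_min
      rw [ENNReal.le_div_iff_mul_le (Or.inl hM0') (Or.inl hMt), mul_comm, h1]
      refine le_min ?_ hMw
      calc (M : ℝ≥0∞) * w u = ENNReal.ofReal ((M : ℝ≥0∞) * w u).toReal :=
            (ENNReal.ofReal_toReal (hwt u hu.1)).symm
        _ ≤ ENNReal.ofReal (⌈((M : ℝ≥0∞) * w u).toReal⌉₊ : ℝ) :=
            ENNReal.ofReal_le_ofReal (Nat.le_ceil _)
        _ = _ := ENNReal.ofReal_natCast _
    have hwa : ∀ᵐ u ∂(ivolume α), (a u : ℝ≥0∞) / M ≤ w u + 1 / M ∧ (w u = 0 → a u = 0) := by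
      filter_upwards [hwG] with u hu
      constructor
      · rw [ENNReal.div_le_iff_le_mul (Or.inl hM0') (Or.inl hMt), add_mul,
          ENNReal.div_mul_cancel hM0' hMt, mul_comm (w u)]
        calc (a u : ℝ≥0∞) ≤ (⌈((M : ℝ≥0∞) * w u).toReal⌉₊ : ℝ≥0∞) := by
              exact_mod_cast min_le_left _ _
          _ = ENNReal.ofReal (⌈((M : ℝ≥0∞) * w u).toReal⌉₊ : ℝ) :=
              (ENNReal.ofReal_natCast _).symm
          _ ≤ ENNReal.ofReal (((M : ℝ≥0∞) * w u).toReal + 1) :=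
              ENNReal.ofReal_le_ofReal (Nat.ceil_lt_add_one ENNReal.toReal_nonneg).le
          _ = _ := by
              rw [ENNReal.ofReal_add ENNReal.toReal_nonneg zero_le_one,
                ENNReal.ofReal_toReal (hwt u hu.1), ENNReal.ofReal_one]
      · intro h0
        simp [ha, h0]
    obtain ⟨P, hPm, hPsum, hPdist⟩ := exists_average α j hjm M a ham fun s => min_le_right _ _
    set h : Fin M → ℝ → ℝ≥0∞ := fun i => (P i).indicator fun u => dyadic (j u) with hh
    have hhm : ∀ i, Measurable (h i) := fun i =>
      (measurable_dyadic.comp hjm).indicator (hPm i)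
    have hset : ∀ i σ, {x | σ < h i x} = j ⁻¹' {m | σ < dyadic m} ∩ P i := by
      intro i σ
      ext x
      by_cases hx : x ∈ P i
      · simp [hh, hx]
      · simp [hh, hx]
    have hsum : ∀ u, ∑ i, h i u ^ q = a u * dyadic (j u) ^ q := fun u => by
      rw [← sum_indicator_eq_natCast_mul (hPsum u)]
      refine Finset.sum_congr rfl fun i _ => ?_
      by_cases hi : u ∈ P i
      · simp [hh, hi]
      · simp [hh, hi, hq]
    have hdy : ∀ᵐ u ∂(ivolume α), w u ≠ 0 → dyadic (j u) ≤ rearrFn g (ψ u) ∧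
        dyadic (j u) ≤ rearrFn g ε * (Ioc 0 R').indicator (fun _ => 1) u := by
      filter_upwards [hwG] with u hu h0
      obtain ⟨h1, h2⟩ := hu.2.2 h0
      obtain ⟨h3, h4, h5⟩ := hHg _ h2
      rw [indicator_of_mem h1, mul_one]
      exact ⟨dyadic_le h3 h4, (dyadic_le h3 h4).trans h5⟩
    have hbd : ∀ i, E.DomBy (h i) B' := by
      intro i
      refine hB'.mono ?_ le_rfl
      filter_upwards [hdy, hwa] with u h1 h2
      rcases eq_or_ne (w u) 0 with h0 | h0
      · have h3 := hsum u
        rw [h2.2 h0, Nat.cast_zero, zero_mul, Finset.sum_eq_zero_iff] at h3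
        have h4 := (ENNReal.rpow_eq_zero_iff_of_pos hq).1 (h3 i (Finset.mem_univ i))
        rw [h4]
        exact zero_le
      · exact (indicator_le_self' (fun _ _ => zero_le) u).trans (h1 h0).2
    have hmean : E.DomBy (fun u => ((∑ i, h i u ^ q) / M) ^ (1 / q))
        (2 ^ (1 / q) * (K * (E.qnorm f + ((M : ℝ) ^ (1 / q))⁻¹ * B'))) := by
      refine (((domBy_rearr hf).add hK hK1 (hB'.const_mul
        (r := ((M : ℝ) ^ (1 / q))⁻¹) (by positivity))).const_mul
        (r := 2 ^ (1 / q)) (by positivity)).mono ?_ le_rfl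
      filter_upwards [hdy, hwa, hwG] with u h1 h2 h3
      rcases eq_or_ne (w u) 0 with h0 | h0
      · rw [hsum, h2.2 h0, Nat.cast_zero, zero_mul, ENNReal.zero_div,
          ENNReal.zero_rpow_of_pos hq']
        exact zero_le
      · obtain ⟨h4, h5⟩ := h1 h0
        set I := rearrFn g ε * (Ioc 0 R').indicator (fun _ => 1) u with hI
        rw [hsum, ENNReal.ofReal_inv_of_pos (by positivity),
          ← ENNReal.ofReal_rpow_of_nonneg hMpos.le hq'.le, ENNReal.ofReal_natCast,
          ← ENNReal.ofReal_rpow_of_nonneg zero_le_two hq'.le, ENNReal.ofReal_ofNat,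
          ← ENNReal.inv_rpow]
        calc ((a u : ℝ≥0∞) * dyadic (j u) ^ q / M) ^ (1 / q)
            ≤ (rearrFn f u ^ q + (M : ℝ≥0∞)⁻¹ * I ^ q) ^ (1 / q) := by
              refine ENNReal.rpow_le_rpow ?_ hq'.le
              calc (a u : ℝ≥0∞) * dyadic (j u) ^ q / M
                  = (a u : ℝ≥0∞) / M * dyadic (j u) ^ q := by
                    rw [div_eq_mul_inv, div_eq_mul_inv]
                    ring
                _ ≤ (w u + 1 / M) * dyadic (j u) ^ q := by
                    gcongr
                    exact h2.1
                _ = w u * dyadic (j u) ^ q + (M : ℝ≥0∞)⁻¹ * dyadic (j u) ^ q := by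
                    rw [add_mul, one_div]
                _ ≤ w u * rearrFn g (ψ u) ^ q + (M : ℝ≥0∞)⁻¹ * I ^ q := by gcongr
                _ ≤ _ := by
                    gcongr
                    exact h3.2.1
          _ ≤ 2 ^ (1 / q) * ((rearrFn f u ^ q) ^ (1 / q) +
                ((M : ℝ≥0∞)⁻¹ * I ^ q) ^ (1 / q)) :=
              ENNReal.add_rpow_le_two_rpow_mul _ _ hq'
          _ = _ := by
              rw [ENNReal.mul_rpow_of_nonneg _ _ hq'.le, ← ENNReal.rpow_mul, ← ENNReal.rpow_mul,
                mul_one_div_cancel hq.ne', ENNReal.rpow_one, ENNReal.rpow_one]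
              rfl
    have h0 := H M h B' _ hhm hbd (fun i σ => by rw [hset, hset, hPdist, hPdist]) hmean
    refine H' (h 0) _ d ((hgm.div_const 2).indicator hHm) (fun σ => ?_)
      (h0.mono (Eventually.of_forall fun _ => le_rfl) hMd)
    -- the distribution of each copy is at least a quarter of that of `g^* / 2` on `Hs`
    have hDm : MeasurableSet {s | σ < dyadic (dyadicExp (rearrFn g s))} :=
      measurableSet_lt measurable_const (measurable_dyadic.comp (measurable_dyadicExp.comp hgm))
    have hsub : {x | σ < Hs.indicator (fun s => rearrFn g s / 2) x} ⊆
        {s | σ < dyadic (dyadicExp (rearrFn g s))} ∩ Hs := by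
      intro x hx
      have hx : σ < Hs.indicator (fun s => rearrFn g s / 2) x := hx
      have hxH : x ∈ Hs := by
        by_contra hn
        rw [indicator_of_notMem hn] at hx
        exact not_lt_zero hx
      rw [indicator_of_mem hxH] at hx
      refine ⟨hx.trans_le (ENNReal.div_le_of_le_mul ?_), hxH⟩
      rw [mul_comm]
      exact le_two_mul_dyadic (hHg x hxH).2.1
    have hle := hmap ({s | σ < dyadic (dyadicExp (rearrFn g s))}.indicator fun _ => 1)
      (measurable_const.indicator hDm)
    have hleft : ∫⁻ s in Hs, {s | σ < dyadic (dyadicExp (rearrFn g s))}.indicator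
        (fun _ => (1 : ℝ≥0∞)) s / 4 ∂(ivolume α) =
        ivolume α ({s | σ < dyadic (dyadicExp (rearrFn g s))} ∩ Hs) / 4 := by
      simp_rw [div_eq_mul_inv]
      rw [lintegral_mul_const _ (measurable_const.indicator hDm), lintegral_indicator hDm,
        setLIntegral_one, Measure.restrict_apply hDm]
    have hright : ∫⁻ u, w u * {s | σ < dyadic (dyadicExp (rearrFn g s))}.indicator
        (fun _ => (1 : ℝ≥0∞)) (ψ u) ∂(ivolume α) ≤ ivolume α {x | σ < h 0 x} := by
      rw [hset, hPdist, ← lintegral_indicator (hjm (MeasurableSet.of_discrete))]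
      refine lintegral_mono_ae ?_
      filter_upwards [haw] with u hu
      by_cases hs : u ∈ j ⁻¹' {m | σ < dyadic m}
      · have hs' : ψ u ∈ {s | σ < dyadic (dyadicExp (rearrFn g s))} := hs
        rw [indicator_of_mem hs, indicator_of_mem hs', mul_one]
        exact hu
      · have hs' : ψ u ∉ {s | σ < dyadic (dyadicExp (rearrFn g s))} := hs
        rw [indicator_of_notMem hs', mul_zero]
        exact zero_le
    have h4 := (hleft.symm.le.trans hle).trans hright
    calc _ ≤ ivolume α ({s | σ < dyadic (dyadicExp (rearrFn g s))} ∩ Hs) := measure_mono hsub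
      _ = 4 * (ivolume α ({s | σ < dyadic (dyadicExp (rearrFn g s))} ∩ Hs) / 4) :=
          (ENNReal.mul_div_cancel (by simp) ENNReal.ofNat_ne_top).symm
      _ ≤ _ := by
          push_cast
          gcongr
  have hm2 : Measurable (Hs.indicator fun s => rearrFn g s / 2) :=
    (hgm.div_const 2).indicator hHm
  have hlim : E.DomBy (Hs.indicator fun s => rearrFn g s / 2)
      (C' * (C * (2 ^ (1 / q) * K) * E.qnorm f)) := by
    refine DomBy.of_forall_gt hm2 fun d hd => ?_
    refine (hmain (d / C') (by rwa [lt_div_iff₀ hC', mul_comm])).mono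
      (Eventually.of_forall fun _ => le_rfl) (le_of_eq (by field_simp))
  refine (hlim.const_mul (r := 2) zero_le_two).mono (Eventually.of_forall fun s => ?_)
    (le_of_eq (by ring))
  rw [ENNReal.ofReal_ofNat]
  by_cases hs : s ∈ Hs
  · rw [indicator_of_mem hs, indicator_of_mem hs,
      ENNReal.mul_div_cancel two_ne_zero ENNReal.ofNat_ne_top]
  · rw [indicator_of_notMem hs]
    exact zero_le

/-- Where `g^* ≤ f^*` there is nothing to do; the rest of `g^*` is exhausted by its cut-offs to
`(1 / (n + 1), n + 1]`. -/
theorem rightMonotone_of_fatou_of_qConcave {q : ℝ} (hq : 0 < q) (hE : E.Fatou)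
    (H : E.QConcave q) : E.RightMonotone q := by
  obtain ⟨C, hC, H⟩ := H.exists_domBy_indicator hq
  obtain ⟨K, hK1, hK⟩ := exists_quasi_const E
  refine rightMonotone_of_domBy hq (C := K * (1 + C)) (by positivity) fun f hf g hg hmaj => ?_
  have hgm := measurable_rearrFn g
  have hSm : MeasurableSet {s | rearrFn f s < rearrFn g s} :=
    measurableSet_lt (measurable_rearrFn f) hgm
  have hε : ∀ n : ℕ, (0 : ℝ) < 1 / (n + 1) := fun n => by positivity
  have hεR : ∀ n : ℕ, (1 : ℝ) / (n + 1) ≤ n + 1 := fun n => by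
    rw [div_le_iff₀ (by positivity)]
    nlinarith [(Nat.cast_nonneg n : (0 : ℝ) ≤ n)]
  have hS : E.DomBy ({s | rearrFn f s < rearrFn g s}.indicator (rearrFn g)) (C * E.qnorm f) := by
    refine Fatou.domBy_of_tendsto hE
      (h := fun n : ℕ => ({s | rearrFn f s < rearrFn g s} ∩
        Ioc (1 / ((n : ℝ) + 1)) ((n : ℝ) + 1)).indicator (rearrFn g))
      (fun n => hgm.indicator (hSm.inter measurableSet_Ioc)) ?_
      (fun n => H f hf g hg hmaj _ _ (hε n) (hεR n)) (hgm.indicator hSm) ?_ ?_ ?_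
    · intro s m n hmn
      have hmn' : (m : ℝ) ≤ n := by exact_mod_cast hmn
      refine indicator_le_indicator_of_subset (inter_subset_inter_right _ (Ioc_subset_Ioc ?_ ?_))
        (fun _ => zero_le) s
      · gcongr
      · gcongr
    · exact ae_ivolume_of_forall_pos fun s hs =>
        (indicator_le_self' (fun _ _ => zero_le) s).trans_lt (rearrFn_lt_top hg hs)
    · exact (finiteDistr_rearrFn hg).mono_ae (Eventually.of_forall fun s =>
        indicator_le_self' (fun _ _ => zero_le) s)
    · refine ae_ivolume_of_forall_pos fun s hs => ?_
      refine tendsto_const_nhds.congr' ?_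
      obtain ⟨N, hN⟩ := exists_nat_one_div_lt hs
      obtain ⟨N', hN'⟩ := exists_nat_ge s
      filter_upwards [eventually_ge_atTop N, eventually_ge_atTop N'] with n hn hn'
      have hsn : s ∈ Ioc (1 / ((n : ℝ) + 1)) ((n : ℝ) + 1) := by
        have h1 : (N : ℝ) ≤ n := by exact_mod_cast hn
        have h2 : (N' : ℝ) ≤ n := by exact_mod_cast hn'
        refine ⟨lt_of_le_of_lt ?_ hN, by linarith⟩
        gcongr
      by_cases h : s ∈ {s | rearrFn f s < rearrFn g s}
      · rw [indicator_of_mem h, indicator_of_mem (show s ∈ _ ∩ _ from ⟨h, hsn⟩)]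
      · rw [indicator_of_notMem h, indicator_of_notMem fun h' => h h'.1]
  refine ((domBy_rearr hf).add hK hK1 hS).mono (Eventually.of_forall fun s => ?_)
    (le_of_eq (by ring))
  by_cases h : s ∈ {s | rearrFn f s < rearrFn g s}
  · rw [indicator_of_mem h]
    exact le_add_self
  · exact (not_lt.1 h).trans le_self_add

end SymmetricSpace

theorem mainTheorem6 {𝕜 : Type*} [RCLike 𝕜] {α : ℝ≥0∞} (hα : 0 < α)
    (E : SymmetricSpace 𝕜 α) {p q : ℝ} (hp : 0 < p) (hpq : p < q)
    (hP : E.LeftMonotone p ∨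
      ENNReal.ofReal p < 1 / E.upperBoyd ∨
      (E.Fatou ∧ E.PConvex p) ∨
      E.IsInterpolation (ENNReal.ofReal p) ∞)
    (hQ : E.RightMonotone q ∨
      1 / E.lowerBoyd < ENNReal.ofReal q ∨
      (E.Fatou ∧ E.QConcave q)) :
    E.IsInterpolation (ENNReal.ofReal p) (ENNReal.ofReal q) := by
  have hq : 0 < q := hp.trans hpq
  have hL : E.LeftMonotone p := by
    rcases hP with h | h | ⟨hF, h⟩ | h
    · exact h
    · exact SymmetricSpace.leftMonotone_of_lt_upperBoyd hp h
    · exact SymmetricSpace.leftMonotone_of_fatou_of_pConvex hα hp hF h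
    · exact SymmetricSpace.leftMonotone_of_isInterpolation_top hp h
  have hR : E.RightMonotone q := by
    rcases hQ with h | h | ⟨hF, h⟩
    · exact h
    · exact SymmetricSpace.rightMonotone_of_lowerBoyd_lt hq h
    · exact SymmetricSpace.rightMonotone_of_fatou_of_qConcave hq hF h
  exact SymmetricSpace.isInterpolation_of_monotone hp hpq hL hR
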